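/- Let $d\ge 1$ and let $\Gamma_0$ be the set of finite subsets of $\mathbb R^d$. For $F:\Gamma_0\to\mathbb R$ put $\int F\,d\lambda_{z\sigma}=\sum_{n\ge 0}\frac{z^n}{n!}\int_{\mathbb R^{dn}}F(\{x_1,\dots,x_n\})\,dx_1\cdots dx_n$, and $\lambda_\sigma=\lambda_{1\sigma}$. **Potential.** Let $\phi:[0,\infty)\to\mathbb R\cup\{+\infty\}$ be continuous on $(0,\infty)$ with $\phi(0)=+\infty$, and suppose that there are $0<r_1<r_0<r_2$, $\varphi_1,\varphi_2>0$, $s\ge d$, $\varepsilon_0>0$ such that $\phi=\phi^+$ on $(0,r_0]$, $\phi^+(r)\ge\varphi_1r^{-s}$ for $0<r<r_1$, $\phi=-\phi^-$ on $(r_0,\infty)$, and $\phi^-(r)\le\varphi_2r^{-d-\varepsilon_0}$ for $r>r_2$, where $\phi^\pm$ are the positive and negative parts. For $\beta>0$ put $U(\gamma)=\sum_{\{x,y\}\subset\gamma}\phi(|x-y|)$, $W(x;\gamma)=\sum_{y\in\gamma}\phi(|x-y|)$, $C_{xy}=e^{-\beta\phi(|x-y|)}-1$, $K(x;\xi)=\prod_{y\in\xi}C_{xy}$,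 $\nu_\beta(x)=|e^{-\beta\phi(|x|)}-1|$, $\nu_1(\beta)=\int\nu_\beta$, $\nu_0(\beta)=\sup\nu_\beta$, $\tilde\nu_0(\beta)=\max(1,\nu_0(\beta))$. **$j$-PTCF.** For $z>0$ and a cut-off $j\in C_0^\infty(\mathbb R^d)$, $0\le j\le 1$, let $\chi_j(\eta)=\prod_{x\in\eta}j(x)$, $Z_j=\int\chi_je^{-\beta U}d\lambda_{z\sigma}$, $\rho_j(\eta)=\frac{z^{|\eta|}}{Z_j}\int\chi_j(\eta\cup\gamma)e^{-\beta U(\eta\cup\gamma)}\lambda_{z\sigma}(d\gamma)$, and $$\tilde\rho^T_{j;m}(\eta_1;\dots;\eta_m)=\sum_{\{J_1,\dots,J_k\}}(-1)^{k-1}(k-1)!\prod_{l=1}^k\rho_j\Big(\bigcup_{i\in J_l}\eta_i\Big),$$ the sum running over the partitions of $\{1,\dots,m\}$ into nonempty sets. The clusters $\eta_i\in\Gamma_0$ are always pairwise disjoint. **The system.** Let $B\ge 0$ satisfy $U(\gamma)\ge -B|\gamma|$ for all $\gamma\in\Gamma_0$ (stability). A *selection* assigns to each nonempty $\eta\in\Gamma_0$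 a point $x_1\in\eta$ with $W(x_1;\eta\setminus\{x_1\})\ge -2B$. Given a selection and a function $j:\mathbb R^d\to[0,1]$, the Kirkwood–Salsburg-type system for $(\rho_k)_{1\le k\le m}$ consists of $\rho_1(\emptyset)=1$, of $\rho_k(\eta_1;\dots;\eta_k)=0$ if $k\ge 2$ and some $\eta_i=\emptyset$, and, for $1\le k\le m$, $\eta_1\ne\emptyset$, $\eta_1'=\eta_1\setminus\{x_1\}$, of $$\rho_k(\eta_1;\dots;\eta_k)=z\,e^{-\beta W(x_1;\eta_1')}j(x_1)\sum_{I\subset\{2,\dots,k\}}\ \sum^{*}_{\xi\subset\eta_I}\int K(x_1;\xi\cup\gamma)\,\rho_{k-|I|}(\eta_1'\cup\eta_I\cup\gamma;\eta_{\{2,\dots,k\}\setminus I})\,\lambda_\sigma(d\gamma),$$ where $\eta_I=\bigcup_{i\in I}\eta_i$ and $*$ means $\xi\cap\eta_i\neq\emptyset$ for all $i\in I$. Solutions are considered in the class $\mathcal E$ of families such that, for fixed $\eta_2,\dots,\eta_k$, $\rho_k$ is measurable in $\eta_1$ and $|\rho_k(\eta_1;\dots;\eta_k)|\le c\,\nu_1(\beta)^{-|\eta_1|}$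 with $c$ independent of $\eta_1$. **Kernels.** The kernel equations are: $T_m(\eta_1;\dots;\eta_m|\gamma)=0$ if $\gamma$ meets some $\eta_i$; $T_1(\emptyset|\emptyset)=1$ and $T_1(\emptyset|\gamma)=0$ for $\gamma\ne\emptyset$; $T_m=0$ if $m\ge2$ and some $\eta_i=\emptyset$; and, if $\eta_1\neq\emptyset$ and $\gamma$ meets no $\eta_i$, $$T_m(\eta_1;\dots;\eta_m|\gamma)=z\,e^{-\beta W(x_1;\eta_1')}\sum_{\xi\subset\gamma}\sum_{I\subset\{2,\dots,m\}}\sum^*_{\zeta\subset\eta_I}K(x_1;\zeta\cup\xi)\,T_{m-|I|}(\eta_1'\cup\eta_I\cup\xi;\eta_{\{2,\dots,m\}\setminus I}|\gamma\setminus\xi).$$ **Forest graphs.** Let the $\eta_i$ be nonempty and $\gamma$ disjoint from them; put $l_i=|\eta_i|$, $l=\sum_il_i$. The blocks are $\eta_1,\dots,\eta_m$ and the one-point sets $\{y\}$, $y\in\gamma$. $\mathfrak S(\eta_1;\dots;\eta_m|\gamma)$ is the set of graphs $f$ on $\bigcup_i\eta_i\cup\gamma$ without edges inside a block, such that contracting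 every block to a vertex gives a tree and, when this tree is rooted at $\eta_1$, all edges of $f$ from a parent block $a$ to a child block $b$ have the same endpoint in $a$. Given a selection, explore $f$ as follows: at first the points of $\eta_1$ are active; in each step, if $x$ is the selected point of the set of active points, $x$ is deactivated for good, and all points of those not yet reached blocks that contain a neighbour of $x$ become active. Let $E^+(f)$ be the set of pairs $\{x,y\}$ such that $y\ne x$ is active when $x$ is selected. **Theorem.** There is $B\ge0$ for which stability holds, $\nu_\beta$ is integrable and bounded, and $\nu_1(\beta)>0$. For every $B\ge 0$ for which stability holds there is a selection, and for every $z>0$ with $$z\,e^{2\beta B+2}\nu_1(\beta)<1$$ there are kernels $T_m(\eta_1;\dots;\eta_m|\gamma)$, $m\ge1$, with the following properties. 1. For every selection they are the unique solution of the kernel equations, and they are $\lambda_\sigma$-integrable in $\gamma$. 2. For every selection, $m\ge2$, nonempty $\eta_i$, and $\gamma$ disjoint from the $\eta_i$: $$T_m(\eta_1;\dots;\eta_m|\gamma)=\sum_{f\in\mathfrak S(\eta_1;\dots;\eta_m|\gamma)}z^{l+|\gamma|}\prod_{\{x,y\}\in E(f)}C_{xy}\prod_{\{x,y\}\in E^+(f)}e^{-\beta\phi(|x-y|)}.$$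 3. For $m\ge2$ and nonempty $\eta_i$: $|T_m(\eta_1;\dots;\eta_m|\gamma)|\le z^{l+|\gamma|}q(\gamma)$ for $\gamma$ disjoint from the $\eta_i$, with $q(\gamma)=e^{2\beta B(l+|\gamma|)}\sum_{f\in\mathfrak S}\prod_{\{x,y\}\in E(f)}\nu_\beta(x-y)$; the functions $q(\{y_1,\dots,y_n\})$ are integrable on $\mathbb R^{dn}$, and the power series $\sum_n\frac{z^{l+n}}{n!}\int q(\{y_1,\dots,y_n\})\,dy_1\cdots dy_n$ converges. 4. For every selection and $m\ge2$, the functions $$\tilde\rho^T_k(\eta_1;\dots;\eta_k)=\int T_k(\eta_1;\dots;\eta_k|\gamma)\,\lambda_\sigma(d\gamma),\qquad 1\le k\le m,$$ are the unique solution in $\mathcal E$ of the system with $j=1$. 5. For every cut-off $j$, selection and $m\ge2$, the $j$-PTCF are the unique solution in $\mathcal E$ of the system with $j$, and $\tilde\rho^T_{j;k}(\eta_1;\dots;\eta_k)=\int\chi_j(\bigcup_i\eta_i\cup\gamma)T_k(\eta_1;\dots;\eta_k|\gamma)\lambda_\sigma(d\gamma)$ for all $k\ge1$. If cut-offs $j_n$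 converge pointwise to $1$, then $\tilde\rho^T_{j_n;m}\to\tilde\rho^T_m$ pointwise for all $m\ge2$. 6. For all $m\ge2$: $$|\tilde\rho^T_m(\eta_1;\dots;\eta_m)|\le(2ze^{2\beta B+1})^l\,\tilde\nu_0(\beta)^{l-l_1}\,l^{m-2}\sum_{n=0}^\infty\big(ze^{2\beta B+2}\nu_1(\beta)\big)^n.$$ -/

import Mathlib

open MeasureTheory Filter Topology
open scoped ContDiff Classical

noncomputable section

namespace PTCF

/-- Position space `ℝ^d` with its Euclidean norm. -/
abbrev Pt (d : ℕ) := EuclideanSpace ℝ (Fin d)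

/-! ### Potential and energies -/

/-- Positive part `φ⁺`. -/
def posPart (φ : ℝ → EReal) (r : ℝ) : EReal := max 0 (φ r)

/-- Negative part `φ⁻`. -/
def negPart (φ : ℝ → EReal) (r : ℝ) : EReal := -(min 0 (φ r))

/-- Assumption (A): `φ : [0,∞) → ℝ ∪ {+∞}` (only the values at `r ≥ 0` matter) is continuous on
`(0,∞)`, infinite at `0`, has a repulsive core and a fast decaying attractive tail. -/
structure AssumptionA (d : ℕ) (φ : ℝ → EReal) : Prop where
  ne_bot : ∀ r, 0 ≤ r → φ r ≠ ⊥
  cont : ContinuousOn φ (Set.Ioi 0)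
  zero : φ 0 = ⊤
  core_tail : ∃ r₁ r₀ r₂ φ₁ φ₂ s ε : ℝ, 0 < r₁ ∧ r₁ < r₀ ∧ r₀ < r₂ ∧ 0 < φ₁ ∧ 0 < φ₂ ∧
    (d : ℝ) ≤ s ∧ 0 < ε ∧
    (∀ r, 0 < r → r ≤ r₀ → φ r = posPart φ r) ∧
    (∀ r, 0 < r → r < r₁ → ((φ₁ * r ^ (-s) : ℝ) : EReal) ≤ posPart φ r) ∧
    (∀ r, r₀ < r → φ r = -negPart φ r) ∧
    (∀ r, r₂ < r → negPart φ r ≤ ((φ₂ * r ^ (-(d : ℝ) - ε) : ℝ) : EReal))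

/-- The real number `e^{-β a}` for an energy `a ∈ ℝ ∪ {+∞}` (it is `0` at `a = +∞`). -/
def boltz (β : ℝ) (a : EReal) : ℝ := (EReal.exp (-((β : EReal) * a))).toReal

/-- A function of the distance, as a function on unordered pairs of points. -/
def onPair {d : ℕ} {α : Type} (g : ℝ → α) : Sym2 (Pt d) → α :=
  Sym2.lift ⟨fun x y => g (dist x y), fun x y => by simp only [dist_comm]⟩

/-- Energy `U(γ)`: sum of the pair potential over all two-point subsets of `γ`. -/
def energyU {d : ℕ} (φ : ℝ → EReal) (γ : Finset (Pt d)) : EReal :=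
  ∑ e ∈ γ.sym2 with ¬ e.IsDiag, onPair φ e

/-- Energy `W(x; γ)` of interaction of the point `x` with `γ`. -/
def energyW {d : ℕ} (φ : ℝ → EReal) (x : Pt d) (γ : Finset (Pt d)) : EReal :=
  ∑ y ∈ γ, φ (dist x y)

/-- Stability `U(γ) ≥ -B |γ|`. -/
def IsStable (d : ℕ) (φ : ℝ → EReal) (B : ℝ) : Prop :=
  ∀ γ : Finset (Pt d), ((-(B * γ.card) : ℝ) : EReal) ≤ energyU φ γ

/-- Mayer factor `e^{-βφ(r)} - 1`. -/
def mayer (φ : ℝ → EReal) (β r : ℝ) : ℝ := boltz β (φ r) - 1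

/-- `ν_β(x) = |e^{-βφ(|x|)} - 1|`. -/
def nu (d : ℕ) (φ : ℝ → EReal) (β : ℝ) (x : Pt d) : ℝ := |mayer φ β ‖x‖|

/-- `ν₁(β) = ∫ ν_β`. -/
def nu1 (d : ℕ) (φ : ℝ → EReal) (β : ℝ) : ℝ := ∫ x : Pt d, nu d φ β x

/-- `ν₀(β) = sup ν_β`. -/
def nu0 (d : ℕ) (φ : ℝ → EReal) (β : ℝ) : ℝ := ⨆ x : Pt d, nu d φ β x

/-- `max (1, ν₀(β))`. -/
def nu0Tilde (d : ℕ) (φ : ℝ → EReal) (β : ℝ) : ℝ := max 1 (nu0 d φ β)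

/-- `K(x; ξ) = ∏_{y ∈ ξ} (e^{-βφ(|x-y|)} - 1)`. -/
def kerK {d : ℕ} (φ : ℝ → EReal) (β : ℝ) (x : Pt d) (ξ : Finset (Pt d)) : ℝ :=
  ∏ y ∈ ξ, mayer φ β (dist x y)

/-! ### Lebesgue–Poisson integration over finite configurations

Finite (simple) configurations are finite sets of points. -/

/-- `∫ F dλ_{zσ} = ∑ₙ zⁿ/n! ∫ F({x₁,…,xₙ}) dx₁⋯dxₙ`. -/
def lpIntegral {d : ℕ} (z : ℝ) (F : Finset (Pt d) → ℝ) : ℝ :=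
  ∑' n : ℕ, z ^ n / n.factorial * ∫ x : Fin n → Pt d, F (Finset.univ.image x)

/-- Integrability with respect to the Lebesgue–Poisson measure `λ_σ`. -/
def LPIntegrable {d : ℕ} (F : Finset (Pt d) → ℝ) : Prop :=
  (∀ n : ℕ, Integrable fun x : Fin n → Pt d => F (Finset.univ.image x)) ∧
    Summable fun n : ℕ => 1 / (n.factorial : ℝ) * ∫ x : Fin n → Pt d, |F (Finset.univ.image x)|

/-! ### Smoothed correlation functions and their partial truncations -/

/-- Cut-off functions: nonnegative elements of `C₀^∞(ℝ^d)` bounded by one. -/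
structure IsCutoff {d : ℕ} (j : Pt d → ℝ) : Prop where
  smooth : ContDiff ℝ ∞ j
  compact : HasCompactSupport j
  nonneg : ∀ x, 0 ≤ j x
  le_one : ∀ x, j x ≤ 1

/-- `χ_j(η) = ∏_{x ∈ η} j(x)`. -/
def chi {d : ℕ} (j : Pt d → ℝ) (η : Finset (Pt d)) : ℝ := ∏ x ∈ η, j x

/-- Partition function `Z_j`. -/
def partFun {d : ℕ} (φ : ℝ → EReal) (β z : ℝ) (j : Pt d → ℝ) : ℝ :=
  lpIntegral z fun γ => chi j γ * boltz β (energyU φ γ)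

/-- Smoothed correlation function `ρ_j(η)`. -/
def corr {d : ℕ} (φ : ℝ → EReal) (β z : ℝ) (j : Pt d → ℝ) (η : Finset (Pt d)) : ℝ :=
  z ^ η.card / partFun φ β z j *
    lpIntegral z fun γ => chi j (η ∪ γ) * boltz β (energyU φ (η ∪ γ))

/-- A hierarchy of functions of `m` clusters, `m = 1, 2, …` (the value at `m = 0` is irrelevant). -/
abbrev Hierarchy (d : ℕ) := (m : ℕ) → (Fin m → Finset (Pt d)) → ℝ

/-- The `j`-PTCF: the `m`-point function is the signed sum over partitions of the set of clusters
`∑_{J₁,…,J_k} (-1)^{k-1} (k-1)! ∏_l ρ_j(⋃_{i ∈ J_l} η_i)`. -/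
def jPTCF {d : ℕ} (φ : ℝ → EReal) (β z : ℝ) (j : Pt d → ℝ) : Hierarchy d := fun m η =>
  ∑ P : Finpartition (Finset.univ : Finset (Fin m)),
    (-1) ^ (P.parts.card - 1) * ((P.parts.card - 1).factorial : ℝ) *
      ∏ J ∈ P.parts, corr φ β z j (J.biUnion η)

/-! ### The Kirkwood–Salsburg-type system -/

/-- The clusters are pairwise disjoint. -/
def DisjointClusters {d m : ℕ} (η : Fin m → Finset (Pt d)) : Prop :=
  Pairwise fun i k => Disjoint (η i) (η k)

/-- Union of all clusters. -/
def allPts {d m : ℕ} (η : Fin m → Finset (Pt d)) : Finset (Pt d) := Finset.univ.biUnion η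

/-- A rule choosing in every nonempty configuration `η` a point `x₁` with
`W(x₁; η ∖ {x₁}) ≥ -2B`. -/
def IsSelection {d : ℕ} (φ : ℝ → EReal) (B : ℝ) (sel : Finset (Pt d) → Pt d) : Prop :=
  ∀ η : Finset (Pt d), η.Nonempty →
    sel η ∈ η ∧ ((-2 * B : ℝ) : EReal) ≤ energyW φ (sel η) (η.erase (sel η))

/-- The subsets `ξ ⊆ ⋃_{i ∈ I} η_i` that meet `η_i` for every `i ∈ I`. -/
def starSubsets {d r : ℕ} (η : Fin r → Finset (Pt d)) (I : Finset (Fin r)) :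
    Finset (Finset (Pt d)) :=
  {ξ ∈ (I.biUnion η).powerset | ∀ i ∈ I, (ξ ∩ η i).Nonempty}

/-- The tuple `(A; η_i, i ∉ I)`, the indices `i ∉ I` in increasing order. -/
def consRest {d r : ℕ} (A : Finset (Pt d)) (η : Fin r → Finset (Pt d)) (I : Finset (Fin r)) :
    Fin (Iᶜ.card + 1) → Finset (Pt d) :=
  Fin.cons A fun k => η (Iᶜ.orderEmbOfFin rfl k)

/-- The Kirkwood–Salsburg-type system for the functions of at most `m` clusters, with cut-off `j`
and with the normalization `ρ₁(∅) = 1` and the vanishing of the functions of two or more clusters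
when one of the clusters is empty. Here `η 0` is the first cluster, `Fin.tail η` lists the others,
and `sel (η 0)` is the distinguished point `x₁` of the first cluster. -/
structure IsKSSolution {d : ℕ} (φ : ℝ → EReal) (β z : ℝ) (j : Pt d → ℝ)
    (sel : Finset (Pt d) → Pt d) (m : ℕ) (ρ : Hierarchy d) : Prop where
  one_empty : ρ 1 (fun _ => ∅) = 1
  some_empty : ∀ k, 2 ≤ k → k ≤ m → ∀ η : Fin k → Finset (Pt d), DisjointClusters η →
    (∃ i, η i = ∅) → ρ k η = 0
  eqn : ∀ r, r + 1 ≤ m → ∀ η : Fin (r + 1) → Finset (Pt d), DisjointClusters η →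
    (η 0).Nonempty →
    ρ (r + 1) η =
      z * boltz β (energyW φ (sel (η 0)) ((η 0).erase (sel (η 0)))) * j (sel (η 0)) *
        ∑ I : Finset (Fin r), ∑ ξ ∈ starSubsets (Fin.tail η) I,
          lpIntegral 1 fun γ => kerK φ β (sel (η 0)) (ξ ∪ γ) *
            ρ (Iᶜ.card + 1)
              (consRest ((η 0).erase (sel (η 0)) ∪ I.biUnion (Fin.tail η) ∪ γ) (Fin.tail η) I)

/-- The class in which solutions are sought: measurable in the first cluster, and growing at most
like `κ^{|η₁|}` in the first cluster when the other clusters are fixed. -/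
structure IsRegularHierarchy {d : ℕ} (κ : ℝ) (m : ℕ) (ρ : Hierarchy d) : Prop where
  meas : ∀ r, r + 1 ≤ m → ∀ η : Fin r → Finset (Pt d), DisjointClusters η →
    ∀ A : Finset (Pt d), (∀ i, Disjoint A (η i)) → ∀ n : ℕ, AEStronglyMeasurable
      (fun x : Fin n → Pt d => ρ (r + 1) (Fin.cons (A ∪ Finset.univ.image x) η)) volume
  bound : ∀ r, r + 1 ≤ m → ∀ η : Fin r → Finset (Pt d), DisjointClusters η →
    ∃ C : ℝ, ∀ A : Finset (Pt d), (∀ i, Disjoint A (η i)) →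
      |ρ (r + 1) (Fin.cons A η)| ≤ C * κ ^ A.card

/-- `ρ` is the unique solution of the system in the class of growth `ν₁(β)^{-|η₁|}`. -/
def IsUniqueKSSolution {d : ℕ} (φ : ℝ → EReal) (β z : ℝ) (j : Pt d → ℝ)
    (sel : Finset (Pt d) → Pt d) (m : ℕ) (ρ : Hierarchy d) : Prop :=
  IsKSSolution φ β z j sel m ρ ∧ IsRegularHierarchy (nu1 d φ β)⁻¹ m ρ ∧
    ∀ ρ' : Hierarchy d, IsKSSolution φ β z j sel m ρ' →
      IsRegularHierarchy (nu1 d φ β)⁻¹ m ρ' →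
      ∀ k, 1 ≤ k → k ≤ m → ∀ η : Fin k → Finset (Pt d), DisjointClusters η → ρ' k η = ρ k η

/-! ### The kernels `T_m` -/

/-- A family of kernels `T_m(η₁;…;η_m | γ)`. -/
abbrev KernelFamily (d : ℕ) := (m : ℕ) → (Fin m → Finset (Pt d)) → Finset (Pt d) → ℝ

/-- The recursion relations and initial conditions for the kernels. -/
structure IsKernel {d : ℕ} (φ : ℝ → EReal) (β z : ℝ) (sel : Finset (Pt d) → Pt d)
    (T : KernelFamily d) : Prop where
  overlap : ∀ m (η : Fin m → Finset (Pt d)) γ, ¬ Disjoint γ (allPts η) → T m η γ = 0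
  one_empty : T 1 (fun _ => ∅) ∅ = 1
  one_empty_of_nonempty : ∀ γ : Finset (Pt d), γ.Nonempty → T 1 (fun _ => ∅) γ = 0
  some_empty : ∀ m, 2 ≤ m → ∀ (η : Fin m → Finset (Pt d)) γ, (∃ i, η i = ∅) → T m η γ = 0
  recursion : ∀ r (η : Fin (r + 1) → Finset (Pt d)) γ, DisjointClusters η →
    Disjoint γ (allPts η) → (η 0).Nonempty →
    T (r + 1) η γ =
      z * boltz β (energyW φ (sel (η 0)) ((η 0).erase (sel (η 0)))) *
        ∑ ξ ∈ γ.powerset, ∑ I : Finset (Fin r), ∑ ζ ∈ starSubsets (Fin.tail η) I,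
          kerK φ β (sel (η 0)) (ζ ∪ ξ) *
            T (Iᶜ.card + 1)
              (consRest ((η 0).erase (sel (η 0)) ∪ I.biUnion (Fin.tail η) ∪ ξ) (Fin.tail η) I)
              (γ \ ξ)

/-! ### Forest graphs

A graph is given by its finite set of edges. -/

/-- The vertex sets that are contracted: the clusters `η_i` and the single points of `γ`. -/
def block {d m : ℕ} (η : Fin m → Finset (Pt d)) (γ : Finset (Pt d)) :
    Fin m ⊕ {y // y ∈ γ} → Finset (Pt d) :=
  Sum.elim η fun y => {y.1}

/-- The graph obtained from `f` by contracting every cluster to one vertex. -/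
def contracted {d m : ℕ} (η : Fin m → Finset (Pt d)) (γ : Finset (Pt d))
    (f : Finset (Sym2 (Pt d))) : SimpleGraph (Fin m ⊕ {y // y ∈ γ}) where
  Adj a b := a ≠ b ∧ ∃ x ∈ block η γ a, ∃ y ∈ block η γ b, s(x, y) ∈ f
  symm := ⟨fun _ _ ⟨h, x, hx, y, hy, hf⟩ => ⟨h.symm, y, hy, x, hx, Sym2.eq_swap ▸ hf⟩⟩
  loopless := ⟨fun _ h => h.1 rfl⟩

/-- Forest graphs over the clusters `η` and the points of `γ`: no edge lies inside a cluster,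
contraction of the clusters gives a tree, and, with this tree rooted at the first cluster, all edges
from a block `a` to a block `b` next to it and farther from the root start from one and the same
point of `a`. (Such a graph has no cycles, since contraction gives a tree and edges between
neighbouring blocks form a star.) -/
structure IsForestGraph {d m : ℕ} [NeZero m] (η : Fin m → Finset (Pt d)) (γ : Finset (Pt d))
    (f : Finset (Sym2 (Pt d))) : Prop where
  edges : ∀ e ∈ f, ∃ a b, a ≠ b ∧ ∃ x ∈ block η γ a, ∃ y ∈ block η γ b, e = s(x, y)
  tree : (contracted η γ f).IsTree
  star : ∀ a b, (contracted η γ f).dist (Sum.inl 0) a < (contracted η γ f).dist (Sum.inl 0) b →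
    ∀ x ∈ block η γ a, ∀ x' ∈ block η γ a, ∀ y ∈ block η γ b, ∀ y' ∈ block η γ b,
      s(x, y) ∈ f → s(x', y') ∈ f → x = x'

/-- The finite set of all forest graphs. -/
def forests {d m : ℕ} [NeZero m] (η : Fin m → Finset (Pt d)) (γ : Finset (Pt d)) :
    Finset (Finset (Sym2 (Pt d))) :=
  {f ∈ (allPts η ∪ γ).sym2.powerset | IsForestGraph η γ f}

/-- Exploration of the graph `f`: `A` is the set of active points, `R` the set of points not yet
reached. The selected active point `x` is joined to all other active points; then `x` is removed,
and the points of `R` which are neighbours of `x` in `f`, together with the clusters they belong to,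
become active. The value is the set of all edges added in the first `N` steps. -/
def exploreEdges {d m : ℕ} (sel : Finset (Pt d) → Pt d) (η : Fin m → Finset (Pt d))
    (f : Finset (Sym2 (Pt d))) : ℕ → Finset (Pt d) → Finset (Pt d) → Finset (Sym2 (Pt d))
  | 0, _, _ => ∅
  | N + 1, A, R =>
    if A = ∅ then ∅ else
      let x := sel A
      let new := {y ∈ R | ∃ u ∈ R, s(x, u) ∈ f ∧ (u = y ∨ ∃ i, u ∈ η i ∧ y ∈ η i)}
      (A.erase x).image (fun y => s(x, y)) ∪ exploreEdges sel η f N (A.erase x ∪ new) (R \ new)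

/-- The edges added to the forest graph `f` to obtain the maximal graph `f*`: the exploration starts
from the first cluster and removes one of the `l + |γ|` points in every step. -/
def addedEdges {d m : ℕ} [NeZero m] (sel : Finset (Pt d) → Pt d) (η : Fin m → Finset (Pt d))
    (γ : Finset (Pt d)) (f : Finset (Sym2 (Pt d))) : Finset (Sym2 (Pt d)) :=
  exploreEdges sel η f ((∑ i, (η i).card) + γ.card) (η 0) ((allPts η ∪ γ) \ η 0)

/-- Contribution of `f` to `T_m`:
`z^{l+|γ|} ∏_{xy ∈ E(f)} (e^{-βφ(|x-y|)} - 1) ∏_{xy ∈ E(f*) ∖ E(f)} e^{-βφ(|x-y|)}`. -/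
def forestTerm {d m : ℕ} [NeZero m] (φ : ℝ → EReal) (β z : ℝ) (sel : Finset (Pt d) → Pt d)
    (η : Fin m → Finset (Pt d)) (γ : Finset (Pt d)) (f : Finset (Sym2 (Pt d))) : ℝ :=
  z ^ ((∑ i, (η i).card) + γ.card) * (∏ e ∈ f, onPair (mayer φ β) e) *
    ∏ e ∈ addedEdges sel η γ f, onPair (fun r => boltz β (φ r)) e

/-- Coefficient (independent of `z`) of `z^{l+|γ|}` in the power series dominating `T_m`:
`e^{2βB(l+|γ|)} ∑_f ∏_{xy ∈ E(f)} ν_β(x-y)`. -/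
def majorantCoeff {d m : ℕ} [NeZero m] (φ : ℝ → EReal) (β B : ℝ)
    (η : Fin m → Finset (Pt d)) (γ : Finset (Pt d)) : ℝ :=
  Real.exp (2 * β * B) ^ ((∑ i, (η i).card) + γ.card) *
    ∑ f ∈ forests η γ, ∏ e ∈ f, onPair (fun r => |mayer φ β r|) e

end PTCF

end

open PTCF

/-! Everything rests on one recursion for functions of a root set A and a set S of disjoint nonempty
blocks (`ClusterRec`). A point x of A is removed at the price of the pair factors p(x,y), y in A \
x, and the blocks of some U ⊆ S are absorbed into the root, each with weight ∏_{y∈B} (1 + c(x,y)) -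
1. Every step removes one point, so solutions are unique (`ClusterRec.unique`). The truncation of
e^{-βU} with respect to A and S is a convolution over subsets of S, and it solves the recursion for
every choice of x (`trunc_clusterRec`). With η_1 as root and the other clusters and the single
points of γ as blocks, T_m is this truncation times z^{l+|γ|} (`kern`, `kernelT`); no selection
enters its definition.

The sum over forest graphs, with the exploration factors, solves the same recursion along the
selected points, and uniqueness gives the expansion (`exploredForestSum_clusterRec`,
`kernelT_eq_sum_forests`). By stability some point of the root interacts with the others with energy
at least -2B, so each removal costs at most e^{2βB}, and the truncation is dominated by a sum over
forests of products of ν_β (`abs_trunc_gibbs_le`). Integrated over n single points, that sum is at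
most ν_1^n (2ν̃_0)^p |A| N^{|S|+n-1}, where p counts the points in blocks and N all points: a Cayley
type count, reproduced by the recursion (`lintegral_forestNu_le`). The estimate N^n ≤ n! e^N and one
further factor e^n turn the sum over n into a geometric series of ratio z e^{2βB+2} ν_1 < 1.

Integrating the kernel recursion over γ turns sums over ξ ⊆ γ into double Lebesgue–Poisson
integrals, hence the Kirkwood–Salsburg-type system (`isBlockKS_kernInt`). The truncated correlation
functions solve it too, with activity z j (`isBlockKS_trunc_corr`). Its integral operator has norm
at most z e^{2βB+1} ν_1 < 1 in the growth class, which gives uniqueness by induction on the number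
of clusters (`IsKSSolution.unique`). Hence the j-PTCF are the integrals of χ_j T_m, and dominated
convergence yields the limit j → 1.

Stability itself is proved by comparing, on dyadic cubes, the repulsive core r^{-d} with the
integrable attractive tail (`exists_isStable`). -/

namespace PTCF

/-! ### Set partitions and the inverse for convolution over subsets. -/

section SubsetConvolution

variable {ι : Type*} [DecidableEq ι]

/-- Removing a part from a partition. -/
def removePart {S : Finset ι} (P : Finpartition S) (A : Finset ι) (hA : A ∈ P.parts) :
    Finpartition (S \ A) :=
  Finpartition.ofExistsUnique (P.parts.erase A)
    (fun B hB => by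
      have hB' := Finset.mem_erase.1 hB
      exact Finset.subset_sdiff.2 ⟨P.le hB'.2, P.disjoint hB'.2 hA hB'.1⟩)
    (fun a ha => by
      have ha' := Finset.mem_sdiff.1 ha
      obtain ⟨t, ht, hat⟩ := P.exists_mem ha'.1
      refine ⟨t, ⟨Finset.mem_erase.2 ⟨?_, ht⟩, hat⟩, ?_⟩
      · rintro rfl; exact ha'.2 hat
      · rintro u ⟨hu, hau⟩
        exact P.eq_of_mem_parts (Finset.mem_of_mem_erase hu) ht hau hat)
    (fun h => P.bot_notMem (Finset.mem_of_mem_erase h))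

/-- A partition with a marked part is a nonempty subset together with a partition of its
complement. -/
lemma sum_finpartition_sum_parts {M : Type*} [AddCommMonoid M] (S : Finset ι)
    (F : Finset ι → Finset (Finset ι) → M) :
    ∑ P : Finpartition S, ∑ A ∈ P.parts, F A (P.parts.erase A) =
      ∑ A ∈ S.powerset with A.Nonempty, ∑ P : Finpartition (S \ A), F A P.parts := by
  rw [Finset.sum_sigma', Finset.sum_sigma']
  refine Finset.sum_bij
    (fun t ht => ⟨t.2, removePart t.1 t.2 (Finset.mem_sigma.1 ht).2⟩) ?_ ?_ ?_ ?_
  · rintro ⟨P, A⟩ h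
    have hA := (Finset.mem_sigma.1 h).2
    simp only [Finset.mem_sigma, Finset.mem_filter, Finset.mem_powerset, Finset.mem_univ, and_true]
    exact ⟨P.le hA, P.nonempty_of_mem_parts hA⟩
  · rintro ⟨P, A⟩ h ⟨Q, A'⟩ h' e
    have hA := (Finset.mem_sigma.1 h).2
    have hA' := (Finset.mem_sigma.1 h').2
    have e' := congrArg
      (fun t : (A : Finset ι) × Finpartition (S \ A) => (t.1, t.2.parts)) e
    simp only [removePart, Finpartition.ofExistsUnique_parts, Prod.mk.injEq] at e'
    obtain ⟨rfl, e2⟩ := e'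
    have : P = Q := by
      apply Finpartition.ext
      rw [← Finset.insert_erase hA, e2, Finset.insert_erase hA']
    subst this; rfl
  · rintro ⟨A, P⟩ h
    simp only [Finset.mem_sigma, Finset.mem_filter, Finset.mem_powerset, Finset.mem_univ,
      and_true] at h
    have hAP : A ∉ P.parts := fun hA => by
      obtain ⟨a, ha⟩ := h.2
      exact (Finset.mem_sdiff.1 (P.le hA ha)).2 ha
    refine ⟨⟨P.extend (b := A) (c := S) h.2.ne_empty Finset.sdiff_disjoint
      (Finset.sdiff_union_of_subset h.1), A⟩, ?_, ?_⟩
    · simp [Finpartition.extend]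
    · simp only [Sigma.mk.injEq, heq_eq_eq, true_and]
      apply Finpartition.ext
      simp [removePart, Finpartition.extend, hAP]
  · rintro ⟨P, A⟩ h
    rfl

/-- The inverse of `R` (normalized by `R ∅ = 1`) for the convolution over subsets. -/
def convInv (R : Finset ι → ℝ) (S : Finset ι) : ℝ :=
  ∑ P : Finpartition S, (-1) ^ P.parts.card * (P.parts.card.factorial : ℝ) * ∏ J ∈ P.parts, R J

@[simp] lemma convInv_empty (R : Finset ι → ℝ) : convInv R ∅ = 1 := by
  have : Unique (Finpartition (∅ : Finset ι)) :=
    inferInstanceAs (Unique (Finpartition (⊥ : Finset ι)))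
  have h : (default : Finpartition (∅ : Finset ι)).parts = ∅ :=
    (default : Finpartition (∅ : Finset ι)).parts_eq_empty_iff.2 rfl
  rw [convInv, Fintype.sum_unique, h]
  simp

/-- A nonempty A together with a partition of S \ A is a partition of S with a marked part. A
partition into k+1 parts arises k+1 times, each time with coefficient (-1)^k k!, and (k+1)(-1)^k k!
= -(-1)^(k+1) (k+1)!. -/
lemma sum_mul_convInv_nonempty (R : Finset ι → ℝ) (S : Finset ι) (hS : S.Nonempty) :
    ∑ A ∈ S.powerset with A.Nonempty, R A * convInv R (S \ A) = - convInv R S := by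
  have key := sum_finpartition_sum_parts S
    (fun A π => (-1) ^ π.card * (π.card.factorial : ℝ) * (R A * ∏ J ∈ π, R J))
  have : ∀ A, R A * convInv R (S \ A) = ∑ P : Finpartition (S \ A),
      (-1) ^ P.parts.card * (P.parts.card.factorial : ℝ) * (R A * ∏ J ∈ P.parts, R J) := by
    intro A
    rw [convInv, Finset.mul_sum]
    exact Finset.sum_congr rfl fun P _ => by ring
  simp_rw [this]
  rw [← key, convInv, ← Finset.sum_neg_distrib]
  refine Finset.sum_congr rfl fun P _ => ?_
  have hne : P.parts.Nonempty := by
    obtain ⟨a, ha⟩ := hS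
    obtain ⟨t, ht, -⟩ := P.exists_mem ha
    exact ⟨t, ht⟩
  obtain ⟨k, hk⟩ : ∃ k, P.parts.card = k + 1 :=
    ⟨P.parts.card - 1, by have := hne.card_pos; omega⟩
  rw [Finset.sum_congr rfl (g := fun _ => (-1) ^ k * (k.factorial : ℝ) * ∏ J ∈ P.parts, R J)]
  · rw [Finset.sum_const, hk, Nat.factorial_succ, nsmul_eq_mul]
    push_cast
    ring
  · intro A hA
    rw [Finset.card_erase_of_mem hA, hk, Finset.mul_prod_erase _ _ hA]
    simp

/-- The term A = ∅ is `convInv R S`, because `R ∅ = 1`, and it cancels the nonempty subsets. This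
identity makes truncated functions vanish when one cluster is empty. -/
lemma sum_powerset_mul_convInv (R : Finset ι → ℝ) (h0 : R ∅ = 1) (S : Finset ι) :
    ∑ A ∈ S.powerset, R A * convInv R (S \ A) = if S = ∅ then 1 else 0 := by
  split_ifs with h
  · subst h; simp [h0]
  · rw [← Finset.sum_filter_add_sum_filter_not S.powerset (fun A => A.Nonempty),
      sum_mul_convInv_nonempty R S (Finset.nonempty_iff_ne_empty.2 h)]
    have : S.powerset.filter (fun A => ¬ A.Nonempty) = {∅} := by
      ext A
      simp only [Finset.mem_filter, Finset.mem_powerset, Finset.not_nonempty_iff_eq_empty,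
        Finset.mem_singleton, and_iff_right_iff_imp]
      rintro rfl; simp
    rw [this]
    simp [h0]

/-- The inverse depends on `R` only up to relabelling. -/
lemma convInv_image {κ : Type*} [DecidableEq κ] (R : Finset ι → ℝ) (R' : Finset κ → ℝ) (f : ι → κ)
    (S : Finset ι) (hf : Set.InjOn f S) (h : ∀ U ⊆ S, R' (U.image f) = R U) :
    convInv R' (S.image f) = convInv R S := by
  induction S using Finset.strongInduction with
  | H S ih =>
    rcases S.eq_empty_or_nonempty with rfl | hS
    · simp
    · rw [← neg_inj, ← sum_mul_convInv_nonempty R S hS,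
        ← sum_mul_convInv_nonempty R' (S.image f) (hS.image f)]
      symm
      refine Finset.sum_bij (fun A _ => A.image f) ?_ ?_ ?_ ?_
      · intro A hA
        simp only [Finset.mem_filter, Finset.mem_powerset] at hA ⊢
        exact ⟨Finset.image_subset_image hA.1, hA.2.image f⟩
      · intro A hA A' hA' e
        simp only [Finset.mem_filter, Finset.mem_powerset] at hA hA'
        have e' := congrArg (fun s : Finset κ => (s : Set κ)) e
        simp only [Finset.coe_image] at e'
        exact_mod_cast (hf.image_eq_image_iff (Finset.coe_subset.2 hA.1)
          (Finset.coe_subset.2 hA'.1)).1 e'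
      · intro B hB
        simp only [Finset.mem_filter, Finset.mem_powerset] at hB
        obtain ⟨A, hA, rfl⟩ := Finset.subset_image_iff.1 hB.1
        exact ⟨A, by simpa using ⟨hA, by simpa using hB.2⟩, rfl⟩
      · intro A hA
        simp only [Finset.mem_filter, Finset.mem_powerset] at hA
        have hsd : S.image f \ A.image f = (S \ A).image f := by
          rw [Finset.image_sdiff_of_injOn hf hA.1]
        rw [h A hA.1, hsd, ih (S \ A) (Finset.sdiff_ssubset hA.1 hA.2)
          (hf.mono (by simp)) (fun U hU => h U (hU.trans Finset.sdiff_subset))]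

/-- The signed sum over partitions, expanded with respect to the part containing `a`. -/
lemma sum_finpartition_signed (R : Finset ι → ℝ) (S : Finset ι) (a : ι) (ha : a ∈ S) :
    ∑ P : Finpartition S, (-1) ^ (P.parts.card - 1) * ((P.parts.card - 1).factorial : ℝ) *
        ∏ J ∈ P.parts, R J =
      ∑ U ∈ (S.erase a).powerset, R (insert a U) * convInv R (S.erase a \ U) := by
  -- The marked part is required to contain a. Exactly one part does, so each partition is counted
  -- once, and the k-1 remaining parts carry the coefficient (-1)^(k-1) (k-1)!.
  have key := sum_finpartition_sum_parts S
    (fun A π => if a ∈ A then (-1) ^ π.card * (π.card.factorial : ℝ) * (R A * ∏ J ∈ π, R J) else 0)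
  have h1 : ∀ P : Finpartition S, (-1) ^ (P.parts.card - 1) *
      ((P.parts.card - 1).factorial : ℝ) * ∏ J ∈ P.parts, R J =
      ∑ A ∈ P.parts, if a ∈ A then (-1) ^ (P.parts.erase A).card *
        ((P.parts.erase A).card.factorial : ℝ) * (R A * ∏ J ∈ P.parts.erase A, R J) else 0 := by
    intro P
    obtain ⟨t, ht, hat⟩ := P.exists_mem ha
    rw [Finset.sum_eq_single t]
    · rw [if_pos hat, Finset.card_erase_of_mem ht, Finset.mul_prod_erase _ _ ht]
    · intro B hB hBt
      rw [if_neg fun hB' => hBt (P.eq_of_mem_parts hB ht hB' hat)]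
    · exact fun h => absurd ht h
  simp_rw [h1]
  rw [key, Finset.sum_filter]
  rw [← Finset.sum_subset (s₁ := (S.erase a).powerset.image (insert a))]
  · rw [Finset.sum_image]
    · refine Finset.sum_congr rfl fun U hU => ?_
      have hU' := Finset.mem_powerset.1 hU
      have : S \ insert a U = S.erase a \ U := by
        ext x; simp only [Finset.mem_sdiff, Finset.mem_insert, Finset.mem_erase]; tauto
      rw [if_pos (Finset.insert_nonempty a U), this, convInv, Finset.mul_sum]
      refine Finset.sum_congr rfl fun P _ => ?_
      rw [if_pos (Finset.mem_insert_self a U)]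
      ring
    · intro U hU U' hU' e
      have hU1 := Finset.mem_powerset.1 hU
      have hU2 := Finset.mem_powerset.1 hU'
      have hn : ∀ W ⊆ S.erase a, a ∉ W := fun W hW h => by simpa using hW h
      rw [← Finset.erase_insert (hn U hU1), e, Finset.erase_insert (hn U' hU2)]
  · intro A hA
    obtain ⟨U, hU, rfl⟩ := Finset.mem_image.1 hA
    have hU' := Finset.mem_powerset.1 hU
    exact Finset.mem_powerset.2
      (Finset.insert_subset ha (hU'.trans (Finset.erase_subset _ _)))
  · intro A hA hA'
    have : a ∉ A := fun haA => hA' (Finset.mem_image.2 ⟨A.erase a,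
      Finset.mem_powerset.2 (Finset.erase_subset_erase _ (Finset.mem_powerset.1 hA)),
      Finset.insert_erase haA⟩)
    simp [this]

/-- Chains W ⊆ U ⊆ S correspond to disjoint pairs (W, U \ W). In `trunc_step` this separates the
blocks attached to the removed point from those kept for the next truncation. -/
lemma sum_powerset_powerset {M : Type*} [AddCommMonoid M] (S : Finset ι)
    (F : Finset ι → Finset ι → M) :
    ∑ U ∈ S.powerset, ∑ W ∈ U.powerset, F W (U \ W) =
      ∑ W ∈ S.powerset, ∑ U ∈ (S \ W).powerset, F W U := by
  rw [Finset.sum_sigma', Finset.sum_sigma']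
  refine Finset.sum_bij' (fun t _ => ⟨t.2, t.1 \ t.2⟩) (fun t _ => ⟨t.1 ∪ t.2, t.1⟩) ?_ ?_ ?_ ?_ ?_
  · rintro ⟨U, W⟩ h
    simp only [Finset.mem_sigma, Finset.mem_powerset] at h ⊢
    exact ⟨h.2.trans h.1, Finset.sdiff_subset_sdiff h.1 le_rfl⟩
  · rintro ⟨W, U⟩ h
    simp only [Finset.mem_sigma, Finset.mem_powerset] at h ⊢
    exact ⟨Finset.union_subset h.1 (h.2.trans Finset.sdiff_subset), Finset.subset_union_left⟩
  · rintro ⟨U, W⟩ h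
    simp only [Finset.mem_sigma, Finset.mem_powerset] at h
    simp [Finset.union_sdiff_of_subset h.2]
  · rintro ⟨W, U⟩ h
    simp only [Finset.mem_sigma, Finset.mem_powerset] at h
    have : Disjoint W U := (Finset.subset_sdiff.1 h.2).2.symm
    simp [Finset.union_sdiff_cancel_left this]
  · rintro ⟨U, W⟩ h
    rfl

end SubsetConvolution

/-! ### Block systems, the cluster recursion and truncation. -/

section BlockSystems

variable {V : Type*}

/-- A root set `A` and a set `S` of nonempty blocks, all pairwise disjoint. -/
structure BlockSystem (A : Finset V) (S : Finset (Finset V)) : Prop where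
  nonempty : ∀ B ∈ S, B.Nonempty
  pairwise : ∀ B ∈ S, ∀ B' ∈ S, B ≠ B' → Disjoint B B'
  root : ∀ B ∈ S, Disjoint A B

lemma BlockSystem.mono {A A' : Finset V} {S S' : Finset (Finset V)} (h : BlockSystem A S)
    (hA : A' ⊆ A) (hS : S' ⊆ S) : BlockSystem A' S' :=
  ⟨fun B hB => h.nonempty B (hS hB), fun B hB B' hB' => h.pairwise B (hS hB) B' (hS hB'),
    fun B hB => (h.root B (hS hB)).mono_left hA⟩

variable [DecidableEq V]

/-- The union of all blocks. -/
abbrev pts (S : Finset (Finset V)) : Finset V := S.biUnion id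

lemma pts_union (S S' : Finset (Finset V)) : pts (S ∪ S') = pts S ∪ pts S' :=
  Finset.union_biUnion

lemma pts_union_pts_sdiff {U S : Finset (Finset V)} (h : U ⊆ S) : pts U ∪ pts (S \ U) = pts S := by
  rw [← pts_union, Finset.union_sdiff_of_subset h]

lemma BlockSystem.absorb {A : Finset V} {S U : Finset (Finset V)} (h : BlockSystem A S) {A' : Finset V}
    (hA : A' ⊆ A) (hU : U ⊆ S) : BlockSystem (A' ∪ pts U) (S \ U) := by
  refine ⟨fun B hB => h.nonempty B (Finset.sdiff_subset hB),
    fun B hB B' hB' => h.pairwise B (Finset.sdiff_subset hB) B' (Finset.sdiff_subset hB'),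
    fun B hB => ?_⟩
  have hB' := Finset.mem_sdiff.1 hB
  rw [Finset.disjoint_union_left]
  refine ⟨(h.root B hB'.1).mono_left hA, ?_⟩
  rw [Finset.disjoint_biUnion_left]
  intro C hC
  refine h.pairwise C (hU hC) B hB'.1 ?_
  rintro rfl; exact hB'.2 hC

lemma BlockSystem.disjoint_pts {A : Finset V} {S : Finset (Finset V)} (h : BlockSystem A S) :
    Disjoint A (pts S) := by
  rw [Finset.disjoint_biUnion_right]; exact h.root

/-- The number of points in a block system. -/
def numPts (A : Finset V) (S : Finset (Finset V)) : ℕ := (A ∪ pts S).card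

lemma BlockSystem.absorb_union {A : Finset V} {S U : Finset (Finset V)} (h : BlockSystem A S)
    {x : V} (hx : x ∈ A) (hU : U ⊆ S) :
    (A.erase x ∪ pts U) ∪ pts (S \ U) = (A ∪ pts S).erase x := by
  have hxS : x ∉ pts S := Finset.disjoint_left.1 h.disjoint_pts hx
  rw [Finset.union_assoc, pts_union_pts_sdiff hU]
  ext y
  simp only [Finset.mem_union, Finset.mem_erase]
  constructor
  · rintro (⟨h1, h2⟩ | h1)
    · exact ⟨h1, Or.inl h2⟩
    · exact ⟨fun e => hxS (e ▸ h1), Or.inr h1⟩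
  · rintro ⟨h1, h2 | h2⟩
    · exact Or.inl ⟨h1, h2⟩
    · exact Or.inr h2

/-- Absorption only moves points from blocks to the root, so exactly the removed point is lost. This
is the measure behind most of the inductions below, and it fixes the exponent of e^{2βB}. -/
lemma BlockSystem.numPts_absorb {A : Finset V} {S U : Finset (Finset V)} (h : BlockSystem A S)
    {x : V} (hx : x ∈ A) (hU : U ⊆ S) :
    numPts (A.erase x ∪ pts U) (S \ U) + 1 = numPts A S := by
  rw [numPts, h.absorb_union hx hU, Finset.card_erase_add_one]
  · rfl
  · exact Finset.mem_union_left _ hx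

/-- `∏_{y ∈ B} (1 + c(x,y)) - 1`, the weight of absorbing the block `B` from `x`. -/
def absorbWeight (c : V → V → ℝ) (x : V) (B : Finset V) : ℝ := ∏ y ∈ B, (1 + c x y) - 1

/-- The recursion obtained by removing a point `x` of the root with `Q A x`. -/
structure ClusterRec (p c : V → V → ℝ) (Q : Finset V → V → Prop)
    (F : Finset V → Finset (Finset V) → ℝ) : Prop where
  base : ∀ S, F ∅ S = if S = ∅ then 1 else 0
  step : ∀ A S, BlockSystem A S → ∀ x ∈ A, Q A x →
    F A S = (∏ y ∈ A.erase x, p x y) *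
      ∑ U ∈ S.powerset, (∏ B ∈ U, absorbWeight c x B) * F (A.erase x ∪ pts U) (S \ U)

/-- The recursion lowers the number of points by one, and an empty root is prescribed. One
admissible point in each nonempty root suffices, so a solution valid for all x can be compared with
one valid along a selection only. -/
lemma ClusterRec.unique {p c : V → V → ℝ} {Q : Finset V → V → Prop}
    {F F' : Finset V → Finset (Finset V) → ℝ} (hF : ClusterRec p c Q F) (hF' : ClusterRec p c Q F')
    (hQ : ∀ A : Finset V, A.Nonempty → ∃ x ∈ A, Q A x) (A : Finset V) (S : Finset (Finset V))
    (h : BlockSystem A S) : F A S = F' A S := by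
  induction hN : numPts A S using Nat.strong_induction_on generalizing A S with
  | _ N ih =>
    rcases A.eq_empty_or_nonempty with rfl | hA
    · rw [hF.base, hF'.base]
    · obtain ⟨x, hx, hxQ⟩ := hQ A hA
      rw [hF.step A S h x hx hxQ, hF'.step A S h x hx hxQ]
      congr 1
      refine Finset.sum_congr rfl fun U hU => ?_
      have hU := Finset.mem_powerset.1 hU
      rw [ih _ (by have := h.numPts_absorb hx hU; omega) _ _
        (h.absorb (Finset.erase_subset _ _) hU) rfl]

lemma ClusterRec.mono {p c : V → V → ℝ} {Q Q' : Finset V → V → Prop}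
    {F : Finset V → Finset (Finset V) → ℝ} (hF : ClusterRec p c Q F)
    (h : ∀ A x, Q' A x → Q A x) : ClusterRec p c Q' F :=
  ⟨hF.base, fun A S hS x hx hq => hF.step A S hS x hx (h A x hq)⟩

/-- The truncation of `ρ` with respect to the root `A` and the blocks `S`. -/
def trunc (ρ : Finset V → ℝ) (A : Finset V) (S : Finset (Finset V)) : ℝ :=
  ∑ U ∈ S.powerset, ρ (A ∪ pts U) * convInv (fun W => ρ (pts W)) (S \ U)

lemma trunc_empty_left (ρ : Finset V → ℝ) (h0 : ρ ∅ = 1) (S : Finset (Finset V)) :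
    trunc ρ ∅ S = if S = ∅ then 1 else 0 := by
  unfold trunc
  simp only [Finset.empty_union]
  exact sum_powerset_mul_convInv (fun W => ρ (pts W)) (by simpa using h0) S

@[simp] lemma trunc_empty_right (ρ : Finset V → ℝ) (A : Finset V) : trunc ρ A ∅ = ρ A := by
  simp [trunc]

/-- Expanding ∏_{B∈U} (1 + k B) over W ⊆ U and exchanging the sums leaves, for each W, the
truncation of L with the blocks of W added to the root. L is kept separate from ρ: it is the
Boltzmann factor itself for the kernels, and an integral of ρ against K for the correlation
functions. -/
lemma trunc_step (ρ L : Finset V → ℝ) (a : ℝ) (k : Finset V → ℝ) (A A' : Finset V)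
    (S : Finset (Finset V))
    (h : ∀ U ⊆ S, ρ (A ∪ pts U) = a * (∏ B ∈ U, (1 + k B)) * L (A' ∪ pts U)) :
    trunc ρ A S = a * ∑ W ∈ S.powerset, (∏ B ∈ W, k B) *
      ∑ U ∈ (S \ W).powerset, L (A' ∪ pts W ∪ pts U) *
        convInv (fun W => ρ (pts W)) ((S \ W) \ U) := by
  unfold trunc
  have h1 : ∀ U ∈ S.powerset, ρ (A ∪ pts U) * convInv (fun W => ρ (pts W)) (S \ U) =
      ∑ W ∈ U.powerset, a * ((∏ B ∈ W, k B) * (L (A' ∪ pts W ∪ pts (U \ W)) *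
        convInv (fun W => ρ (pts W)) ((S \ W) \ (U \ W)))) := by
    intro U hU
    have hU := Finset.mem_powerset.1 hU
    rw [h U hU, Finset.prod_one_add, Finset.mul_sum, Finset.sum_mul, Finset.sum_mul]
    refine Finset.sum_congr rfl fun W hW => ?_
    have hW := Finset.mem_powerset.1 hW
    rw [Finset.union_assoc, pts_union_pts_sdiff hW]
    have : (S \ W) \ (U \ W) = S \ U := by
      ext B
      simp only [Finset.mem_sdiff]
      have := @hW B
      tauto
    rw [this]; ring
  rw [Finset.sum_congr rfl h1, sum_powerset_powerset S (fun W U => a * ((∏ B ∈ W, k B) *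
    (L (A' ∪ pts W ∪ pts U) * convInv (fun W => ρ (pts W)) ((S \ W) \ U)))), Finset.mul_sum]
  refine Finset.sum_congr rfl fun W _ => ?_
  rw [← Finset.mul_sum, ← Finset.mul_sum]

/-- A multiplicative pair interaction gives a truncation which satisfies the cluster recursion. -/
lemma trunc_clusterRec (b : V → V → ℝ) (ψ : Finset V → ℝ) (h0 : ψ ∅ = 1)
    (hψ : ∀ A x, x ∈ A → ψ A = (∏ y ∈ A.erase x, b x y) * ψ (A.erase x)) :
    ClusterRec b (fun x y => b x y - 1) (fun _ _ => True) (trunc ψ) := by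
  refine ⟨trunc_empty_left ψ h0, fun A S hS x hx _ => ?_⟩
  rw [trunc_step ψ ψ (∏ y ∈ A.erase x, b x y) (absorbWeight (fun x y => b x y - 1) x) A (A.erase x)
    S]
  · rfl
  · intro U hU
    have hd : Disjoint (A.erase x) (pts U) :=
      (hS.mono (Finset.erase_subset _ _) hU).disjoint_pts
    have hxU : x ∉ pts U := Finset.disjoint_left.1 (hS.mono le_rfl hU).disjoint_pts hx
    have he : (A ∪ pts U).erase x = A.erase x ∪ pts U := by
      rw [Finset.erase_union_distrib, Finset.erase_eq_of_notMem hxU]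
    rw [hψ _ x (Finset.mem_union_left _ hx), he, Finset.prod_union hd, Finset.prod_biUnion]
    · simp [absorbWeight]
    · intro B hB B' hB' hne
      exact hS.pairwise B (hU hB) B' (hU hB') hne

end BlockSystems

end PTCF

namespace PTCF

/-! ### Sums over sets meeting every block. -/

section StarSums

variable {V ι : Type*} [DecidableEq V] [DecidableEq ι]

/-- The subsets of `⋃_{i ∈ I} B_i` that meet every `B_i`, `i ∈ I`. -/
def transversals (I : Finset ι) (bl : ι → Finset V) : Finset (Finset V) :=
  {Z ∈ (I.biUnion bl).powerset | ∀ i ∈ I, (Z ∩ bl i).Nonempty}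

/-- Such a set is an independent choice of a nonempty subset in each block, and ∏ (1 + g) - 1 sums
over the nonempty subsets of one block. -/
lemma sum_transversals_prod (I : Finset ι) (bl : ι → Finset V)
    (hd : ∀ i ∈ I, ∀ k ∈ I, i ≠ k → Disjoint (bl i) (bl k)) (g : V → ℝ) :
    ∑ Z ∈ transversals I bl, ∏ y ∈ Z, g y = ∏ i ∈ I, (∏ y ∈ bl i, (1 + g y) - 1) := by
  induction I using Finset.induction_on with
  | empty => simp [transversals]
  | insert i I hi ih =>
    have hdi : Disjoint (bl i) (I.biUnion bl) := by
      rw [Finset.disjoint_biUnion_right]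
      intro k hk
      exact hd i (Finset.mem_insert_self _ _) k (Finset.mem_insert_of_mem hk)
        (by rintro rfl; exact hi hk)
    rw [Finset.prod_insert hi, ← ih (fun a ha b hb => hd a (Finset.mem_insert_of_mem ha) b
      (Finset.mem_insert_of_mem hb))]
    have h1 : ∏ y ∈ bl i, (1 + g y) - 1 =
        ∑ Z ∈ (bl i).powerset with Z.Nonempty, ∏ y ∈ Z, g y := by
      rw [Finset.prod_one_add, ← Finset.sum_filter_add_sum_filter_not (bl i).powerset
        (fun Z => Z.Nonempty)]
      have : (bl i).powerset.filter (fun A => ¬ A.Nonempty) = {∅} := by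
        ext A
        simp only [Finset.mem_filter, Finset.mem_powerset, Finset.not_nonempty_iff_eq_empty,
          Finset.mem_singleton, and_iff_right_iff_imp]
        rintro rfl; simp
      rw [this]; simp
    rw [h1, Finset.sum_mul_sum, ← Finset.sum_product']
    refine Finset.sum_bij' (fun Z _ => (Z ∩ bl i, Z \ bl i)) (fun t _ => t.1 ∪ t.2) ?_ ?_ ?_ ?_ ?_
    · intro Z hZ
      simp only [transversals, Finset.mem_filter, Finset.mem_powerset, Finset.mem_product,
        Finset.biUnion_insert] at hZ ⊢
      refine ⟨⟨Finset.inter_subset_right, hZ.2 i (Finset.mem_insert_self _ _)⟩, ?_, ?_⟩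
      · intro y hy
        have hy' := Finset.mem_sdiff.1 hy
        exact (Finset.mem_union.1 (hZ.1 hy'.1)).resolve_left hy'.2
      · intro k hk
        obtain ⟨y, hy⟩ := hZ.2 k (Finset.mem_insert_of_mem hk)
        have hy' := Finset.mem_inter.1 hy
        refine ⟨y, Finset.mem_inter.2 ⟨Finset.mem_sdiff.2 ⟨hy'.1, fun hyi => ?_⟩, hy'.2⟩⟩
        exact Finset.disjoint_left.1 hdi hyi (Finset.mem_biUnion.2 ⟨k, hk, hy'.2⟩)
    · rintro ⟨Z, Z'⟩ h
      simp only [transversals, Finset.mem_filter, Finset.mem_powerset, Finset.mem_product,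
        Finset.biUnion_insert] at h ⊢
      obtain ⟨⟨h1, h2⟩, h3, h4⟩ := h
      refine ⟨Finset.union_subset_union h1 h3, ?_⟩
      intro k hk
      rcases Finset.mem_insert.1 hk with rfl | hk
      · obtain ⟨y, hy⟩ := h2
        exact ⟨y, Finset.mem_inter.2 ⟨Finset.mem_union_left _ hy, h1 hy⟩⟩
      · exact (h4 k hk).mono (Finset.inter_subset_inter Finset.subset_union_right le_rfl)
    · intro Z _
      simp only
      rw [Finset.union_comm, Finset.sdiff_union_inter]
    · rintro ⟨Z, Z'⟩ h
      simp only [transversals, Finset.mem_filter, Finset.mem_powerset, Finset.mem_product] at h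
      obtain ⟨⟨h1, h2⟩, h3, h4⟩ := h
      have hd' : Disjoint Z' (bl i) := (hdi.mono_right h3).symm
      ext y
      · have a1 := @h1 y
        have a2 := fun hh : y ∈ Z' => Finset.disjoint_left.1 hd' hh
        simp only [Finset.mem_inter, Finset.mem_union]; tauto
      · have a1 := @h1 y
        have a2 := fun hh : y ∈ Z' => Finset.disjoint_left.1 hd' hh
        simp only [Finset.mem_sdiff, Finset.mem_union]; tauto
    · intro Z _
      rw [mul_comm]
      have := Finset.prod_union (f := g) (Finset.disjoint_sdiff_inter Z (bl i))
      rw [Finset.sdiff_union_inter] at this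
      exact this

end StarSums

/-! ### Forests encoded by parent points and stars, and their exploration. -/

section ParentForests

variable {V : Type*} [DecidableEq V]

/-- Graphs in which every block `B` of `S` is joined by a nonempty star to one point `p B`, which
lies in the root or in a block of smaller rank. -/
def IsParentForest (A : Finset V) (S : Finset (Finset V)) (f : Finset (Sym2 V)) : Prop :=
  ∃ (p : Finset V → V) (ζ : Finset V → Finset V) (h : Finset V → ℕ),
    (∀ B ∈ S, ζ B ⊆ B ∧ (ζ B).Nonempty ∧ (p B ∈ A ∨ ∃ B' ∈ S, p B ∈ B' ∧ h B' < h B)) ∧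
    f = S.biUnion fun B => (ζ B).image fun y => s(p B, y)

/-- The finite set of parent forests. -/
noncomputable def parentForests (A : Finset V) (S : Finset (Finset V)) : Finset (Finset (Sym2 V)) :=
  {f ∈ (A ∪ pts S).sym2.powerset | IsParentForest A S f}

lemma IsParentForest.subset_sym2 {A : Finset V} {S : Finset (Finset V)} {f : Finset (Sym2 V)}
    (hf : IsParentForest A S f) : f ⊆ (A ∪ pts S).sym2 := by
  obtain ⟨p, ζ, h, hp, rfl⟩ := hf
  intro e he
  obtain ⟨B, hB, he⟩ := Finset.mem_biUnion.1 he
  obtain ⟨y, hy, rfl⟩ := Finset.mem_image.1 he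
  obtain ⟨h1, -, h2⟩ := hp B hB
  rw [Finset.mk_mem_sym2_iff]
  refine ⟨?_, Finset.mem_union_right _ (Finset.mem_biUnion.2 ⟨B, hB, h1 hy⟩)⟩
  rcases h2 with h2 | ⟨B', hB', h2, -⟩
  · exact Finset.mem_union_left _ h2
  · exact Finset.mem_union_right _ (Finset.mem_biUnion.2 ⟨B', hB', h2⟩)

lemma mem_parentForests {A : Finset V} {S : Finset (Finset V)} {f : Finset (Sym2 V)} :
    f ∈ parentForests A S ↔ IsParentForest A S f := by
  simp only [parentForests, Finset.mem_filter, Finset.mem_powerset, and_iff_right_iff_imp]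
  exact fun h => h.subset_sym2

/-- A block of minimal rank can have its parent only in the root, which is impossible for an empty
root. -/
lemma parentForests_empty_left [Nonempty V] (S : Finset (Finset V)) :
    parentForests ∅ S = if S = ∅ then {∅} else ∅ := by
  split_ifs with h
  · subst h
    ext f
    rw [mem_parentForests, Finset.mem_singleton]
    constructor
    · rintro ⟨p, ζ, h, -, rfl⟩; simp
    · rintro rfl
      exact ⟨fun _ => Classical.arbitrary V, fun _ => ∅, fun _ => 0, by simp, by simp⟩
  · rw [Finset.eq_empty_iff_forall_notMem]
    intro f hf
    obtain ⟨p, ζ, k, hp, -⟩ := mem_parentForests.1 hf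
    obtain ⟨B, hB, hmin⟩ := Finset.exists_min_image S k (Finset.nonempty_iff_ne_empty.2 h)
    rcases (hp B hB).2.2 with h1 | ⟨B', hB', -, h2⟩
    · simp at h1
    · exact absurd (hmin B' hB') (not_le.2 h2)

/-- The neighbours of `x` among the points of the blocks. -/
def nbrs (S : Finset (Finset V)) (x : V) (f : Finset (Sym2 V)) : Finset V :=
  {y ∈ pts S | s(x, y) ∈ f}

/-- The blocks which contain a neighbour of `x`. -/
def nbrBlocks (S : Finset (Finset V)) (x : V) (f : Finset (Sym2 V)) : Finset (Finset V) :=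
  {B ∈ S | ∃ y ∈ B, s(x, y) ∈ f}

lemma nbrBlocks_subset (S : Finset (Finset V)) (x : V) (f : Finset (Sym2 V)) :
    nbrBlocks S x f ⊆ S := Finset.filter_subset _ _

/-- The edges joining `x` to the points of `Z`. -/
def starEdges (x : V) (Z : Finset V) : Finset (Sym2 V) := Z.image fun y => s(x, y)

lemma mem_starEdges {x : V} {Z : Finset V} {y : V} : s(x, y) ∈ starEdges x Z ↔ y ∈ Z := by
  simp only [starEdges, Finset.mem_image]
  constructor
  · rintro ⟨w, hw, e⟩
    rw [Sym2.congr_right] at e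
    exact e ▸ hw
  · exact fun h => ⟨y, h, rfl⟩

/-- Since x lies in no block, an edge at x can only be the parent end of a star. The blocks with
parent x are therefore those containing a neighbour of x; once they join the root, the other blocks
keep their parents and ranks. -/
lemma IsParentForest.erase {A : Finset V} {S : Finset (Finset V)} {f : Finset (Sym2 V)}
    (hS : BlockSystem A S) (hf : IsParentForest A S f) {x : V} (hx : x ∈ A) :
    nbrs S x f ∈ transversals (nbrBlocks S x f) id ∧
    IsParentForest (A.erase x ∪ pts (nbrBlocks S x f)) (S \ nbrBlocks S x f)
      (f.filter fun e => x ∉ e) ∧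
    f.filter (fun e => x ∉ e) ∪ starEdges x (nbrs S x f) = f := by
  obtain ⟨p, ζ, h, hp, rfl⟩ := hf
  set f := S.biUnion fun B => (ζ B).image fun y => s(p B, y) with hfdef
  have hxS : ∀ B ∈ S, x ∉ B := fun B hB => Finset.disjoint_left.1 (hS.root B hB) hx
  have hsame : ∀ B ∈ S, ∀ B' ∈ S, ∀ y ∈ B, y ∈ B' → B = B' := fun B hB B' hB' y hy hy' => by
    by_contra hne
    exact Finset.disjoint_left.1 (hS.pairwise B hB B' hB' hne) hy hy'
  have hmem : ∀ y, s(x, y) ∈ f ↔ ∃ B ∈ S, p B = x ∧ y ∈ ζ B := by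
    intro y
    simp only [hfdef, Finset.mem_biUnion, Finset.mem_image]
    constructor
    · rintro ⟨B, hB, w, hw, e⟩
      rcases Sym2.eq_iff.1 e with ⟨e1, e2⟩ | ⟨e1, e2⟩
      · exact ⟨B, hB, e1, e2 ▸ hw⟩
      · exact absurd ((hp B hB).1 (e2 ▸ hw)) (hxS B hB)
    · rintro ⟨B, hB, rfl, hy⟩
      exact ⟨B, hB, y, hy, rfl⟩
  have hU : ∀ B ∈ S, B ∈ nbrBlocks S x f ↔ p B = x := by
    intro B hB
    simp only [nbrBlocks, Finset.mem_filter, hB, true_and, hmem]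
    constructor
    · rintro ⟨y, hy, B', hB', e, hy'⟩
      rw [hsame B hB B' hB' y hy ((hp B' hB').1 hy')]; exact e
    · intro e
      obtain ⟨y, hy⟩ := (hp B hB).2.1
      exact ⟨y, (hp B hB).1 hy, B, hB, e, hy⟩
  have hUS : nbrBlocks S x f ⊆ S := Finset.filter_subset _ _
  refine ⟨?_, ⟨p, ζ, h, ?_, ?_⟩, ?_⟩
  · simp only [transversals, Finset.mem_filter, Finset.mem_powerset]
    constructor
    · intro y hy
      obtain ⟨B, hB, e, hyB⟩ := (hmem y).1 (Finset.mem_filter.1 hy).2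
      exact Finset.mem_biUnion.2 ⟨B, (hU B hB).2 e, (hp B hB).1 hyB⟩
    · intro B hB
      obtain ⟨hBS, y, hy, hyf⟩ := Finset.mem_filter.1 hB
      exact ⟨y, Finset.mem_inter.2 ⟨Finset.mem_filter.2
        ⟨Finset.mem_biUnion.2 ⟨B, hBS, hy⟩, hyf⟩, hy⟩⟩
  · intro B hB
    obtain ⟨hB, hBU⟩ := Finset.mem_sdiff.1 hB
    obtain ⟨h1, h2, h3⟩ := hp B hB
    refine ⟨h1, h2, ?_⟩
    rcases h3 with h3 | ⟨B', hB', h3, h4⟩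
    · exact Or.inl (Finset.mem_union_left _ (Finset.mem_erase.2
        ⟨fun e => hBU ((hU B hB).2 e), h3⟩))
    · by_cases hB'U : B' ∈ nbrBlocks S x f
      · exact Or.inl (Finset.mem_union_right _ (Finset.mem_biUnion.2 ⟨B', hB'U, h3⟩))
      · exact Or.inr ⟨B', Finset.mem_sdiff.2 ⟨hB', hB'U⟩, h3, h4⟩
  · ext e
    simp only [hfdef, Finset.mem_filter, Finset.mem_biUnion, Finset.mem_image, Finset.mem_sdiff]
    constructor
    · rintro ⟨⟨B, hB, y, hy, rfl⟩, hxe⟩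
      refine ⟨B, ⟨hB, fun hBU => hxe ?_⟩, y, hy, rfl⟩
      rw [(hU B hB).1 hBU]; exact Sym2.mem_mk_left _ _
    · rintro ⟨B, ⟨hB, hBU⟩, y, hy, rfl⟩
      refine ⟨⟨B, hB, y, hy, rfl⟩, fun hxe => ?_⟩
      rcases Sym2.mem_iff.1 hxe with e | e
      · exact hBU ((hU B hB).2 e.symm)
      · exact hxS B hB (e ▸ (hp B hB).1 hy)
  · ext e
    simp only [Finset.mem_union, Finset.mem_filter]
    constructor
    · rintro (h | h)
      · exact h.1
      · obtain ⟨y, hy, rfl⟩ := Finset.mem_image.1 h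
        exact (Finset.mem_filter.1 hy).2
    · intro he
      by_cases hxe : x ∈ e
      · right
        obtain ⟨y, rfl⟩ := Sym2.mem_iff_exists.1 hxe
        rw [mem_starEdges]
        obtain ⟨B, hB, -, hy⟩ := (hmem y).1 he
        exact Finset.mem_filter.2 ⟨Finset.mem_biUnion.2 ⟨B, hB, (hp B hB).1 hy⟩, he⟩
      · exact Or.inl ⟨he, hxe⟩

/-- Inverse of the decomposition in `IsParentForest.erase`: the forest without x has no edge at x,
so the added star can be read off from the result. -/
lemma IsParentForest.extend {A : Finset V} {S U : Finset (Finset V)} {Z : Finset V}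
    {f : Finset (Sym2 V)} (hS : BlockSystem A S) {x : V} (hx : x ∈ A) (hU : U ⊆ S)
    (hZ : Z ∈ transversals U id) (hf : IsParentForest (A.erase x ∪ pts U) (S \ U) f) :
    IsParentForest A S (f ∪ starEdges x Z) ∧ nbrs S x (f ∪ starEdges x Z) = Z ∧
    nbrBlocks S x (f ∪ starEdges x Z) = U ∧
    (f ∪ starEdges x Z).filter (fun e => x ∉ e) = f := by
  have hxS : ∀ B ∈ S, x ∉ B := fun B hB => Finset.disjoint_left.1 (hS.root B hB) hx
  have hsame : ∀ B ∈ S, ∀ B' ∈ S, ∀ y ∈ B, y ∈ B' → B = B' := fun B hB B' hB' y hy hy' => by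
    by_contra hne
    exact Finset.disjoint_left.1 (hS.pairwise B hB B' hB' hne) hy hy'
  have hxf : ∀ e ∈ f, x ∉ e := by
    intro e he hxe
    have := hf.subset_sym2 he
    rw [hS.absorb_union hx hU] at this
    exact (Finset.mem_erase.1 (Finset.mem_sym2_iff.1 this x hxe)).1 rfl
  simp only [transversals, Finset.mem_filter, Finset.mem_powerset, id] at hZ
  obtain ⟨hZ1, hZ2⟩ := hZ
  have hmem : ∀ y, s(x, y) ∈ f ∪ starEdges x Z ↔ y ∈ Z := by
    intro y
    rw [Finset.mem_union, mem_starEdges]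
    exact or_iff_right fun h => hxf _ h (Sym2.mem_mk_left _ _)
  refine ⟨?_, ?_, ?_, ?_⟩
  · obtain ⟨p, ζ, h, hp, rfl⟩ := hf
    -- Children of x get rank 0 and all other ranks are raised by one, so that a block of U,
    -- formerly part of the root, ranks below its children.
    refine ⟨fun B => if B ∈ U then x else p B, fun B => if B ∈ U then Z ∩ B else ζ B,
      fun B => if B ∈ U then 0 else h B + 1, ?_, ?_⟩
    · intro B hB
      by_cases hBU : B ∈ U
      · simp only [hBU, if_true]
        exact ⟨Finset.inter_subset_right, hZ2 B hBU, Or.inl hx⟩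
      · simp only [hBU, if_false]
        obtain ⟨h1, h2, h3⟩ := hp B (Finset.mem_sdiff.2 ⟨hB, hBU⟩)
        refine ⟨h1, h2, ?_⟩
        rcases h3 with h3 | ⟨B', hB', h3, h4⟩
        · rcases Finset.mem_union.1 h3 with h3 | h3
          · exact Or.inl (Finset.mem_of_mem_erase h3)
          · obtain ⟨B', hB', h4⟩ := Finset.mem_biUnion.1 h3
            exact Or.inr ⟨B', hU hB', h4, by simp [hB']⟩
        · have hB' := Finset.mem_sdiff.1 hB'
          exact Or.inr ⟨B', hB'.1, h3, by simp [hB'.2, h4]⟩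
    · ext e
      simp only [Finset.mem_union, Finset.mem_biUnion, Finset.mem_image, Finset.mem_sdiff,
        starEdges]
      constructor
      · rintro (⟨B, ⟨hB, hBU⟩, y, hy, rfl⟩ | ⟨y, hy, rfl⟩)
        · exact ⟨B, hB, y, by simpa [hBU] using hy, by simp [hBU]⟩
        · obtain ⟨B, hB, hyB⟩ := Finset.mem_biUnion.1 (hZ1 hy)
          exact ⟨B, hU hB, y, by simpa [hB] using ⟨hy, hyB⟩, by simp [hB]⟩
      · rintro ⟨B, hB, y, hy, rfl⟩
        by_cases hBU : B ∈ U
        · simp only [hBU, if_true] at hy ⊢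
          exact Or.inr ⟨y, (Finset.mem_inter.1 hy).1, rfl⟩
        · simp only [hBU, if_false] at hy ⊢
          exact Or.inl ⟨B, ⟨hB, hBU⟩, y, hy, rfl⟩
  · ext y
    simp only [nbrs, Finset.mem_filter, hmem, and_iff_right_iff_imp]
    intro hy
    exact Finset.biUnion_subset_biUnion_of_subset_left id hU (hZ1 hy)
  · ext B
    simp only [nbrBlocks, Finset.mem_filter, hmem]
    constructor
    · rintro ⟨hB, y, hy, hyZ⟩
      obtain ⟨B', hB', hyB'⟩ := Finset.mem_biUnion.1 (hZ1 hyZ)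
      rw [hsame B hB B' (hU hB') y hy hyB']; exact hB'
    · intro hB
      obtain ⟨y, hy⟩ := hZ2 B hB
      exact ⟨hU hB, y, (Finset.mem_inter.1 hy).2, (Finset.mem_inter.1 hy).1⟩
  · ext e
    simp only [Finset.mem_filter, Finset.mem_union]
    constructor
    · rintro ⟨h | h, hxe⟩
      · exact h
      · obtain ⟨y, -, rfl⟩ := Finset.mem_image.1 h
        exact absurd (Sym2.mem_mk_left _ _) hxe
    · exact fun h => ⟨Or.inl h, hxf e h⟩

/-- A forest is the same as the set U of blocks joined to x, the neighbours Z of x in them, and a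
forest over the root with x removed and U absorbed. -/
lemma sum_parentForests {M : Type*} [AddCommMonoid M] {A : Finset V} {S : Finset (Finset V)}
    (hS : BlockSystem A S) {x : V} (hx : x ∈ A) (g : Finset (Sym2 V) → M) :
    ∑ f ∈ parentForests A S, g f =
      ∑ U ∈ S.powerset, ∑ Z ∈ transversals U id,
        ∑ f ∈ parentForests (A.erase x ∪ pts U) (S \ U), g (f ∪ starEdges x Z) := by
  simp_rw [Finset.sum_sigma']
  symm
  refine Finset.sum_bij' (fun t _ => t.2.2 ∪ starEdges x t.2.1)
    (fun f _ => ⟨nbrBlocks S x f, nbrs S x f, f.filter fun e => x ∉ e⟩) ?_ ?_ ?_ ?_ ?_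
  · rintro ⟨U, Z, f⟩ h
    simp only [Finset.mem_sigma, Finset.mem_powerset, mem_parentForests] at h ⊢
    exact (h.2.2.extend hS hx h.1 h.2.1).1
  · intro f hf
    simp only [Finset.mem_sigma, Finset.mem_powerset, mem_parentForests] at hf ⊢
    obtain ⟨h1, h2, -⟩ := hf.erase hS hx
    exact ⟨Finset.filter_subset _ _, h1, h2⟩
  · rintro ⟨U, Z, f⟩ h
    simp only [Finset.mem_sigma, Finset.mem_powerset, mem_parentForests] at h
    obtain ⟨-, h1, h2, h3⟩ := h.2.2.extend hS hx h.1 h.2.1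
    simp only [h1, h2, h3]
  · intro f hf
    simp only [mem_parentForests] at hf ⊢
    exact (hf.erase hS hx).2.2
  · intros; rfl

lemma prod_union_starEdges {A : Finset V} {S U : Finset (Finset V)} (hS : BlockSystem A S) {x : V}
    (hx : x ∈ A) (hU : U ⊆ S) {f : Finset (Sym2 V)}
    (hf : f ⊆ ((A.erase x ∪ pts U) ∪ pts (S \ U)).sym2) (Z : Finset V) (w : Sym2 V → ℝ) :
    ∏ e ∈ f ∪ starEdges x Z, w e = (∏ y ∈ Z, w s(x, y)) * ∏ e ∈ f, w e := by
  rw [Finset.prod_union, mul_comm, starEdges, Finset.prod_image]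
  · intro y _ y' _ e
    exact Sym2.congr_right.1 e
  · rw [Finset.disjoint_left]
    intro e he he'
    obtain ⟨y, -, rfl⟩ := Finset.mem_image.1 he'
    have := hf he
    rw [hS.absorb_union hx hU] at this
    exact (Finset.mem_erase.1 (Finset.mk_mem_sym2_iff.1 this).1).1 rfl

/-- The sum over forests of the products of edge weights solves a cluster recursion. -/
lemma forestSum_clusterRec [Nonempty V] (c : V → V → ℝ) (w : Sym2 V → ℝ)
    (hw : ∀ x y, w s(x, y) = c x y) :
    ClusterRec (fun _ _ => 1) c (fun _ _ => True)
      (fun A S => ∑ f ∈ parentForests A S, ∏ e ∈ f, w e) := by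
  refine ⟨fun S => ?_, fun A S hS x hx _ => ?_⟩
  · simp only [parentForests_empty_left]
    split_ifs <;> simp
  · simp only [Finset.prod_const_one, one_mul]
    rw [sum_parentForests hS hx]
    refine Finset.sum_congr rfl fun U hU => ?_
    have hU := Finset.mem_powerset.1 hU
    have := sum_transversals_prod U id (fun B hB B' hB' => hS.pairwise B (hU hB) B' (hU hB')) (c x)
    simp only [absorbWeight, id] at this ⊢
    rw [← this, Finset.sum_mul]
    refine Finset.sum_congr rfl fun Z hZ => ?_
    rw [Finset.mul_sum]
    refine Finset.sum_congr rfl fun f hf => ?_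
    rw [prod_union_starEdges hS hx hU (mem_parentForests.1 hf).subset_sym2]
    simp only [hw]

/-- The edges added in the exploration of `f`: `A` is the active set, `S` the set of blocks not yet
reached. -/
def explore (sel : Finset V → V) (f : Finset (Sym2 V)) :
    ℕ → Finset V → Finset (Finset V) → Finset (Sym2 V)
  | 0, _, _ => ∅
  | N + 1, A, S =>
    if A = ∅ then ∅ else
      starEdges (sel A) (A.erase (sel A)) ∪
        explore sel f N (A.erase (sel A) ∪ pts (nbrBlocks S (sel A) f)) (S \ nbrBlocks S (sel A) f)

lemma explore_subset (sel : Finset V → V) (hsel : ∀ A : Finset V, A.Nonempty → sel A ∈ A)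
    (f : Finset (Sym2 V)) (N : ℕ) (A : Finset V) (S : Finset (Finset V)) :
    explore sel f N A S ⊆ (A ∪ pts S).sym2 := by
  induction N generalizing A S with
  | zero => simp [explore]
  | succ N ih =>
    unfold explore
    split_ifs with hA
    · simp
    · have hx := hsel A (Finset.nonempty_iff_ne_empty.2 hA)
      apply Finset.union_subset
      · intro e he
        obtain ⟨y, hy, rfl⟩ := Finset.mem_image.1 he
        rw [Finset.mk_mem_sym2_iff]
        exact ⟨Finset.mem_union_left _ hx, Finset.mem_union_left _ (Finset.mem_of_mem_erase hy)⟩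
      · refine (ih _ _).trans (Finset.sym2_mono ?_)
        rw [Finset.union_assoc, pts_union_pts_sdiff (nbrBlocks_subset S _ _)]
        exact Finset.union_subset_union (Finset.erase_subset _ _) le_rfl

/-- The exploration consults only pairs of points that are still active or not yet reached; edges at
points already removed are invisible to it. -/
lemma explore_congr (sel : Finset V → V) (hsel : ∀ A : Finset V, A.Nonempty → sel A ∈ A)
    (f f' : Finset (Sym2 V)) (N : ℕ) (A : Finset V) (S : Finset (Finset V))
    (h : ∀ e ∈ (A ∪ pts S).sym2, e ∈ f ↔ e ∈ f') : explore sel f N A S = explore sel f' N A S := by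
  induction N generalizing A S with
  | zero => rfl
  | succ N ih =>
    unfold explore
    split_ifs with hA
    · rfl
    · have hx := hsel A (Finset.nonempty_iff_ne_empty.2 hA)
      have hb : nbrBlocks S (sel A) f = nbrBlocks S (sel A) f' := by
        refine Finset.filter_congr fun B hB => ?_
        refine exists_congr fun y => and_congr_right fun hy => h _ ?_
        rw [Finset.mk_mem_sym2_iff]
        exact ⟨Finset.mem_union_left _ hx,
          Finset.mem_union_right _ (Finset.mem_biUnion.2 ⟨B, hB, hy⟩)⟩
      rw [hb, ih]
      intro e he
      refine h e (Finset.sym2_mono ?_ he)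
      rw [Finset.union_assoc, pts_union_pts_sdiff (nbrBlocks_subset S _ _)]
      exact Finset.union_subset_union (Finset.erase_subset _ _) le_rfl

/-- The forest expansion with the factors of the exploration solves the recursion along the
selected points. -/
lemma exploredForestSum_clusterRec [Nonempty V] (b c : V → V → ℝ) (wb wc : Sym2 V → ℝ)
    (hb : ∀ x y, wb s(x, y) = b x y) (hc : ∀ x y, wc s(x, y) = c x y)
    (sel : Finset V → V) (hsel : ∀ A : Finset V, A.Nonempty → sel A ∈ A) :
    ClusterRec b c (fun A x => x = sel A)
      (fun A S => ∑ f ∈ parentForests A S,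
        (∏ e ∈ f, wc e) * ∏ e ∈ explore sel f (numPts A S) A S, wb e) := by
  refine ⟨fun S => ?_, fun A S hS x hx hxA => ?_⟩
  · simp only [parentForests_empty_left]
    split_ifs with h
    · subst h; simp [numPts, explore]
    · simp
  · rw [sum_parentForests hS hx, Finset.mul_sum]
    refine Finset.sum_congr rfl fun U hU => ?_
    have hU := Finset.mem_powerset.1 hU
    have := sum_transversals_prod U id (fun B hB B' hB' => hS.pairwise B (hU hB) B' (hU hB')) (c x)
    simp only [absorbWeight, id] at this ⊢
    rw [← this, Finset.sum_mul, Finset.mul_sum]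
    refine Finset.sum_congr rfl fun Z hZ => ?_
    rw [Finset.mul_sum, Finset.mul_sum]
    refine Finset.sum_congr rfl fun f hf => ?_
    have hf := mem_parentForests.1 hf
    rw [prod_union_starEdges hS hx hU hf.subset_sym2]
    have hnb := (hf.extend hS hx hU hZ).2.2.1
    -- One exploration step joins x to the other active points and absorbs exactly U; afterwards the
    -- star at x plays no role, so the rest is the exploration of f. The number of steps matches
    -- because one point was removed.
    have hE : explore sel (f ∪ starEdges x Z) (numPts A S) A S = starEdges x (A.erase x) ∪
        explore sel f (numPts (A.erase x ∪ pts U) (S \ U)) (A.erase x ∪ pts U) (S \ U) := by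
      rw [← hS.numPts_absorb hx hU]
      conv_lhs => unfold explore
      rw [if_neg (Finset.ne_empty_of_mem hx), ← hxA, hnb]
      congr 1
      refine explore_congr sel hsel _ _ _ _ _ fun e he => ?_
      rw [Finset.mem_union]
      refine or_iff_left fun h => ?_
      obtain ⟨y, -, rfl⟩ := Finset.mem_image.1 h
      rw [hS.absorb_union hx hU] at he
      exact (Finset.mem_erase.1 (Finset.mk_mem_sym2_iff.1 he).1).1 rfl
    rw [hE, Finset.union_comm (starEdges x (A.erase x)),
      prod_union_starEdges hS hx hU (explore_subset sel hsel _ _ _ _)]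
    simp only [hc, hb]
    ring

end ParentForests

end PTCF

namespace PTCF

/-! ### Rooted trees of blocks and parent functions. -/

section TreeCharacterization

variable {V ι : Type*}

/-- A neighbour of i nearer to r lies on the path from r to i, for otherwise i would lie on a
shortest path to that neighbour; only the penultimate vertex of the path is adjacent to i. -/
lemma eq_of_adj_of_dist_lt {G : SimpleGraph ι} (hG : G.IsTree) (r : ι) {a a' i : ι}
    (h : G.Adj a i) (h' : G.Adj a' i) (hd : G.dist r a < G.dist r i)
    (hd' : G.dist r a' < G.dist r i) : a = a' := by
  obtain ⟨P, hP, hPl⟩ := hG.connected.exists_path_of_dist r i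
  have key : ∀ b, G.Adj b i → G.dist r b < G.dist r i → b ∈ P.support := by
    intro b hb hbd
    obtain ⟨Q, hQ, hQl⟩ := hG.connected.exists_path_of_dist r b
    refine hG.isAcyclic.mem_support_of_ne_mem_support_of_adj_of_isPath hP hQ hb.symm ?_
    intro hi
    have := (SimpleGraph.dist_le (Q.takeUntil i hi)).trans (Q.length_takeUntil_le_length hi)
    omega
  rw [hG.isAcyclic.eq_penultimate_of_adj_end hP h.symm (key a h hd),
    hG.isAcyclic.eq_penultimate_of_adj_end hP h'.symm (key a' h' hd')]

lemma exists_adj_dist_lt {G : SimpleGraph ι} (hG : G.Connected) (r i : ι) (hi : i ≠ r) :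
    ∃ a, G.Adj a i ∧ G.dist r a < G.dist r i := by
  obtain ⟨P, hP, hPl⟩ := hG.exists_path_of_dist r i
  have hnil : ¬ P.Nil := fun h => hi h.eq.symm
  refine ⟨P.penultimate, P.adj_penultimate hnil, ?_⟩
  have h1 := SimpleGraph.dist_le P.dropLast
  have h2 : 0 < P.length := by
    rw [hPl]; exact hG.pos_dist_of_ne hi.symm
  have h3 : P.dropLast.length = P.length - 1 := by simp
  omega

variable (bl : ι → Finset V) (r : ι) (G : SimpleGraph ι) (f : Finset (Sym2 V))

/-- Rooted trees of blocks in which the edges to every child start from one point, described by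
parent points. -/
lemma exists_parent_of_isTree (hne : ∀ i, (bl i).Nonempty)
    (hG : ∀ a b, G.Adj a b ↔ a ≠ b ∧ ∃ x ∈ bl a, ∃ y ∈ bl b, s(x, y) ∈ f)
    (hedge : ∀ e ∈ f, ∃ a b, a ≠ b ∧ ∃ x ∈ bl a, ∃ y ∈ bl b, e = s(x, y))
    (htree : G.IsTree)
    (hstar : ∀ a b, G.dist r a < G.dist r b → ∀ x ∈ bl a, ∀ x' ∈ bl a, ∀ y ∈ bl b, ∀ y' ∈ bl b,
      s(x, y) ∈ f → s(x', y') ∈ f → x = x') :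
    ∃ (p : ι → V) (ζ : ι → Finset V) (h : ι → ℕ),
      (∀ i ≠ r, ζ i ⊆ bl i ∧ (ζ i).Nonempty ∧
        ∃ k, p i ∈ bl k ∧ (k = r ∨ (k ≠ r ∧ h k < h i))) ∧
      ∀ e, e ∈ f ↔ ∃ i ≠ r, ∃ y ∈ ζ i, e = s(p i, y) := by
  have hV : Nonempty V := ⟨(hne r).choose⟩
  have h1 : ∀ i, ∃ a x, i ≠ r → G.Adj a i ∧ G.dist r a < G.dist r i ∧ x ∈ bl a ∧
      ∃ y ∈ bl i, s(x, y) ∈ f := by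
    intro i
    by_cases hi : i = r
    · exact ⟨i, Classical.arbitrary V, fun h => absurd hi h⟩
    · obtain ⟨a, ha, hda⟩ := exists_adj_dist_lt htree.connected r i hi
      obtain ⟨-, x, hx, y, hy, hxy⟩ := (hG a i).1 ha
      exact ⟨a, x, fun _ => ⟨ha, hda, hx, y, hy, hxy⟩⟩
  choose π p hp using h1
  refine ⟨p, fun i => {y ∈ bl i | s(p i, y) ∈ f}, fun i => G.dist r i, ?_, ?_⟩
  · intro i hi
    obtain ⟨ha, hda, hx, y, hy, hxy⟩ := hp i hi
    refine ⟨Finset.filter_subset _ _, ⟨y, Finset.mem_filter.2 ⟨hy, hxy⟩⟩, π i, hx, ?_⟩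
    by_cases hr : π i = r
    · exact Or.inl hr
    · exact Or.inr ⟨hr, hda⟩
  · intro e
    constructor
    · intro he
      have key : ∀ a b, G.Adj a b → G.dist r a < G.dist r b → ∀ x ∈ bl a, ∀ y ∈ bl b,
          s(x, y) ∈ f → ∃ i ≠ r, ∃ w ∈ (bl i).filter (fun y => s(p i, y) ∈ f),
            s(x, y) = s(p i, w) := by
        intro a b hab hlt x hx y hy hxy
        have hb : b ≠ r := by
          rintro rfl
          simp at hlt
        obtain ⟨ha, hda, hx', y', hy', hxy'⟩ := hp b hb
        have e1 := eq_of_adj_of_dist_lt htree r hab ha hlt hda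
        have e2 := hstar a b hlt x hx (p b) (e1 ▸ hx') y hy y' hy' hxy hxy'
        exact ⟨b, hb, y, Finset.mem_filter.2 ⟨hy, e2 ▸ hxy⟩, by rw [e2]⟩
      obtain ⟨a, b, hab, x, hx, y, hy, rfl⟩ := hedge e he
      have hadj := (hG a b).2 ⟨hab, x, hx, y, hy, he⟩
      rcases lt_or_gt_of_ne (htree.dist_ne_of_adj r hadj) with h | h
      · exact key a b hadj h x hx y hy he
      · rw [Sym2.eq_swap] at he ⊢
        exact key b a hadj.symm h y hy x hx he
    · rintro ⟨i, hi, y, hy, rfl⟩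
      exact (Finset.mem_filter.1 hy).2

/-- Descending ranks lead from every vertex to r, which gives connectedness. Every edge joins a
vertex other than r to its parent, so there is one edge fewer than vertices at most, and a connected
graph with so few edges is a tree. -/
lemma isTree_of_exists_parent [Finite ι] (hd : ∀ i k, i ≠ k → Disjoint (bl i) (bl k))
    (hG : ∀ a b, G.Adj a b ↔ a ≠ b ∧ ∃ x ∈ bl a, ∃ y ∈ bl b, s(x, y) ∈ f)
    (p : ι → V) (ζ : ι → Finset V) (h : ι → ℕ)
    (hp : ∀ i ≠ r, ζ i ⊆ bl i ∧ (ζ i).Nonempty ∧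
        ∃ k, p i ∈ bl k ∧ (k = r ∨ (k ≠ r ∧ h k < h i)))
    (hf : ∀ e, e ∈ f ↔ ∃ i ≠ r, ∃ y ∈ ζ i, e = s(p i, y)) :
    (∀ e ∈ f, ∃ a b, a ≠ b ∧ ∃ x ∈ bl a, ∃ y ∈ bl b, e = s(x, y)) ∧ G.IsTree ∧
    (∀ a b, G.dist r a < G.dist r b → ∀ x ∈ bl a, ∀ x' ∈ bl a, ∀ y ∈ bl b, ∀ y' ∈ bl b,
      s(x, y) ∈ f → s(x', y') ∈ f → x = x') := by
  have hsame : ∀ i k y, y ∈ bl i → y ∈ bl k → i = k := fun i k y hy hy' => by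
    by_contra hne
    exact Finset.disjoint_left.1 (hd i k hne) hy hy'
  have hpar : ∀ i, ∃ k, i ≠ r → p i ∈ bl k ∧ (k = r ∨ (k ≠ r ∧ h k < h i)) := by
    intro i
    by_cases hi : i = r
    · exact ⟨r, fun h => absurd hi h⟩
    · obtain ⟨k, hk⟩ := (hp i hi).2.2
      exact ⟨k, fun _ => hk⟩
  choose π hπ using hpar
  have hπne : ∀ i ≠ r, π i ≠ i := by
    intro i hi e
    rcases (hπ i hi).2 with h1 | ⟨-, h1⟩
    · exact hi (e ▸ h1)
    · rw [e] at h1; exact lt_irrefl _ h1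
  have hadj : ∀ i ≠ r, G.Adj (π i) i := by
    intro i hi
    obtain ⟨h1, ⟨y, hy⟩, -⟩ := hp i hi
    exact (hG _ _).2 ⟨hπne i hi, p i, (hπ i hi).1, y, h1 hy, (hf _).2 ⟨i, hi, y, hy, rfl⟩⟩
  have hcase : ∀ a b x y, x ∈ bl a → y ∈ bl b → s(x, y) ∈ f →
      (b ≠ r ∧ π b = a ∧ x = p b) ∨ (a ≠ r ∧ π a = b ∧ y = p a) := by
    intro a b x y hx hy hxy
    obtain ⟨i, hi, w, hw, e⟩ := (hf _).1 hxy
    have hwi := (hp i hi).1 hw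
    rcases Sym2.eq_iff.1 e with ⟨rfl, rfl⟩ | ⟨rfl, rfl⟩
    · obtain rfl := hsame _ _ _ hy hwi
      exact Or.inl ⟨hi, hsame _ _ _ (hπ _ hi).1 hx, rfl⟩
    · obtain rfl := hsame _ _ _ hx hwi
      exact Or.inr ⟨hi, hsame _ _ _ (hπ _ hi).1 hy, rfl⟩
  have hreach : ∀ i, G.Reachable r i := by
    intro i
    induction hn : h i using Nat.strong_induction_on generalizing i with
    | _ n ih =>
      by_cases hi : i = r
      · rw [hi]
      · refine SimpleGraph.Reachable.trans ?_ (hadj i hi).reachable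
        rcases (hπ i hi).2 with h1 | ⟨h1, h2⟩
        · rw [h1]
        · exact ih _ (hn ▸ h2) (π i) rfl
  have hconn : G.Connected :=
    { preconnected := fun a b => (hreach a).symm.trans (hreach b), nonempty := ⟨r⟩ }
  have htree : G.IsTree := by
    have := Fintype.ofFinite ι
    rw [SimpleGraph.isTree_iff_connected_and_card]
    refine ⟨hconn, le_antisymm ?_ hconn.card_vert_le_card_edgeSet_add_one⟩
    have hsub : G.edgeSet ⊆ ((Finset.univ.erase r).image fun i => s(π i, i) : Finset (Sym2 ι)) := by
      intro e he
      induction e using Sym2.ind with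
      | _ a b =>
        rw [SimpleGraph.mem_edgeSet] at he
        obtain ⟨-, x, hx, y, hy, hxy⟩ := (hG a b).1 he
        rw [Finset.mem_coe, Finset.mem_image]
        rcases hcase a b x y hx hy hxy with ⟨hb, e, -⟩ | ⟨ha, e, -⟩
        · exact ⟨b, by simpa using hb, by rw [e]⟩
        · exact ⟨a, by simpa using ha, by rw [e, Sym2.eq_swap]⟩
    have h1 : Nat.card G.edgeSet ≤ (Finset.univ.erase r).card := by
      refine (Nat.card_mono (Finset.finite_toSet _) hsub).trans ?_
      rw [Nat.card_eq_card_toFinset, Finset.toFinset_coe]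
      exact Finset.card_image_le
    have h2 : (Finset.univ.erase r).card + 1 = Nat.card ι := by
      rw [Finset.card_erase_add_one (Finset.mem_univ r), Finset.card_univ,
        Nat.card_eq_fintype_card]
    omega
  -- Ranks order the vertices by parenthood, but the star condition refers to distances. If π i were
  -- farther from r than i, then i and π (π i) would both be neighbours of π i nearer to r, hence
  -- equal, against the decrease of ranks.
  have hdist : ∀ i ≠ r, G.dist r (π i) < G.dist r i := by
    intro i
    induction hn : h i using Nat.strong_induction_on generalizing i with
    | _ n ih =>
      intro hi
      by_contra hcon
      have hlt : G.dist r i < G.dist r (π i) :=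
        lt_of_le_of_ne (not_lt.1 hcon) (htree.dist_ne_of_adj r (hadj i hi)).symm
      rcases (hπ i hi).2 with h1 | ⟨h1, h2⟩
      · rw [h1] at hlt; simp at hlt
      · have h3 := ih _ (hn ▸ h2) (π i) rfl h1
        have h4 := eq_of_adj_of_dist_lt htree r (hadj i hi).symm (hadj (π i) h1) hlt h3
        rcases (hπ (π i) h1).2 with h5 | ⟨-, h5⟩
        · exact hi (h4.trans h5)
        · rw [← h4] at h5; exact lt_asymm h2 h5
  refine ⟨?_, htree, ?_⟩
  · intro e he
    obtain ⟨i, hi, y, hy, rfl⟩ := (hf e).1 he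
    exact ⟨π i, i, hπne i hi, p i, (hπ i hi).1, y, (hp i hi).1 hy, rfl⟩
  · intro a b hab x hx x' hx' y hy y' hy' h1 h2
    have hno : ∀ x ∈ bl a, ∀ y ∈ bl b, s(x, y) ∈ f → x = p b := by
      intro x hx y hy hxy
      rcases hcase a b x y hx hy hxy with ⟨-, -, e⟩ | ⟨ha, e, -⟩
      · exact e
      · have := hdist a ha
        rw [e] at this
        exact absurd hab (not_lt.2 this.le)
    rw [hno x hx y hy h1, hno x' hx' y' hy' h2]

end TreeCharacterization

/-! ### Identification of forest graphs with parent forests. -/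

section Concrete

variable {d : ℕ}

/-- The one-point blocks of a configuration. -/
noncomputable def singles (γ : Finset (Pt d)) : Finset (Finset (Pt d)) := γ.image fun y => {y}

/-- All blocks other than the root: the clusters after the first one and the points of `γ`. -/
noncomputable def tailBlocks {r : ℕ} (η : Fin r → Finset (Pt d)) (γ : Finset (Pt d)) :
    Finset (Finset (Pt d)) := Finset.univ.image η ∪ singles γ

lemma pts_singles (γ : Finset (Pt d)) : pts (singles γ) = γ := by
  ext; simp [singles]

lemma pts_image_univ {r : ℕ} (η : Fin r → Finset (Pt d)) :
    pts (Finset.univ.image η) = allPts η := by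
  ext; simp [allPts]

lemma pts_tailBlocks {r : ℕ} (η : Fin r → Finset (Pt d)) (γ : Finset (Pt d)) :
    pts (tailBlocks η γ) = allPts η ∪ γ := by
  rw [tailBlocks, pts_union, pts_singles, pts_image_univ]

lemma allPts_eq_union_tail {r : ℕ} (η : Fin (r + 1) → Finset (Pt d)) :
    allPts η = η 0 ∪ allPts (Fin.tail η) := by
  ext x
  simp only [allPts, Finset.mem_biUnion, Finset.mem_univ, true_and, Finset.mem_union, Fin.tail,
    Fin.exists_fin_succ]

lemma blockSystem_tailBlocks {r : ℕ} {η : Fin (r + 1) → Finset (Pt d)} {γ : Finset (Pt d)}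
    (hη : DisjointClusters η) (hne : ∀ i : Fin r, (η i.succ).Nonempty)
    (hγ : Disjoint γ (allPts η)) : BlockSystem (η 0) (tailBlocks (Fin.tail η) γ) := by
  have hγ' : ∀ i, Disjoint γ (η i) := fun i =>
    hγ.mono_right (Finset.subset_biUnion_of_mem η (Finset.mem_univ i))
  refine ⟨?_, ?_, ?_⟩
  · intro B hB
    simp only [tailBlocks, singles, Finset.mem_union, Finset.mem_image, Finset.mem_univ,
      true_and] at hB
    rcases hB with ⟨i, rfl⟩ | ⟨y, -, rfl⟩
    · exact hne i
    · exact Finset.singleton_nonempty y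
  · intro B hB B' hB' hBB
    simp only [tailBlocks, singles, Finset.mem_union, Finset.mem_image, Finset.mem_univ,
      true_and] at hB hB'
    rcases hB with ⟨i, rfl⟩ | ⟨y, hy, rfl⟩ <;> rcases hB' with ⟨k, rfl⟩ | ⟨w, hw, rfl⟩
    · exact hη fun e => hBB (by rw [Fin.succ_injective _ e])
    · exact Finset.disjoint_singleton_right.2 fun h => Finset.disjoint_left.1 (hγ' _) hw h
    · exact Finset.disjoint_singleton_left.2 fun h => Finset.disjoint_left.1 (hγ' _) hy h
    · exact Finset.disjoint_singleton.2 fun h => hBB (by rw [h])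
  · intro B hB
    simp only [tailBlocks, singles, Finset.mem_union, Finset.mem_image, Finset.mem_univ,
      true_and] at hB
    rcases hB with ⟨i, rfl⟩ | ⟨y, hy, rfl⟩
    · exact hη (Fin.succ_ne_zero i).symm
    · exact Finset.disjoint_singleton_right.2 fun h => Finset.disjoint_left.1 (hγ' _) hy h

lemma block_disjoint {m : ℕ} {η : Fin m → Finset (Pt d)} {γ : Finset (Pt d)}
    (hη : DisjointClusters η) (hγ : Disjoint γ (allPts η)) (a b : Fin m ⊕ {y // y ∈ γ})
    (hab : a ≠ b) : Disjoint (block η γ a) (block η γ b) := by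
  have hγ' : ∀ i, Disjoint γ (η i) := fun i =>
    hγ.mono_right (Finset.subset_biUnion_of_mem η (Finset.mem_univ i))
  rcases a with i | ⟨y, hy⟩ <;> rcases b with k | ⟨w, hw⟩ <;> simp only [block, Sum.elim_inl, Sum.elim_inr]
  · exact hη fun e => hab (by rw [e])
  · exact Finset.disjoint_singleton_right.2 fun h => Finset.disjoint_left.1 (hγ' _) hw h
  · exact Finset.disjoint_singleton_left.2 fun h => Finset.disjoint_left.1 (hγ' _) hy h
  · exact Finset.disjoint_singleton.2 fun h => hab (by subst h; rfl)

lemma mem_tailBlocks_iff {r : ℕ} {η : Fin (r + 1) → Finset (Pt d)} {γ : Finset (Pt d)}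
    {B : Finset (Pt d)} : B ∈ tailBlocks (Fin.tail η) γ ↔ ∃ a ≠ Sum.inl 0, block η γ a = B := by
  simp only [tailBlocks, singles, Finset.mem_union, Finset.mem_image, Finset.mem_univ, true_and,
    Sum.exists, ne_eq, Sum.inl.injEq, block, Sum.elim_inl, Sum.elim_inr, reduceCtorEq,
    not_false_eq_true, Fin.exists_fin_succ, not_true_eq_false, false_and, false_or,
    Fin.succ_ne_zero, Fin.tail, Subtype.exists, exists_prop]

/-- Disjoint nonempty blocks are distinct, so the index of a block and the block determine each
other, and parent data can be carried between indexed families and sets of blocks. -/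
lemma isForestGraph_iff {r : ℕ} {η : Fin (r + 1) → Finset (Pt d)} {γ : Finset (Pt d)}
    (hη : DisjointClusters η) (hne : ∀ i, (η i).Nonempty) (hγ : Disjoint γ (allPts η))
    (f : Finset (Sym2 (Pt d))) :
    IsForestGraph η γ f ↔ IsParentForest (η 0) (tailBlocks (Fin.tail η) γ) f := by
  have hbd := block_disjoint hη hγ
  have hbne : ∀ a, (block η γ a).Nonempty := by
    rintro (i | ⟨y, hy⟩)
    · exact hne i
    · exact Finset.singleton_nonempty y
  have hinj : Function.Injective (block η γ) := by
    intro a b e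
    by_contra hab
    have := hbd a b hab
    rw [e, Finset.disjoint_self_iff_empty] at this
    exact (hbne b).ne_empty this
  constructor
  · rintro ⟨h1, h2, h3⟩
    obtain ⟨p, ζ, h, hp, hf⟩ := exists_parent_of_isTree (block η γ) (Sum.inl 0)
      (contracted η γ f) f hbne (fun a b => Iff.rfl) h1 h2 h3
    have hinv := Function.leftInverse_invFun hinj
    refine ⟨p ∘ Function.invFun (block η γ), ζ ∘ Function.invFun (block η γ),
      h ∘ Function.invFun (block η γ), ?_, ?_⟩
    · intro B hB
      obtain ⟨a, ha, rfl⟩ := mem_tailBlocks_iff.1 hB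
      simp only [Function.comp, hinv a]
      obtain ⟨h1, h2, k, h3, h4⟩ := hp a ha
      refine ⟨h1, h2, ?_⟩
      rcases h4 with rfl | ⟨h4, h5⟩
      · exact Or.inl h3
      · exact Or.inr ⟨block η γ k, mem_tailBlocks_iff.2 ⟨k, h4, rfl⟩, h3, by rwa [hinv k]⟩
    · ext e
      rw [hf]
      simp only [Finset.mem_biUnion, Finset.mem_image, Function.comp]
      constructor
      · rintro ⟨i, hi, y, hy, rfl⟩
        exact ⟨block η γ i, mem_tailBlocks_iff.2 ⟨i, hi, rfl⟩, y, by rwa [hinv i], by rw [hinv i]⟩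
      · rintro ⟨B, hB, y, hy, rfl⟩
        obtain ⟨a, ha, rfl⟩ := mem_tailBlocks_iff.1 hB
        rw [hinv a] at hy ⊢
        exact ⟨a, ha, y, hy, rfl⟩
  · rintro ⟨p, ζ, h, hp, hf⟩
    obtain ⟨h1, h2, h3⟩ := isTree_of_exists_parent (block η γ) (Sum.inl 0) (contracted η γ f) f hbd
      (fun a b => Iff.rfl) (fun a => p (block η γ a)) (fun a => ζ (block η γ a))
      (fun a => h (block η γ a)) (by
        intro a ha
        obtain ⟨h1, h2, h3⟩ := hp _ (mem_tailBlocks_iff.2 ⟨a, ha, rfl⟩)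
        refine ⟨h1, h2, ?_⟩
        rcases h3 with h3 | ⟨B, hB, h3, h4⟩
        · exact ⟨Sum.inl 0, h3, Or.inl rfl⟩
        · obtain ⟨k, hk, rfl⟩ := mem_tailBlocks_iff.1 hB
          exact ⟨k, h3, Or.inr ⟨hk, h4⟩⟩) (by
        intro e
        rw [hf]
        simp only [Finset.mem_biUnion, Finset.mem_image]
        constructor
        · rintro ⟨B, hB, y, hy, rfl⟩
          obtain ⟨a, ha, rfl⟩ := mem_tailBlocks_iff.1 hB
          exact ⟨a, ha, y, hy, rfl⟩
        · rintro ⟨a, ha, y, hy, rfl⟩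
          exact ⟨_, mem_tailBlocks_iff.2 ⟨a, ha, rfl⟩, y, hy, rfl⟩)
    exact ⟨h1, h2, h3⟩

lemma forests_eq_parentForests {r : ℕ} {η : Fin (r + 1) → Finset (Pt d)} {γ : Finset (Pt d)}
    (hη : DisjointClusters η) (hne : ∀ i, (η i).Nonempty) (hγ : Disjoint γ (allPts η)) :
    forests η γ = parentForests (η 0) (tailBlocks (Fin.tail η) γ) := by
  ext f
  rw [mem_parentForests, ← isForestGraph_iff hη hne hγ, forests, Finset.mem_filter,
    Finset.mem_powerset, and_iff_right_iff_imp, isForestGraph_iff hη hne hγ]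
  intro hf
  have := hf.subset_sym2
  rwa [pts_tailBlocks, ← Finset.union_assoc, ← allPts_eq_union_tail] at this

/-- The set of unreached points remains a union of whole blocks. The hypothesis `h` says that, among
those points, being equal or in a common cluster means being in the same block. -/
lemma exploreEdges_eq_explore {m : ℕ} (sel : Finset (Pt d) → Pt d) (η : Fin m → Finset (Pt d))
    (f : Finset (Sym2 (Pt d))) (N : ℕ) (A : Finset (Pt d)) (S : Finset (Finset (Pt d)))
    (h : ∀ B ∈ S, ∀ u ∈ B, ∀ y ∈ pts S, (u = y ∨ ∃ i, u ∈ η i ∧ y ∈ η i) ↔ y ∈ B)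
    (hd : ∀ B ∈ S, ∀ B' ∈ S, B ≠ B' → Disjoint B B') :
    exploreEdges sel η f N A (pts S) = explore sel f N A S := by
  induction N generalizing A S with
  | zero => rfl
  | succ N ih =>
    have hnew : ({y ∈ pts S | ∃ u ∈ pts S, s(sel A, u) ∈ f ∧ (u = y ∨ ∃ i, u ∈ η i ∧ y ∈ η i)} :
        Finset (Pt d)) = pts (nbrBlocks S (sel A) f) := by
      ext y
      simp only [Finset.mem_filter]
      constructor
      · rintro ⟨hy, u, hu, huf, huy⟩
        obtain ⟨B, hB, huB⟩ := Finset.mem_biUnion.1 hu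
        exact Finset.mem_biUnion.2 ⟨B, Finset.mem_filter.2 ⟨hB, u, huB, huf⟩,
          (h B hB u huB y hy).1 huy⟩
      · intro hy
        obtain ⟨B, hB, hyB⟩ := Finset.mem_biUnion.1 hy
        obtain ⟨hB, u, huB, huf⟩ := Finset.mem_filter.1 hB
        have hy' : y ∈ pts S := Finset.mem_biUnion.2 ⟨B, hB, hyB⟩
        exact ⟨hy', u, Finset.mem_biUnion.2 ⟨B, hB, huB⟩, huf, (h B hB u huB y hy').2 hyB⟩
    have hsd : pts S \ pts (nbrBlocks S (sel A) f) = pts (S \ nbrBlocks S (sel A) f) := by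
      have hU := nbrBlocks_subset S (sel A) f
      rw [← pts_union_pts_sdiff hU, Finset.union_sdiff_cancel_left]
      rw [Finset.disjoint_biUnion_left]
      intro B hB
      rw [Finset.disjoint_biUnion_right]
      intro B' hB'
      have hB' := Finset.mem_sdiff.1 hB'
      exact hd B (hU hB) B' hB'.1 (by rintro rfl; exact hB'.2 hB)
    unfold exploreEdges explore
    split_ifs with hA
    · rfl
    · simp only []
      rw [hnew, hsd, ih]
      · rfl
      · intro B hB u hu y hy
        exact h B (Finset.sdiff_subset hB) u hu y
          (Finset.biUnion_subset_biUnion_of_subset_left id Finset.sdiff_subset hy)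
      · exact fun B hB B' hB' => hd B (Finset.sdiff_subset hB) B' (Finset.sdiff_subset hB')

lemma sum_card_eq_card_allPts {m : ℕ} {η : Fin m → Finset (Pt d)} (hη : DisjointClusters η) :
    ∑ i, (η i).card = (allPts η).card :=
  (Finset.card_biUnion fun _ _ _ _ h => hη h).symm

lemma numPts_tailBlocks {r : ℕ} {η : Fin (r + 1) → Finset (Pt d)} {γ : Finset (Pt d)}
    (hη : DisjointClusters η) (hγ : Disjoint γ (allPts η)) :
    numPts (η 0) (tailBlocks (Fin.tail η) γ) = ∑ i, (η i).card + γ.card := by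
  rw [numPts, pts_tailBlocks, ← Finset.union_assoc, ← allPts_eq_union_tail,
    Finset.card_union_of_disjoint hγ.symm, sum_card_eq_card_allPts hη]

lemma addedEdges_eq_explore {r : ℕ} {η : Fin (r + 1) → Finset (Pt d)} {γ : Finset (Pt d)}
    (hη : DisjointClusters η) (hne : ∀ i, (η i).Nonempty) (hγ : Disjoint γ (allPts η))
    (sel : Finset (Pt d) → Pt d) (f : Finset (Sym2 (Pt d))) :
    addedEdges sel η γ f = explore sel f (numPts (η 0) (tailBlocks (Fin.tail η) γ)) (η 0)
      (tailBlocks (Fin.tail η) γ) := by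
  have hS := blockSystem_tailBlocks hη (fun i => hne i.succ) hγ
  have hsame : ∀ i k y, y ∈ η i → y ∈ η k → i = k := fun i k y hy hy' => by
    by_contra hne
    exact Finset.disjoint_left.1 (hη hne) hy hy'
  have hγ' : ∀ i, Disjoint γ (η i) := fun i =>
    hγ.mono_right (Finset.subset_biUnion_of_mem η (Finset.mem_univ i))
  rw [addedEdges, numPts_tailBlocks hη hγ, ← exploreEdges_eq_explore sel η f _ _ _ _ hS.pairwise]
  · congr 1
    rw [pts_tailBlocks, allPts_eq_union_tail, Finset.union_assoc, Finset.union_sdiff_cancel_left]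
    have := hS.disjoint_pts
    rwa [pts_tailBlocks] at this
  · intro B hB u hu y hy
    simp only [tailBlocks, singles, Finset.mem_union, Finset.mem_image, Finset.mem_univ,
      true_and] at hB
    rcases hB with ⟨i, rfl⟩ | ⟨w, hw, rfl⟩
    · constructor
      · rintro (rfl | ⟨k, hk, hk'⟩)
        · exact hu
        · rwa [hsame _ _ _ hk hu] at hk'
      · exact fun h => Or.inr ⟨_, hu, h⟩
    · rw [Finset.mem_singleton] at hu ⊢
      subst hu
      constructor
      · rintro (rfl | ⟨k, hk, hk'⟩)
        · rfl
        · exact absurd hk (Finset.disjoint_left.1 (hγ' k) hw)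
      · rintro rfl; exact Or.inl rfl

end Concrete

end PTCF

namespace PTCF

/-! ### Boltzmann factors of extended real energies. -/

section Boltzmann

variable {β : ℝ}

lemma boltz_nonneg (β : ℝ) (a : EReal) : 0 ≤ boltz β a := ENNReal.toReal_nonneg

lemma boltz_top (hβ : 0 < β) : boltz β ⊤ = 0 := by
  simp [boltz, EReal.coe_mul_top_of_pos hβ]

lemma boltz_coe (β r : ℝ) : boltz β (r : EReal) = Real.exp (-(β * r)) := by
  rw [boltz, ← EReal.coe_mul, ← EReal.coe_neg, EReal.exp_coe,
    ENNReal.toReal_ofReal (Real.exp_pos _).le]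

lemma boltz_zero (β : ℝ) : boltz β 0 = 1 := by
  have := boltz_coe β 0
  simpa using this

lemma boltz_add (hβ : 0 < β) {a b : EReal} (ha : a ≠ ⊥) (hb : b ≠ ⊥) :
    boltz β (a + b) = boltz β a * boltz β b := by
  induction a with
  | bot => exact absurd rfl ha
  | top => rw [EReal.top_add_of_ne_bot hb, boltz_top hβ, zero_mul]
  | coe a =>
    induction b with
    | bot => exact absurd rfl hb
    | top => rw [EReal.add_top_of_ne_bot ha, boltz_top hβ, mul_zero]
    | coe b =>
      rw [← EReal.coe_add, boltz_coe, boltz_coe, boltz_coe, ← Real.exp_add]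
      ring_nf

lemma sum_ne_bot {ι : Type*} (s : Finset ι) (g : ι → EReal) (h : ∀ i ∈ s, g i ≠ ⊥) :
    ∑ i ∈ s, g i ≠ ⊥ := by
  induction s using Finset.cons_induction with
  | empty => simp
  | cons a s ha ih =>
    rw [Finset.sum_cons]
    rw [Ne, EReal.add_eq_bot_iff, not_or]
    exact ⟨h a (Finset.mem_cons_self _ _), ih fun i hi => h i (Finset.mem_cons_of_mem hi)⟩

lemma boltz_sum (hβ : 0 < β) {ι : Type*} (s : Finset ι) (g : ι → EReal)
    (h : ∀ i ∈ s, g i ≠ ⊥) : boltz β (∑ i ∈ s, g i) = ∏ i ∈ s, boltz β (g i) := by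
  induction s using Finset.cons_induction with
  | empty => simp [boltz_zero]
  | cons a s ha ih =>
    rw [Finset.sum_cons, Finset.prod_cons, boltz_add hβ (h a (Finset.mem_cons_self _ _))
      (sum_ne_bot s g fun i hi => h i (Finset.mem_cons_of_mem hi)),
      ih fun i hi => h i (Finset.mem_cons_of_mem hi)]

lemma boltz_le (hβ : 0 < β) {a : EReal} {r : ℝ} (h : (r : EReal) ≤ a) :
    boltz β a ≤ Real.exp (-(β * r)) := by
  induction a with
  | bot => simp at h
  | top => rw [boltz_top hβ]; positivity
  | coe a =>
    rw [boltz_coe, Real.exp_le_exp]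
    have := mul_le_mul_of_nonneg_left (EReal.coe_le_coe_iff.1 h) hβ.le
    linarith

end Boltzmann

/-! ### Energies, stability and the selected point. -/

section Energies

variable {d : ℕ} {φ : ℝ → EReal}

lemma energyU_empty : energyU (d := d) φ ∅ = 0 := by simp [energyU]

lemma energyU_insert (x : Pt d) (A : Finset (Pt d)) (hx : x ∉ A) :
    energyU φ (insert x A) = energyW φ x A + energyU φ A := by
  have hset : ((insert x A).sym2.filter fun e => ¬ e.IsDiag) =
      (A.image fun y => s(x, y)) ∪ A.sym2.filter fun e => ¬ e.IsDiag := by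
    ext e
    induction e using Sym2.ind with
    | _ a b =>
      simp only [Finset.mem_filter, Finset.mk_mem_sym2_iff, Finset.mem_insert, Sym2.mk_isDiag_iff,
        Finset.mem_union, Finset.mem_image, Sym2.eq_iff]
      constructor
      · rintro ⟨⟨rfl | ha, rfl | hb⟩, hab⟩
        · exact absurd rfl hab
        · exact Or.inl ⟨b, hb, Or.inl ⟨rfl, rfl⟩⟩
        · exact Or.inl ⟨a, ha, Or.inr ⟨rfl, rfl⟩⟩
        · exact Or.inr ⟨⟨ha, hb⟩, hab⟩
      · rintro (⟨y, hy, ⟨rfl, rfl⟩ | ⟨rfl, rfl⟩⟩ | ⟨⟨ha, hb⟩, hab⟩)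
        · exact ⟨⟨Or.inl rfl, Or.inr hy⟩, fun e => hx (e ▸ hy)⟩
        · exact ⟨⟨Or.inr hy, Or.inl rfl⟩, fun e => hx (e ▸ hy)⟩
        · exact ⟨⟨Or.inr ha, Or.inr hb⟩, hab⟩
  rw [energyU, hset, Finset.sum_union, Finset.sum_image]
  · rfl
  · intro y _ y' _ e
    exact Sym2.congr_right.1 e
  · rw [Finset.disjoint_left]
    intro e he he'
    obtain ⟨y, -, rfl⟩ := Finset.mem_image.1 he
    exact hx (Finset.mk_mem_sym2_iff.1 (Finset.mem_filter.1 he').1).1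

lemma energyW_ne_bot (hφ : AssumptionA d φ) (x : Pt d) (A : Finset (Pt d)) : energyW φ x A ≠ ⊥ :=
  sum_ne_bot _ _ fun _ _ => hφ.ne_bot _ dist_nonneg

lemma energyU_ne_bot (hφ : AssumptionA d φ) (A : Finset (Pt d)) : energyU φ A ≠ ⊥ := by
  refine sum_ne_bot _ _ fun e _ => ?_
  induction e using Sym2.ind with
  | _ a b => exact hφ.ne_bot _ dist_nonneg

/-- The Boltzmann factor of a pair of points. -/
noncomputable def bond (φ : ℝ → EReal) (β : ℝ) (x y : Pt d) : ℝ := boltz β (φ (dist x y))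

/-- The Boltzmann factor of a configuration. -/
noncomputable def gibbs (φ : ℝ → EReal) (β : ℝ) (A : Finset (Pt d)) : ℝ := boltz β (energyU φ A)

lemma bond_nonneg (β : ℝ) (x y : Pt d) : 0 ≤ bond φ β x y := boltz_nonneg _ _

lemma mayer_dist (β : ℝ) (x y : Pt d) : mayer φ β (dist x y) = bond φ β x y - 1 := rfl

lemma boltz_energyW (hφ : AssumptionA d φ) {β : ℝ} (hβ : 0 < β) (x : Pt d) (A : Finset (Pt d)) :
    boltz β (energyW φ x A) = ∏ y ∈ A, bond φ β x y :=
  boltz_sum hβ _ _ fun _ _ => hφ.ne_bot _ dist_nonneg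

lemma gibbs_empty (β : ℝ) : gibbs φ β (∅ : Finset (Pt d)) = 1 := by
  rw [gibbs, energyU_empty, boltz_zero]

lemma gibbs_nonneg (β : ℝ) (A : Finset (Pt d)) : 0 ≤ gibbs φ β A := boltz_nonneg _ _

lemma gibbs_erase (hφ : AssumptionA d φ) {β : ℝ} (hβ : 0 < β) (A : Finset (Pt d)) (x : Pt d)
    (hx : x ∈ A) : gibbs φ β A = (∏ y ∈ A.erase x, bond φ β x y) * gibbs φ β (A.erase x) := by
  conv_lhs => rw [← Finset.insert_erase hx]
  rw [gibbs, energyU_insert x _ (Finset.notMem_erase x A),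
    boltz_add hβ (energyW_ne_bot hφ _ _) (energyU_ne_bot hφ _), boltz_energyW hφ hβ, gibbs]

lemma gibbs_le (hβ : 0 < β) {B : ℝ} (hB : IsStable d φ B) (A : Finset (Pt d)) :
    gibbs φ β A ≤ Real.exp (β * B) ^ A.card := by
  refine (boltz_le hβ (hB A)).trans (le_of_eq ?_)
  rw [← Real.exp_nat_mul]
  ring_nf

lemma kerK_eq (β : ℝ) (x : Pt d) (ξ : Finset (Pt d)) :
    kerK φ β x ξ = ∏ y ∈ ξ, (bond φ β x y - 1) := rfl

lemma sum_offDiag_insert {M : Type*} [AddCommMonoid M] (g : Pt d → Pt d → M)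
    (hg : ∀ x y, g x y = g y x) (x : Pt d) (A : Finset (Pt d)) (hx : x ∉ A) :
    ∑ u ∈ insert x A, ∑ y ∈ (insert x A).erase u, g u y =
      ∑ y ∈ A, g x y + (∑ y ∈ A, g x y + ∑ u ∈ A, ∑ y ∈ A.erase u, g u y) := by
  rw [Finset.sum_insert hx, Finset.erase_insert hx]
  have : ∀ u ∈ A, ∑ y ∈ (insert x A).erase u, g u y = g x u + ∑ y ∈ A.erase u, g u y := by
    intro u hu
    rw [Finset.erase_insert_of_ne (by rintro rfl; exact hx hu),
      Finset.sum_insert (fun h => hx (Finset.mem_of_mem_erase h)), hg]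
  rw [Finset.sum_congr rfl this, Finset.sum_add_distrib]

lemma coe_sum_ereal {ι : Type*} (s : Finset ι) (g : ι → ℝ) :
    ((∑ i ∈ s, g i : ℝ) : EReal) = ∑ i ∈ s, (g i : EReal) := by
  induction s using Finset.cons_induction with
  | empty => simp
  | cons a s ha ih => rw [Finset.sum_cons, Finset.sum_cons, EReal.coe_add, ih]

/-- Twice the energy is the sum over ordered pairs. -/
lemma sum_energyW (A : Finset (Pt d)) :
    ∑ x ∈ A, energyW φ x (A.erase x) = energyU φ A + energyU φ A := by
  induction A using Finset.induction_on with
  | empty => simp [energyU_empty]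
  | insert x A hx ih =>
    simp only [energyW] at ih ⊢
    rw [sum_offDiag_insert (fun x y => φ (dist x y)) (fun x y => by rw [dist_comm]) x A hx, ih,
      energyU_insert x A hx, energyW]
    abel

lemma le_energyU (g : Pt d → Pt d → ℝ) (hg : ∀ x y, g x y = g y x) (A : Finset (Pt d))
    (h : ∀ x ∈ A, ∀ y ∈ A, x ≠ y → ((g x y : ℝ) : EReal) ≤ φ (dist x y)) :
    (((∑ u ∈ A, ∑ y ∈ A.erase u, g u y) / 2 : ℝ) : EReal) ≤ energyU φ A := by
  induction A using Finset.induction_on with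
  | empty => simp [energyU_empty]
  | insert x A hx ih =>
    rw [energyU_insert x A hx, sum_offDiag_insert g hg x A hx]
    have h1 : ((∑ y ∈ A, g x y : ℝ) : EReal) ≤ energyW φ x A := by
      rw [energyW, coe_sum_ereal]
      exact Finset.sum_le_sum fun y hy => h x (Finset.mem_insert_self _ _) y
        (Finset.mem_insert_of_mem hy) (by rintro rfl; exact hx hy)
    have h2 := ih fun u hu y hy => h u (Finset.mem_insert_of_mem hu) y (Finset.mem_insert_of_mem hy)
    have := add_le_add h1 h2
    rw [← EReal.coe_add] at this
    refine le_trans (le_of_eq ?_) this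
    congr 1
    ring

/-- The average over x in A of W(x; A \ x) is 2U(A)/|A|, which stability bounds below by -2B; some
point reaches the average. -/
lemma exists_selection (hφ : AssumptionA d φ) {B : ℝ} (hB : IsStable d φ B) :
    ∃ sel : Finset (Pt d) → Pt d, IsSelection φ B sel := by
  have key : ∀ A : Finset (Pt d), ∃ x, A.Nonempty →
      x ∈ A ∧ ((-2 * B : ℝ) : EReal) ≤ energyW φ x (A.erase x) := by
    intro A
    by_contra! hcon
    have hA : A.Nonempty := (hcon 0).1
    have hlt : ∀ x ∈ A, energyW φ x (A.erase x) < ((-2 * B : ℝ) : EReal) := fun x hx =>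
      (hcon x).2 hx
    -- In the proof by contradiction all energies are below -2B, hence finite, and the strict
    -- inequality can be summed over the reals.
    have hre : ∀ x ∈ A, energyW φ x (A.erase x) =
        (((energyW φ x (A.erase x)).toReal : ℝ) : EReal) := fun x hx =>
      (EReal.coe_toReal ((hlt x hx).trans (EReal.coe_lt_top _)).ne (energyW_ne_bot hφ _ _)).symm
    have h1 : ∑ x ∈ A, energyW φ x (A.erase x) < ((A.card * (-2 * B) : ℝ) : EReal) := by
      rw [Finset.sum_congr rfl hre, ← coe_sum_ereal, EReal.coe_lt_coe_iff]
      calc ∑ x ∈ A, (energyW φ x (A.erase x)).toReal < ∑ x ∈ A, (-2 * B) := by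
            refine Finset.sum_lt_sum_of_nonempty hA fun x hx => ?_
            have := hlt x hx
            rw [hre x hx, EReal.coe_lt_coe_iff] at this
            exact this
        _ = A.card * (-2 * B) := by rw [Finset.sum_const, nsmul_eq_mul]
    rw [sum_energyW] at h1
    have h2 := add_le_add (hB A) (hB A)
    rw [← EReal.coe_add] at h2
    have h3 := h2.trans_lt h1
    rw [EReal.coe_lt_coe_iff] at h3
    linarith
  choose sel hsel using key
  exact ⟨sel, hsel⟩

lemma IsSelection.prod_bond_le (hφ : AssumptionA d φ) {β B : ℝ} (hβ : 0 < β)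
    {sel : Finset (Pt d) → Pt d} (h : IsSelection φ B sel) {A : Finset (Pt d)} (hA : A.Nonempty) :
    ∏ y ∈ A.erase (sel A), bond φ β (sel A) y ≤ Real.exp (2 * β * B) := by
  rw [← boltz_energyW hφ hβ]
  refine (boltz_le hβ (h A hA).2).trans (le_of_eq ?_)
  ring_nf

end Energies

end PTCF

namespace PTCF

/-! ### Lower bounds for the potential. -/

section LowerBound

variable {d : ℕ} {φ : ℝ → EReal}

/-- A repulsive core `φ₁ r^{-d}` minus an integrable tail bounds the potential from below. -/
lemma exists_potential_bound (hφ : AssumptionA d φ) :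
    ∃ a C R R' ε : ℝ, 0 < a ∧ 0 ≤ C ∧ 0 < R ∧ 0 < R' ∧ 0 < ε ∧
      (∀ r, 0 < r → ((((if r < R then a * r ^ (-(d : ℝ)) else 0) -
        C * (1 + r) ^ (-((d : ℝ) + ε)) : ℝ)) : EReal) ≤ φ r) ∧
      ∀ r, R' < r → φ r ≤ 0 := by
  obtain ⟨r₁, r₀, r₂, φ₁, φ₂, s, ε, h1, h10, h02, hφ1, hφ2, hs, hε, hcore, hcoreb, htail, htailb⟩ :=
    hφ.core_tail
  have hr0 : 0 < r₀ := h1.trans h10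
  have hr2 : 0 < r₂ := hr0.trans h02
  have hde : 0 < (d : ℝ) + ε := by positivity
  -- On the compact range between r₀ and r₂ continuity gives a minimum, which is not -∞.
  obtain ⟨M, hM0, hM⟩ : ∃ M : ℝ, 0 ≤ M ∧ ∀ r, r₀ ≤ r → r ≤ r₂ → ((-M : ℝ) : EReal) ≤ φ r := by
    obtain ⟨t, ht, hmin⟩ := (isCompact_Icc (a := r₀) (b := r₂)).exists_isMinOn
      (Set.nonempty_Icc.2 h02.le)
      (hφ.cont.mono fun x hx => lt_of_lt_of_le hr0 hx.1)
    have hb := hφ.ne_bot t (hr0.le.trans ht.1)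
    refine ⟨max 0 (-(φ t).toReal), le_max_left _ _, fun r h h' => ?_⟩
    refine le_trans ?_ (hmin ⟨h, h'⟩)
    rcases eq_or_ne (φ t) ⊤ with he | he
    · simp [he]
    · conv_rhs => rw [← EReal.coe_toReal he hb]
      rw [EReal.coe_le_coe_iff]
      have := le_max_right 0 (-(φ t).toReal)
      linarith
  -- For r > r₂ one has r ≥ q (1 + r), which turns the tail bound in r into one in 1 + r. The two
  -- summands of C below serve the compact range and the tail.
  set q : ℝ := r₂ / (1 + r₂) with hq
  have hq0 : 0 < q := by positivity
  set C : ℝ := M * (1 + r₂) ^ ((d : ℝ) + ε) + φ₂ * q ^ (-((d : ℝ) + ε)) with hC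
  have hC0 : 0 ≤ C := by positivity
  -- The cut at 1 is what allows r^{-s} to be weakened to r^{-d} when s ≥ d.
  refine ⟨φ₁, C, min r₁ 1, r₀, ε, hφ1, hC0, lt_min h1 one_pos, hr0, hε, ?_, ?_⟩
  · intro r hr
    have hp : 0 < (1 + r) ^ (-((d : ℝ) + ε)) := by positivity
    by_cases hrR : r < min r₁ 1
    · rw [if_pos hrR]
      have hr1 := hrR.trans_le (min_le_left _ _)
      have hr1' := hrR.trans_le (min_le_right _ _)
      rw [hcore r hr (hr1.le.trans h10.le)]
      refine le_trans ?_ (hcoreb r hr hr1)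
      rw [EReal.coe_le_coe_iff]
      have h3 : r ^ (-(d : ℝ)) ≤ r ^ (-s) :=
        Real.rpow_le_rpow_of_exponent_ge hr hr1'.le (by linarith)
      have h4 := mul_le_mul_of_nonneg_left h3 hφ1.le
      have h5 := mul_nonneg hC0 hp.le
      linarith
    · rw [if_neg hrR, zero_sub]
      rcases le_or_gt r r₀ with h3 | h3
      · rw [hcore r hr h3]
        refine le_trans ?_ (le_max_left _ _)
        have := mul_nonneg hC0 hp.le
        exact_mod_cast neg_nonpos.2 this
      · rcases le_or_gt r r₂ with h4 | h4
        · refine le_trans ?_ (hM r h3.le h4)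
          rw [EReal.coe_le_coe_iff, neg_le_neg_iff]
          have h5 : 1 ≤ (1 + r₂) ^ ((d : ℝ) + ε) * (1 + r) ^ (-((d : ℝ) + ε)) := by
            rw [Real.rpow_neg (by positivity), ← div_eq_mul_inv, one_le_div (by positivity)]
            exact Real.rpow_le_rpow (by positivity) (by linarith) hde.le
          calc M = M * 1 := (mul_one M).symm
            _ ≤ M * ((1 + r₂) ^ ((d : ℝ) + ε) * (1 + r) ^ (-((d : ℝ) + ε))) := by gcongr
            _ = M * (1 + r₂) ^ ((d : ℝ) + ε) * (1 + r) ^ (-((d : ℝ) + ε)) := by ring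
            _ ≤ C * (1 + r) ^ (-((d : ℝ) + ε)) := by
              gcongr
              rw [hC]
              have : 0 ≤ φ₂ * q ^ (-((d : ℝ) + ε)) := by positivity
              linarith
        · rw [htail r h3]
          have h5 := EReal.neg_le_neg_iff.2 (htailb r h4)
          refine le_trans ?_ h5
          rw [← EReal.coe_neg, EReal.coe_le_coe_iff, neg_le_neg_iff]
          have h6 : r ^ (-(d : ℝ) - ε) ≤ q ^ (-((d : ℝ) + ε)) * (1 + r) ^ (-((d : ℝ) + ε)) := by
            rw [← Real.mul_rpow hq0.le (by positivity), show -(d : ℝ) - ε = -((d : ℝ) + ε) by ring]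
            refine Real.rpow_le_rpow_of_nonpos (by positivity) ?_ (by linarith)
            rw [hq, div_mul_eq_mul_div, div_le_iff₀ (by positivity)]
            nlinarith
          calc φ₂ * r ^ (-(d : ℝ) - ε)
              ≤ φ₂ * (q ^ (-((d : ℝ) + ε)) * (1 + r) ^ (-((d : ℝ) + ε))) := by gcongr
            _ = φ₂ * q ^ (-((d : ℝ) + ε)) * (1 + r) ^ (-((d : ℝ) + ε)) := by ring
            _ ≤ C * (1 + r) ^ (-((d : ℝ) + ε)) := by
              gcongr
              rw [hC]
              have : 0 ≤ M * (1 + r₂) ^ ((d : ℝ) + ε) := by positivity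
              linarith
  · intro r hr
    rw [htail r hr, negPart, neg_neg]
    exact min_le_left _ _

lemma exists_core_pos (hφ : AssumptionA d φ) : ∃ R : ℝ, 0 < R ∧ ∀ r, 0 < r → r < R → 0 < φ r := by
  obtain ⟨r₁, r₀, r₂, φ₁, φ₂, s, ε, h1, h10, -, hφ1, -, -, -, hcore, hcoreb, -, -⟩ :=
    hφ.core_tail
  refine ⟨r₁, h1, fun r hr hr1 => ?_⟩
  rw [hcore r hr (hr1.le.trans h10.le)]
  refine lt_of_lt_of_le ?_ (hcoreb r hr hr1)
  have : 0 < φ₁ * r ^ (-s) := by positivity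
  exact_mod_cast this

end LowerBound

/-! ### Decay, integrability and positivity of the Mayer function. -/

section MayerFunction

variable {d : ℕ} {φ : ℝ → EReal} {β : ℝ}

/-- The potential, as a function of |r|, is continuous away from one point, and the Boltzmann factor
is antitone in the energy. -/
lemma measurable_boltz_norm (hφ : AssumptionA d φ) (hβ : 0 < β) :
    Measurable fun x : Pt d => boltz β (φ ‖x‖) := by
  have h1 : Measurable fun r : ℝ => φ |r| := by
    refine measurable_of_continuousOn_compl_singleton 0 ?_
    refine hφ.cont.comp continuous_abs.continuousOn fun r hr => ?_
    exact abs_pos.2 hr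
  have h2 : Measurable fun a : EReal => EReal.exp (-((β : EReal) * a)) := by
    refine Antitone.measurable fun a b hab => ?_
    refine EReal.exp_monotone (EReal.neg_le_neg_iff.2 ?_)
    exact mul_le_mul_of_nonneg_left hab (by exact_mod_cast hβ.le)
  have h3 : Measurable fun x : Pt d => φ ‖x‖ := by
    have := h1.comp (measurable_norm (α := Pt d))
    simpa [Function.comp_def] using this
  exact (h2.comp h3).ennreal_toReal

lemma measurable_bond (hφ : AssumptionA d φ) (hβ : 0 < β) :
    Measurable fun q : Pt d × Pt d => bond φ β q.1 q.2 := by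
  have : (fun q : Pt d × Pt d => bond φ β q.1 q.2) =
      (fun x : Pt d => boltz β (φ ‖x‖)) ∘ fun q : Pt d × Pt d => q.1 - q.2 := by
    ext q; simp [bond, dist_eq_norm]
  rw [this]
  exact (measurable_boltz_norm hφ hβ).comp (measurable_fst.sub measurable_snd)

lemma measurable_nu (hφ : AssumptionA d φ) (hβ : 0 < β) : Measurable (nu d φ β) :=
  ((measurable_boltz_norm hφ hβ).sub measurable_const).abs

lemma nu_nonneg (x : Pt d) : 0 ≤ nu d φ β x := abs_nonneg _

/-- Beyond R' the potential is nonpositive, and e^t - 1 ≤ t e^t with t = βC(1+r)^{-(d+ε)} gives the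
decay. Within R' the Mayer function is merely bounded, by E = e^{βC}, and the weight is bounded
below. -/
lemma exists_nu_le (hφ : AssumptionA d φ) (hβ : 0 < β) :
    ∃ K ε : ℝ, 0 ≤ K ∧ 0 < ε ∧ ∀ x : Pt d, nu d φ β x ≤ K * (1 + ‖x‖) ^ (-((d : ℝ) + ε)) := by
  obtain ⟨a, C, R, R', ε, ha, hC, hR, hR', hε, hlow, hneg⟩ := exists_potential_bound hφ
  have hde : 0 < (d : ℝ) + ε := by positivity
  have hlow' : ∀ r, 0 < r → ((-(C * (1 + r) ^ (-((d : ℝ) + ε))) : ℝ) : EReal) ≤ φ r := by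
    intro r hr
    refine le_trans ?_ (hlow r hr)
    rw [EReal.coe_le_coe_iff]
    have : 0 ≤ (if r < R then a * r ^ (-(d : ℝ)) else 0) := by split_ifs <;> positivity
    linarith
  have hb : ∀ r, 0 ≤ r → boltz β (φ r) ≤ Real.exp (β * (C * (1 + r) ^ (-((d : ℝ) + ε)))) := by
    intro r hr
    rcases hr.eq_or_lt with rfl | hr
    · rw [hφ.zero, boltz_top hβ]; positivity
    · refine (boltz_le hβ (hlow' r hr)).trans (le_of_eq ?_)
      ring_nf
  have hle1 : ∀ r : ℝ, 0 ≤ r → (1 + r) ^ (-((d : ℝ) + ε)) ≤ 1 := fun r hr =>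
    Real.rpow_le_one_of_one_le_of_nonpos (by linarith) (by linarith)
  set E := Real.exp (β * C) with hE
  have hE1 : 1 ≤ E := Real.one_le_exp (by positivity)
  refine ⟨β * C * E + E * (1 + R') ^ ((d : ℝ) + ε), ε, by positivity, hε, fun x => ?_⟩
  set r := ‖x‖ with hr
  have hr0 : 0 ≤ r := norm_nonneg x
  have hp : 0 < (1 + r) ^ (-((d : ℝ) + ε)) := by positivity
  have hbE : boltz β (φ r) ≤ E := (hb r hr0).trans (Real.exp_le_exp.2 (by
    have := mul_le_mul_of_nonneg_left (hle1 r hr0) hC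
    rw [mul_one] at this
    exact mul_le_mul_of_nonneg_left this hβ.le))
  have hb0 := boltz_nonneg β (φ r)
  rw [nu, mayer, ← hr, add_mul]
  rcases le_or_gt r R' with h | h
  · have h1 : |boltz β (φ r) - 1| ≤ E := by
      rw [abs_le]; constructor <;> linarith
    have h2 : 1 ≤ (1 + R') ^ ((d : ℝ) + ε) * (1 + r) ^ (-((d : ℝ) + ε)) := by
      rw [Real.rpow_neg (by positivity), ← div_eq_mul_inv, one_le_div (by positivity)]
      exact Real.rpow_le_rpow (by positivity) (by linarith) hde.le
    have h3 := mul_le_mul_of_nonneg_left h2 (zero_le_one.trans hE1)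
    have h4 : 0 ≤ β * C * E * (1 + r) ^ (-((d : ℝ) + ε)) := by positivity
    rw [mul_one, ← mul_assoc] at h3
    linarith
  · have hge : 1 ≤ boltz β (φ r) := by
      have hr' : 0 < r := hR'.trans h
      have h1 := hneg r h
      have h2 := hφ.ne_bot r hr0
      have h3 : φ r ≠ ⊤ := (h1.trans_lt EReal.zero_lt_top).ne
      rw [← EReal.coe_toReal h3 h2, boltz_coe]
      refine Real.one_le_exp ?_
      have : (φ r).toReal ≤ 0 := by
        rw [← EReal.coe_toReal h3 h2] at h1
        exact_mod_cast h1
      nlinarith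
    rw [abs_of_nonneg (by linarith)]
    set t := β * (C * (1 + r) ^ (-((d : ℝ) + ε))) with ht
    have ht0 : 0 ≤ t := by positivity
    have h1 : Real.exp t - 1 ≤ t * Real.exp t := by
      have := Real.add_one_le_exp (-t)
      have h2 : Real.exp (-t) * Real.exp t = 1 := by rw [← Real.exp_add]; simp
      nlinarith [Real.exp_pos t]
    have h2 : Real.exp t ≤ E := Real.exp_le_exp.2 (by
      have := mul_le_mul_of_nonneg_left (hle1 r hr0) hC
      rw [mul_one] at this
      exact mul_le_mul_of_nonneg_left this hβ.le)
    have h3 : t * Real.exp t ≤ t * E := mul_le_mul_of_nonneg_left h2 ht0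
    have h4 := hb r hr0
    have h5 : 0 ≤ E * (1 + R') ^ ((d : ℝ) + ε) * (1 + r) ^ (-((d : ℝ) + ε)) := by positivity
    have h6 : t * E = β * C * E * (1 + r) ^ (-((d : ℝ) + ε)) := by rw [ht]; ring
    linarith

lemma integrable_nu (hφ : AssumptionA d φ) (hβ : 0 < β) : Integrable (nu d φ β) := by
  obtain ⟨K, ε, hK, hε, h⟩ := exists_nu_le hφ hβ
  have hint : Integrable fun x : Pt d => (1 + ‖x‖) ^ (-((d : ℝ) + ε)) :=
    integrable_one_add_norm (by simpa using hε)
  refine (hint.const_mul K).mono' (measurable_nu hφ hβ).aestronglyMeasurable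
    (Eventually.of_forall fun x => ?_)
  rw [Real.norm_of_nonneg (nu_nonneg x)]
  exact h x

lemma bddAbove_nu (hφ : AssumptionA d φ) (hβ : 0 < β) : BddAbove (Set.range (nu d φ β)) := by
  obtain ⟨K, ε, hK, hε, h⟩ := exists_nu_le hφ hβ
  refine ⟨K, ?_⟩
  rintro _ ⟨x, rfl⟩
  refine (h x).trans (mul_le_of_le_one_right hK ?_)
  have hde : 0 < (d : ℝ) + ε := by positivity
  exact Real.rpow_le_one_of_one_le_of_nonpos (by linarith [norm_nonneg x]) (by linarith)

/-- The potential is strictly positive in the core, so the Mayer function does not vanish on a ball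
around the origin. -/
lemma nu1_pos (hφ : AssumptionA d φ) (hβ : 0 < β) : 0 < nu1 d φ β := by
  rw [nu1, integral_pos_iff_support_of_nonneg nu_nonneg (integrable_nu hφ hβ)]
  obtain ⟨R, hR, hpos⟩ := exists_core_pos hφ
  refine lt_of_lt_of_le (Metric.measure_ball_pos volume (0 : Pt d) hR) (measure_mono ?_)
  intro x hx
  rw [mem_ball_zero_iff] at hx
  rw [Function.mem_support, nu, mayer, abs_ne_zero, sub_ne_zero]
  rcases (norm_nonneg x).eq_or_lt with h | h
  · rw [← h, hφ.zero, boltz_top hβ]; exact zero_ne_one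
  · have h1 := hpos _ h hx
    induction hv : φ ‖x‖ with
    | bot => exact absurd hv (hφ.ne_bot _ (norm_nonneg x))
    | top => rw [boltz_top hβ]; exact zero_ne_one
    | coe a =>
      rw [hv] at h1
      have ha : 0 < a := by exact_mod_cast h1
      rw [boltz_coe]
      have : Real.exp (-(β * a)) < 1 := by
        rw [← Real.exp_zero]; exact Real.exp_lt_exp.2 (by nlinarith)
      exact this.ne

lemma abs_mayer_dist (x y : Pt d) : |mayer φ β (dist x y)| = nu d φ β (x - y) := by
  rw [nu, dist_eq_norm]

lemma nu_le_nu0 (hφ : AssumptionA d φ) (hβ : 0 < β) (x : Pt d) : nu d φ β x ≤ nu0 d φ β :=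
  le_ciSup (bddAbove_nu hφ hβ) x

end MayerFunction

end PTCF

namespace PTCF

/-! ### Stability by counting points in dyadic cells. -/

section Stability

variable {d : ℕ}

/-- The number of ordered pairs of points with the same value of `q`. -/
noncomputable def samePairs {X Z : Type*} [DecidableEq Z] (q : X → Z) (A : Finset X) : ℝ :=
  ∑ x ∈ A, ∑ y ∈ A, if q x = q y then 1 else 0

lemma sum_sum_comp {X Z : Type*} [DecidableEq Z] (q : X → Z) (A : Finset X) (T : Finset Z)
    (hT : ∀ x ∈ A, q x ∈ T) (F : Z → Z → ℝ) :
    ∑ x ∈ A, ∑ y ∈ A, F (q x) (q y) =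
      ∑ s ∈ T, ∑ t ∈ T, ((A.filter fun x => q x = s).card : ℝ) *
        ((A.filter fun x => q x = t).card : ℝ) * F s t := by
  have h1 : ∀ g : Z → ℝ, ∑ x ∈ A, g (q x) =
      ∑ s ∈ T, ((A.filter fun x => q x = s).card : ℝ) * g s := by
    intro g
    rw [← Finset.sum_fiberwise_of_maps_to hT]
    refine Finset.sum_congr rfl fun s _ => ?_
    rw [Finset.sum_congr rfl (g := fun _ => g s)
      (fun x hx => by rw [(Finset.mem_filter.1 hx).2]), Finset.sum_const, nsmul_eq_mul]
  rw [h1 fun s => ∑ y ∈ A, F s (q y)]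
  refine Finset.sum_congr rfl fun s _ => ?_
  rw [h1 fun t => F s t, Finset.mul_sum]
  exact Finset.sum_congr rfl fun t _ => by ring

lemma samePairs_eq {X Z : Type*} [DecidableEq Z] (q : X → Z) (A : Finset X) (T : Finset Z)
    (hT : ∀ x ∈ A, q x ∈ T) :
    samePairs q A = ∑ s ∈ T, ((A.filter fun x => q x = s).card : ℝ) ^ 2 := by
  rw [samePairs, sum_sum_comp q A T hT fun s t => if s = t then 1 else 0]
  refine Finset.sum_congr rfl fun s hs => ?_
  simp only [mul_ite, mul_one, mul_zero, Finset.sum_ite_eq, hs, if_true]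
  ring

lemma card_sq_le_samePairs {X Z : Type*} [DecidableEq Z] (q : X → Z) (A : Finset X) (T : Finset Z)
    (hT : ∀ x ∈ A, q x ∈ T) : (A.card : ℝ) ^ 2 ≤ T.card * samePairs q A := by
  rw [samePairs_eq q A T hT, Finset.card_eq_sum_card_fiberwise hT]
  push_cast
  exact sq_sum_le_card_mul_sum_sq

/-- Cauchy–Schwarz: refining a partition into cells, each cell being cut into at most `n` pieces,
divides the number of equal pairs by at most `n`. -/
lemma samePairs_le_mul {X Z : Type*} [DecidableEq Z] (q q' : X → Z) (A : Finset X) (n : ℕ)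
    (hbox : ∀ p : Z, ∃ T : Finset Z, T.card ≤ n ∧ ∀ x, q x = p → q' x ∈ T) :
    samePairs q A ≤ n * samePairs q' A := by
  rw [samePairs_eq q A (A.image q) fun x hx => Finset.mem_image_of_mem q hx]
  have h1 : ∀ p ∈ A.image q, ((A.filter fun x => q x = p).card : ℝ) ^ 2 ≤
      n * ∑ x ∈ A.filter (fun x => q x = p), ∑ y ∈ A, if q' x = q' y then 1 else 0 := by
    intro p _
    obtain ⟨T, hTn, hT⟩ := hbox p
    refine (card_sq_le_samePairs q' _ T fun x hx => hT x (Finset.mem_filter.1 hx).2).trans ?_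
    have h2 : samePairs q' (A.filter fun x => q x = p) ≤
        ∑ x ∈ A.filter (fun x => q x = p), ∑ y ∈ A, if q' x = q' y then 1 else 0 := by
      refine Finset.sum_le_sum fun x _ => ?_
      exact Finset.sum_le_sum_of_subset_of_nonneg (Finset.filter_subset _ _)
        fun y _ _ => by split_ifs <;> norm_num
    have h0 : 0 ≤ samePairs q' (A.filter fun x => q x = p) :=
      Finset.sum_nonneg fun x _ => Finset.sum_nonneg fun y _ => by split_ifs <;> norm_num
    have hTn' : (T.card : ℝ) ≤ n := by exact_mod_cast hTn
    nlinarith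
  refine (Finset.sum_le_sum h1).trans (le_of_eq ?_)
  rw [← Finset.mul_sum, Finset.sum_fiberwise_of_maps_to fun x hx => Finset.mem_image_of_mem q hx]
  rfl

/-- The cell of scale `2^{-k} L` which contains `x`. -/
noncomputable def cell (L : ℝ) (k : ℕ) (x : Pt d) : Fin d → ℤ := fun i => ⌊2 ^ k * (x i / L)⌋

/-- A cell of scale 0 is cut into (2^k)^d cells of scale k. -/
lemma samePairs_cell_le (L : ℝ) (k : ℕ) (A : Finset (Pt d)) :
    samePairs (cell L 0) A ≤ ((2 ^ k) ^ d : ℕ) * samePairs (cell L k) A := by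
  refine samePairs_le_mul _ _ A _ fun p => ?_
  refine ⟨Fintype.piFinset fun i => Finset.Ico (2 ^ k * p i) (2 ^ k * p i + 2 ^ k), ?_, ?_⟩
  · rw [Fintype.card_piFinset]
    simp only [Int.card_Ico, add_sub_cancel_left, Finset.prod_const, Finset.card_univ,
      Fintype.card_fin]
    refine le_of_eq ?_
    congr 1
  · intro x hx
    rw [Fintype.mem_piFinset]
    intro i
    have hi : ⌊x i / L⌋ = p i := by
      have := congrFun hx i
      simpa [cell] using this
    have h1 := Int.floor_le (x i / L)
    have h2 := Int.lt_floor_add_one (x i / L)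
    rw [hi] at h1 h2
    have hk : (0 : ℝ) < 2 ^ k := by positivity
    rw [Finset.mem_Ico]
    constructor
    · refine Int.le_floor.2 ?_
      push_cast
      exact mul_le_mul_of_nonneg_left h1 hk.le
    · refine Int.floor_lt.2 ?_
      push_cast
      nlinarith

lemma dist_le_of_cell_eq {L : ℝ} (hL : 0 < L) (k : ℕ) {x y : Pt d} (h : cell L k x = cell L k y) :
    dist x y ≤ Real.sqrt d * L / 2 ^ k := by
  have hk : (0 : ℝ) < 2 ^ k := by positivity
  have hi : ∀ i, dist (x i) (y i) ≤ L / 2 ^ k := by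
    intro i
    have h1 : |2 ^ k * (x i / L) - 2 ^ k * (y i / L)| < 1 :=
      Int.abs_sub_lt_one_of_floor_eq_floor (congrFun h i)
    have h2 : 2 ^ k * (x i / L) - 2 ^ k * (y i / L) = (2 ^ k / L) * (x i - y i) := by ring
    rw [h2, abs_mul, abs_of_pos (by positivity)] at h1
    rw [Real.dist_eq, le_div_iff₀ hk]
    rw [div_mul_eq_mul_div, div_lt_one hL] at h1
    linarith
  rw [EuclideanSpace.dist_eq]
  calc Real.sqrt (∑ i, dist (x i) (y i) ^ 2) ≤ Real.sqrt (∑ _i : Fin d, (L / 2 ^ k) ^ 2) := by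
        refine Real.sqrt_le_sqrt (Finset.sum_le_sum fun i _ => ?_)
        exact pow_le_pow_left₀ dist_nonneg (hi i) 2
    _ = Real.sqrt d * L / 2 ^ k := by
        rw [Finset.sum_const, Finset.card_univ, Fintype.card_fin, nsmul_eq_mul,
          Real.sqrt_mul (by positivity), Real.sqrt_sq (by positivity)]
        ring

lemma one_add_abs_cell_sub_le {L : ℝ} (hL : 0 < L) (x y : Pt d) (i : Fin d) :
    1 + |((cell L 0 x i - cell L 0 y i : ℤ) : ℝ)| ≤ (2 + 1 / L) * (1 + dist x y) := by
  have h0 : |x i - y i| ≤ dist x y := by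
    rw [dist_eq_norm]
    have := PiLp.norm_apply_le (x - y) i
    simpa [Real.norm_eq_abs] using this
  have h1 := Int.floor_le (x i / L)
  have h2 := Int.lt_floor_add_one (x i / L)
  have h3 := Int.floor_le (y i / L)
  have h4 := Int.lt_floor_add_one (y i / L)
  have h5 : |x i / L - y i / L| ≤ dist x y / L := by
    rw [← sub_div, abs_div, abs_of_pos hL]
    gcongr
  have h6 := abs_le.1 h5
  have h7 : |((cell L 0 x i - cell L 0 y i : ℤ) : ℝ)| ≤ 1 + dist x y / L := by
    simp only [cell, pow_zero, one_mul]
    push_cast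
    rw [abs_le]
    constructor <;> linarith
  have h8 : 0 ≤ dist x y := dist_nonneg
  have h9 : (2 + 1 / L) * (1 + dist x y) = 2 + 2 * dist x y + 1 / L + dist x y / L := by ring
  have h10 : 0 < 1 / L := by positivity
  linarith

/-- A coordinatewise summable bound for the tail of the interaction of two cells. -/
noncomputable def cellTail (c ε : ℝ) (d : ℕ) (n : ℤ) : ℝ := (c * (1 + |(n : ℝ)|)) ^ (-(1 + ε / d))

lemma summable_cellTail {c ε : ℝ} (hc : 0 < c) (hε : 0 < ε) (hd : 1 ≤ d) :
    Summable (cellTail c ε d) := by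
  have hexp : 1 < 1 + ε / d := by
    have : 0 < (d : ℝ) := by exact_mod_cast hd
    have := div_pos hε this
    linarith
  have h1 : Summable fun n : ℕ => ((n : ℝ) + 1) ^ (-(1 + ε / d)) := by
    have := (summable_nat_add_iff 1).2 (Real.summable_nat_rpow.2 (show -(1 + ε / d) < -1 by linarith))
    simpa using this
  have h2 : ∀ m : ℝ, 0 ≤ m → (c * (1 + m)) ^ (-(1 + ε / d)) =
      c ^ (-(1 + ε / d)) * (m + 1) ^ (-(1 + ε / d)) := fun m hm => by
    rw [Real.mul_rpow hc.le (by positivity), add_comm m 1]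
  refine Summable.of_nat_of_neg ?_ ?_
  · have : (fun n : ℕ => cellTail c ε d (n : ℤ)) =
        fun n : ℕ => c ^ (-(1 + ε / d)) * ((n : ℝ) + 1) ^ (-(1 + ε / d)) := by
      ext n
      rw [cellTail, ← h2 _ (Nat.cast_nonneg n)]
      simp
    rw [this]; exact h1.mul_left _
  · have : (fun n : ℕ => cellTail c ε d (-(n : ℤ))) =
        fun n : ℕ => c ^ (-(1 + ε / d)) * ((n : ℝ) + 1) ^ (-(1 + ε / d)) := by
      ext n
      rw [cellTail, ← h2 _ (Nat.cast_nonneg n)]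
      simp
    rw [this]; exact h1.mul_left _

lemma cellTail_nonneg {c ε : ℝ} (hc : 0 < c) (n : ℤ) : 0 ≤ cellTail c ε d n := by
  unfold cellTail; positivity

lemma cellTail_neg (c ε : ℝ) (n : ℤ) : cellTail c ε d (-n) = cellTail c ε d n := by
  simp [cellTail]

/-- The exponent d + ε is shared equally by the d coordinates. Each receives 1 + ε/d > 1, so that
the sum over cells factors into convergent one-dimensional sums. -/
lemma tail_le_prod_cellTail {L ε : ℝ} (hL : 0 < L) (hε : 0 < ε) (hd : 1 ≤ d) (x y : Pt d) :
    (1 + dist x y) ^ (-((d : ℝ) + ε)) ≤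
      ∏ i, cellTail (1 / (2 + 1 / L)) ε d (cell L 0 x i - cell L 0 y i) := by
  have hd' : 0 < (d : ℝ) := by exact_mod_cast hd
  have h1 : (1 + dist x y) ^ (-((d : ℝ) + ε)) = ∏ _i : Fin d, (1 + dist x y) ^ (-(1 + ε / d)) := by
    rw [Finset.prod_const, Finset.card_univ, Fintype.card_fin, ← Real.rpow_natCast,
      ← Real.rpow_mul (by positivity)]
    congr 1
    field_simp
  rw [h1]
  refine Finset.prod_le_prod (fun i _ => by positivity) fun i _ => ?_
  unfold cellTail
  refine Real.rpow_le_rpow_of_nonpos (by positivity) ?_ ?_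
  · rw [one_div, inv_mul_le_iff₀ (by positivity)]
    exact one_add_abs_cell_sub_le hL x y i
  · have := div_pos hε hd'
    linarith

/-- Schur's test. -/
lemma sum_sum_mul_le_of_row {Z : Type*} (T : Finset Z) (n : Z → ℝ) (w : Z → Z → ℝ) (M : ℝ)
    (hw0 : ∀ s t, 0 ≤ w s t) (hwsymm : ∀ s t, w s t = w t s) (hrow : ∀ s, ∑ t ∈ T, w s t ≤ M) :
    ∑ s ∈ T, ∑ t ∈ T, n s * n t * w s t ≤ M * ∑ s ∈ T, n s ^ 2 := by
  calc ∑ s ∈ T, ∑ t ∈ T, n s * n t * w s t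
      ≤ ∑ s ∈ T, ∑ t ∈ T, (n s ^ 2 * w s t / 2 + n t ^ 2 * w t s / 2) := by
        refine Finset.sum_le_sum fun s _ => Finset.sum_le_sum fun t _ => ?_
        rw [hwsymm t s]
        nlinarith [mul_nonneg (sq_nonneg (n s - n t)) (hw0 s t)]
    _ = ∑ s ∈ T, n s ^ 2 * ∑ t ∈ T, w s t := by
        simp_rw [Finset.sum_add_distrib]
        rw [Finset.sum_comm (f := fun s t => n t ^ 2 * w t s / 2), ← Finset.sum_add_distrib]
        refine Finset.sum_congr rfl fun s _ => ?_
        rw [← Finset.sum_add_distrib, Finset.mul_sum]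
        exact Finset.sum_congr rfl fun t _ => by ring
    _ ≤ ∑ s ∈ T, n s ^ 2 * M :=
        Finset.sum_le_sum fun s _ => mul_le_mul_of_nonneg_left (hrow s) (sq_nonneg _)
    _ = _ := by rw [← Finset.sum_mul, mul_comm]

/-- The finite set of differences is enlarged to a box, where the sum of products is a product of
sums; the bound then does not depend on s or T. -/
lemma sum_prod_cellTail_row_le {c ε : ℝ} (hc : 0 < c) (hε : 0 < ε) (hd : 1 ≤ d)
    (T : Finset (Fin d → ℤ)) (s : Fin d → ℤ) :
    ∑ t ∈ T, ∏ i, cellTail c ε d (s i - t i) ≤ (∑' n, cellTail c ε d n) ^ d := by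
  have himg : ∑ t ∈ T, ∏ i, cellTail c ε d (s i - t i) =
      ∑ u ∈ T.image (fun t i => s i - t i), ∏ i, cellTail c ε d (u i) := by
    rw [Finset.sum_image]
    intro t _ t' _ e
    ext i
    have := congrFun e i
    simp only at this
    omega
  have hbox : T.image (fun t i => s i - t i) ⊆
      Fintype.piFinset fun i => T.image fun t => s i - t i := by
    intro u hu
    obtain ⟨t, ht, rfl⟩ := Finset.mem_image.1 hu
    rw [Fintype.mem_piFinset]
    exact fun i => Finset.mem_image_of_mem (fun t : Fin d → ℤ => s i - t i) ht
  rw [himg]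
  refine (Finset.sum_le_sum_of_subset_of_nonneg hbox
    fun u _ _ => Finset.prod_nonneg fun i _ => cellTail_nonneg hc _).trans ?_
  rw [← Finset.prod_univ_sum]
  calc ∏ i, ∑ n ∈ T.image (fun t => s i - t i), cellTail c ε d n
      ≤ ∏ _i : Fin d, ∑' n, cellTail c ε d n := by
        refine Finset.prod_le_prod (fun i _ => Finset.sum_nonneg fun n _ => cellTail_nonneg hc n)
          fun i _ => ?_
        exact (summable_cellTail hc hε hd).sum_le_tsum _ fun n _ => cellTail_nonneg hc n
    _ = _ := by rw [Finset.prod_const, Finset.card_univ, Fintype.card_fin]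

lemma sum_prod_cellTail_le {c ε : ℝ} (hc : 0 < c) (hε : 0 < ε) (hd : 1 ≤ d)
    (q : Pt d → Fin d → ℤ) (A : Finset (Pt d)) :
    ∑ x ∈ A, ∑ y ∈ A, ∏ i, cellTail c ε d (q x i - q y i) ≤
      (∑' n, cellTail c ε d n) ^ d * samePairs q A := by
  have hT : ∀ x ∈ A, q x ∈ A.image q := fun x hx => Finset.mem_image_of_mem q hx
  rw [sum_sum_comp q A _ hT fun s t => ∏ i, cellTail c ε d (s i - t i), samePairs_eq q A _ hT]
  refine sum_sum_mul_le_of_row (A.image q) (fun s => ((A.filter fun x => q x = s).card : ℝ))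
    (fun s t => ∏ i, cellTail c ε d (s i - t i)) _
    (fun s t => Finset.prod_nonneg fun i _ => cellTail_nonneg hc _) (fun s t => ?_)
    (sum_prod_cellTail_row_le hc hε hd _)
  exact Finset.prod_congr rfl fun i _ => by rw [← cellTail_neg, neg_sub]

/-- Successive terms grow by 2^d ≥ 2, so the sum is at most twice its last term. -/
lemma geom_sum_le (d k : ℕ) (hd : 1 ≤ d) :
    ∑ i ∈ Finset.range (k + 1), (((2 : ℝ) ^ i) ^ d) ≤ 2 * (2 ^ k) ^ d := by
  induction k with
  | zero => simp
  | succ k ih =>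
    rw [Finset.sum_range_succ]
    have h : (2 : ℝ) * (2 ^ k) ^ d ≤ (2 ^ (k + 1)) ^ d := by
      rw [pow_succ, mul_pow, mul_comm]
      gcongr
      exact le_self_pow₀ (by norm_num) (by omega)
    linarith

/-- The core dominates the sum over dyadic scales. -/
lemma sum_scales_le_core {L : ℝ} (hL : 0 < L) (hd : 1 ≤ d) {x y : Pt d} (hxy : x ≠ y) (K : ℕ) :
    ∑ k ∈ Finset.range K, ((2 : ℝ) ^ k) ^ d * (if cell L k x = cell L k y then 1 else 0) ≤
      2 * ((Real.sqrt d * L) ^ d * dist x y ^ (-(d : ℝ))) := by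
  have hr : 0 < dist x y := dist_pos.2 hxy
  induction K with
  | zero => simp; positivity
  | succ k ih =>
    -- If the cells agree at the last scale, 2^k is at most √d L / |x-y|, and the whole geometric
    -- sum is controlled by its last term. Otherwise the last scale contributes nothing.
    by_cases h : cell L k x = cell L k y
    · have h1 : ((2 : ℝ) ^ k) ^ d ≤ (Real.sqrt d * L) ^ d * dist x y ^ (-(d : ℝ)) := by
        rw [Real.rpow_neg hr.le, Real.rpow_natCast, ← div_eq_mul_inv, ← div_pow]
        refine pow_le_pow_left₀ (by positivity) ?_ d
        rw [le_div_iff₀ hr]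
        have := dist_le_of_cell_eq hL k h
        rwa [le_div_iff₀ (by positivity), mul_comm] at this
      calc ∑ i ∈ Finset.range (k + 1), ((2 : ℝ) ^ i) ^ d * (if cell L i x = cell L i y then 1 else 0)
          ≤ ∑ i ∈ Finset.range (k + 1), ((2 : ℝ) ^ i) ^ d := by
            refine Finset.sum_le_sum fun i _ => ?_
            split_ifs
            · simp
            · simp
        _ ≤ 2 * (2 ^ k) ^ d := geom_sum_le d k hd
        _ ≤ _ := by linarith
    · rw [Finset.sum_range_succ, if_neg h, mul_zero, add_zero]
      exact ih

/-- Stability of the potential. -/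
theorem exists_isStable {φ : ℝ → EReal} (hd : 1 ≤ d) (hφ : AssumptionA d φ) :
    ∃ B : ℝ, 0 ≤ B ∧ IsStable d φ B := by
  obtain ⟨a, C, R, R', ε, ha, hC, hR, -, hε, hlow, -⟩ := exists_potential_bound hφ
  have hd' : 0 < (d : ℝ) := by exact_mod_cast hd
  have hsq : 0 < Real.sqrt d := Real.sqrt_pos.2 hd'
  -- A cell then has diameter at most R/2, so two points in a common cell, at any scale, lie in the
  -- core.
  set L : ℝ := R / (2 * Real.sqrt d) with hLdef
  have hL : 0 < L := by positivity
  have hLR : Real.sqrt d * L < R := by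
    rw [hLdef]; field_simp; linarith
  set c : ℝ := 1 / (2 + 1 / L)
  have hc : 0 < c := by positivity
  set S : ℝ := C * (∑' n, cellTail c ε d n) ^ d with hS
  -- Normalized so that a' times the sum over dyadic scales stays below a r^{-d}.
  set a' : ℝ := a / (2 * (Real.sqrt d * L) ^ d) with ha'
  have ha'0 : 0 < a' := by positivity
  -- Each of the K + 1 scales contributes at least the number of equal pairs at scale 0, so a' (K +
  -- 1) ≥ S lets the core absorb the tail.
  obtain ⟨K, hK⟩ := exists_nat_ge (S / a')
  rw [div_le_iff₀ ha'0] at hK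
  set D : ℝ := ∑ k ∈ Finset.range (K + 1), ((2 : ℝ) ^ k) ^ d with hD
  have hD0 : 0 ≤ D := Finset.sum_nonneg fun k _ => by positivity
  set core : Pt d → Pt d → ℝ := fun x y => a' * ∑ k ∈ Finset.range (K + 1),
    ((2 : ℝ) ^ k) ^ d * (if cell L k x = cell L k y then 1 else 0) with hcore
  set tail : Pt d → Pt d → ℝ := fun x y =>
    C * ∏ i, cellTail c ε d (cell L 0 x i - cell L 0 y i) with htail
  have hg : ∀ x y, x ≠ y → ((core x y - tail x y : ℝ) : EReal) ≤ φ (dist x y) := by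
    intro x y hxy
    have hr : 0 < dist x y := dist_pos.2 hxy
    refine le_trans ?_ (hlow _ hr)
    rw [EReal.coe_le_coe_iff]
    refine sub_le_sub ?_ (mul_le_mul_of_nonneg_left (tail_le_prod_cellTail hL hε hd x y) hC)
    by_cases h : dist x y < R
    · rw [if_pos h, hcore]
      have := mul_le_mul_of_nonneg_left (sum_scales_le_core hL hd hxy (K + 1)) ha'0.le
      refine this.trans (le_of_eq ?_)
      rw [ha']
      field_simp
    · rw [if_neg h, hcore]
      refine le_of_eq ?_
      refine mul_eq_zero_of_right _ (Finset.sum_eq_zero fun k _ => ?_)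
      rw [if_neg, mul_zero]
      intro he
      have h1 := dist_le_of_cell_eq hL k he
      have h2 : Real.sqrt d * L / 2 ^ k ≤ Real.sqrt d * L :=
        div_le_self (by positivity) (one_le_pow₀ (by norm_num))
      linarith
  have hsymm : ∀ x y, core x y - tail x y = core y x - tail y x := by
    intro x y
    simp only [hcore, htail]
    congr 2
    · refine Finset.sum_congr rfl fun k _ => ?_
      simp only [eq_comm]
    · refine Finset.prod_congr rfl fun i _ => ?_
      rw [← cellTail_neg, neg_sub]
  -- The double sums contain the diagonal, where the core function equals a' D. Dropping it costs a'
  -- D per point, and the energy counts every pair once, hence the half.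
  refine ⟨a' * D / 2, by positivity, fun A => ?_⟩
  refine le_trans ?_ (le_energyU _ hsymm A fun x _ y _ hxy => hg x y hxy)
  rw [EReal.coe_le_coe_iff]
  have htail0 : ∀ x y, 0 ≤ tail x y := fun x y =>
    mul_nonneg hC (Finset.prod_nonneg fun i _ => cellTail_nonneg hc _)
  have hsplit : ∀ x ∈ A, ∑ y ∈ A, core x y - a' * D - ∑ y ∈ A, tail x y ≤
      ∑ y ∈ A.erase x, (core x y - tail x y) := by
    intro x hx
    rw [Finset.sum_sub_distrib, ← Finset.add_sum_erase A (core x) hx,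
      ← Finset.add_sum_erase A (tail x) hx]
    have h1 : core x x = a' * D := by simp [hcore, hD]
    have h2 := htail0 x x
    linarith
  have hsum := Finset.sum_le_sum hsplit
  rw [Finset.sum_sub_distrib, Finset.sum_sub_distrib, Finset.sum_const, nsmul_eq_mul] at hsum
  have htailsum : ∑ x ∈ A, ∑ y ∈ A, tail x y ≤ S * samePairs (cell L 0) A := by
    simp only [htail, ← Finset.mul_sum, hS, mul_assoc]
    exact mul_le_mul_of_nonneg_left (sum_prod_cellTail_le hc hε hd _ A) hC
  have hcoresum : a' * ((K + 1) * samePairs (cell L 0) A) ≤ ∑ x ∈ A, ∑ y ∈ A, core x y := by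
    simp only [hcore, ← Finset.mul_sum]
    refine mul_le_mul_of_nonneg_left ?_ ha'0.le
    have h1 : ∑ x ∈ A, ∑ y ∈ A, ∑ k ∈ Finset.range (K + 1),
        ((2 : ℝ) ^ k) ^ d * (if cell L k x = cell L k y then 1 else 0) =
        ∑ k ∈ Finset.range (K + 1), ((2 : ℝ) ^ k) ^ d * samePairs (cell L k) A := by
      simp_rw [samePairs, Finset.mul_sum]
      rw [Finset.sum_comm (s := Finset.range (K + 1))]
      exact Finset.sum_congr rfl fun x _ => Finset.sum_comm
    rw [h1]
    calc ((K : ℝ) + 1) * samePairs (cell L 0) A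
        = ∑ k ∈ Finset.range (K + 1), samePairs (cell L 0) A := by
          rw [Finset.sum_const, Finset.card_range, nsmul_eq_mul]; push_cast; ring
      _ ≤ _ := Finset.sum_le_sum fun k _ => by
          have := samePairs_cell_le L k A
          push_cast at this
          exact this
  have hP0 : 0 ≤ samePairs (cell L 0) A :=
    Finset.sum_nonneg fun x _ => Finset.sum_nonneg fun y _ => by split_ifs <;> norm_num
  have hfin : S * samePairs (cell L 0) A ≤ a' * ((K + 1) * samePairs (cell L 0) A) := by
    have : S ≤ a' * (K + 1) := by nlinarith
    calc S * samePairs (cell L 0) A ≤ a' * (K + 1) * samePairs (cell L 0) A := by gcongr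
      _ = _ := by ring
  linarith

end Stability

end PTCF

namespace PTCF

/-! ### Generic configurations, joint measurability and splitting of variables. -/

section Generic

variable {d : ℕ} {κ : Type*}

/-- The points `x i` are distinct and avoid `X`. -/
def IsGeneric (X : Finset (Pt d)) (x : κ → Pt d) : Prop := Function.Injective x ∧ ∀ i, x i ∉ X

lemma nontrivial_pt (hd : 1 ≤ d) : Nontrivial (Pt d) := by
  refine ⟨⟨0, EuclideanSpace.single (⟨0, hd⟩ : Fin d) (1 : ℝ), fun h => ?_⟩⟩
  have := congrArg (fun v : Pt d => v ⟨0, hd⟩) h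
  simp at this

/-- Each diagonal x i = x k is a proper subspace because d ≥ 1, and a finite set of positions is
null. Almost everywhere, sequences can therefore be treated as sets. -/
lemma ae_isGeneric [Fintype κ] (hd : 1 ≤ d) (X : Finset (Pt d)) :
    ∀ᵐ x : κ → Pt d, IsGeneric X x := by
  have := nontrivial_pt hd
  have h1 : ∀ i : κ, ∀ᵐ x : κ → Pt d, x i ∉ X := by
    intro i
    have h : ∀ᵐ y : Pt d, y ∉ X := by
      rw [ae_iff]
      simp only [not_not]
      exact X.measure_zero volume
    exact (Measure.quasiMeasurePreserving_eval (fun _ : κ => (volume : Measure (Pt d))) i).ae h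
  have h2 : ∀ i k : κ, i ≠ k → ∀ᵐ x : κ → Pt d, x i ≠ x k := by
    intro i k hik
    let p : Submodule ℝ (κ → Pt d) :=
      LinearMap.ker ((LinearMap.proj i : (κ → Pt d) →ₗ[ℝ] Pt d) - LinearMap.proj k)
    have hp : p ≠ ⊤ := by
      obtain ⟨v, hv⟩ := exists_ne (0 : Pt d)
      intro htop
      have : Pi.single i v ∈ p := htop ▸ Submodule.mem_top
      simp only [p, LinearMap.mem_ker, LinearMap.sub_apply, LinearMap.proj_apply,
        Pi.single_eq_same, Pi.single_eq_of_ne hik.symm, sub_zero] at this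
      exact hv this
    have h0 := Measure.addHaar_submodule (volume : Measure (κ → Pt d)) p hp
    rw [ae_iff]
    refine measure_mono_null (fun x hx => ?_) h0
    simp only [ne_eq, not_not, Set.mem_ofPred_eq] at hx
    simp [p, hx]
  have h3 : ∀ᵐ x : κ → Pt d, ∀ i k : κ, i ≠ k → x i ≠ x k := by
    rw [eventually_countable_forall]; intro i
    rw [eventually_countable_forall]; intro k
    by_cases hik : i = k
    · exact Eventually.of_forall fun x h => absurd hik h
    · exact (h2 i k hik).mono fun x hx _ => hx
  filter_upwards [eventually_countable_forall.2 h1, h3] with x hx hx'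
  exact ⟨fun i k h => by_contra fun hne => hx' i k hne h, hx⟩

lemma IsGeneric.disjoint_image {X : Finset (Pt d)} {x : κ → Pt d} (h : IsGeneric X x)
    (s : Finset κ) : Disjoint (s.image x) X := by
  rw [Finset.disjoint_left]
  intro y hy
  obtain ⟨i, -, rfl⟩ := Finset.mem_image.1 hy
  exact h.2 i

lemma sum_powerset_image {M : Type*} [AddCommMonoid M] {κ V : Type*} [DecidableEq V] (x : κ → V)
    (hx : Function.Injective x) (t : Finset κ) (g : Finset V → M) :
    ∑ ξ ∈ (t.image x).powerset, g ξ = ∑ α ∈ t.powerset, g (α.image x) := by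
  have : (t.image x).powerset = t.powerset.image fun α => α.image x := by
    ext ξ
    simp only [Finset.mem_powerset, Finset.mem_image, Finset.subset_image_iff]
  rw [this, Finset.sum_image]
  intro a _ b _ h
  exact Finset.image_injective hx h

lemma image_sdiff_image {κ : Type*} [DecidableEq κ] {x : κ → Pt d}
    (hx : Function.Injective x) (s t : Finset κ) :
    s.image x \ t.image x = (s \ t).image x := by
  rw [Finset.image_sdiff _ _ hx]

/-- Joint measurability of a function of two finite configurations. -/
def JointMeas {E : Type*} [MeasurableSpace E] (g : Finset (Pt d) → Finset (Pt d) → E) : Prop :=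
  ∀ (κ : Type) [Fintype κ] (s t : Finset κ), Disjoint s t →
    AEMeasurable (fun x : κ → Pt d => g (s.image x) (t.image x)) volume

lemma JointMeas.comp {E E' : Type*} [MeasurableSpace E] [MeasurableSpace E'] {φ : E → E'}
    {g : Finset (Pt d) → Finset (Pt d) → E} (hφ : Measurable φ) (hg : JointMeas g) :
    JointMeas fun ξ γ => φ (g ξ γ) := fun κ _ s t hst => hφ.comp_aemeasurable (hg κ s t hst)

lemma JointMeas.mul {g g' : Finset (Pt d) → Finset (Pt d) → ℝ} (hg : JointMeas g)
    (hg' : JointMeas g') : JointMeas fun ξ γ => g ξ γ * g' ξ γ :=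
  fun κ _ s t hst => (hg κ s t hst).mul (hg' κ s t hst)

lemma aemeasurable_prod_image [Fintype κ] (hd : 1 ≤ d) (h : Pt d → ℝ) (hh : Measurable h) (s : Finset κ) :
    AEMeasurable (fun x : κ → Pt d => ∏ y ∈ s.image x, h y) volume := by
  have h1 : Measurable fun x : κ → Pt d => ∏ i ∈ s, h (x i) :=
    Finset.measurable_prod _ fun i _ => hh.comp (measurable_pi_apply i)
  refine h1.aemeasurable.congr ?_
  filter_upwards [ae_isGeneric hd ∅] with x hx
  rw [Finset.prod_image fun a _ b _ e => hx.1 e]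

lemma JointMeas.of_prod (hd : 1 ≤ d) {h : Pt d → ℝ} (hh : Measurable h) :
    JointMeas fun ξ _ => ∏ y ∈ ξ, h y := fun _ _ s _ _ => aemeasurable_prod_image hd h hh s

lemma lintegral_image_congr {κ κ' : Type} [Fintype κ] [Fintype κ'] (e : κ ≃ κ')
    (g : Finset (Pt d) → ENNReal) :
    ∫⁻ x : κ → Pt d, g (Finset.univ.image x) = ∫⁻ x : κ' → Pt d, g (Finset.univ.image x) := by
  have hmp := volume_measurePreserving_piCongrLeft (fun _ : κ' => Pt d) e
  rw [← hmp.lintegral_comp_emb (MeasurableEquiv.measurableEmbedding _)]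
  refine lintegral_congr fun x => ?_
  congr 1
  ext y
  simp only [Finset.mem_image, Finset.mem_univ, true_and]
  constructor
  · rintro ⟨i, rfl⟩
    exact ⟨e i, by rw [MeasurableEquiv.coe_piCongrLeft, Equiv.piCongrLeft_apply_apply]⟩
  · rintro ⟨i, rfl⟩
    refine ⟨e.symm i, ?_⟩
    rw [MeasurableEquiv.coe_piCongrLeft]
    conv_rhs => rw [← e.apply_symm_apply i]
    rw [Equiv.piCongrLeft_apply_apply]

/-- Integration over a configuration splits into integrations over two complementary groups of
points. -/
lemma lintegral_split {κ : Type} [Fintype κ]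
    (g : Finset (Pt d) → Finset (Pt d) → ENNReal) {s t : Finset κ}
    (hst : ∀ i, i ∈ t ↔ i ∉ s)
    (hg : AEMeasurable (fun x : κ → Pt d => g (s.image x) (t.image x)) volume) :
    ∫⁻ x : κ → Pt d, g (s.image x) (t.image x) =
      ∫⁻ u : Fin s.card → Pt d, ∫⁻ v : Fin t.card → Pt d,
        g (Finset.univ.image u) (Finset.univ.image v) := by
  let _ : Fintype {i // i ∈ s} := Subtype.fintype _
  have hmp := volume_preserving_piEquivPiSubtypeProd (fun _ : κ => Pt d) (fun i => i ∈ s)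
  set e := MeasurableEquiv.piEquivPiSubtypeProd (fun _ : κ => Pt d) (fun i => i ∈ s)
  let G : ({i // i ∈ s} → Pt d) × ({i // ¬ i ∈ s} → Pt d) → ENNReal :=
    fun p => g (Finset.univ.image p.1) (Finset.univ.image p.2)
  have he : (fun x : κ → Pt d => g (s.image x) (t.image x)) = G ∘ e := by
    funext x
    simp only [G, e, MeasurableEquiv.piEquivPiSubtypeProd, MeasurableEquiv.coe_mk,
      Equiv.piEquivPiSubtypeProd_apply, Function.comp]
    congr 1
    · ext y; simp
    · ext y; simp [hst]
  rw [he] at hg ⊢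
  have hG := (hmp.aemeasurable_comp_iff (MeasurableEquiv.measurableEmbedding _)).1 hg
  rw [Measure.volume_eq_prod] at hG
  calc ∫⁻ x, (G ∘ e) x = ∫⁻ p, G p :=
        hmp.lintegral_comp_emb (MeasurableEquiv.measurableEmbedding _) G
    _ = ∫⁻ u : {i // i ∈ s} → Pt d, ∫⁻ v : {i // ¬ i ∈ s} → Pt d,
          g (Finset.univ.image u) (Finset.univ.image v) := by
        rw [Measure.volume_eq_prod, lintegral_prod _ hG]
    _ = ∫⁻ u : Fin s.card → Pt d, ∫⁻ v : {i // ¬ i ∈ s} → Pt d,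
          g (Finset.univ.image u) (Finset.univ.image v) :=
        lintegral_image_congr (Fintype.equivFinOfCardEq (Fintype.card_of_subtype s fun _ => Iff.rfl))
          (fun ξ => ∫⁻ v : {i // ¬ i ∈ s} → Pt d, g ξ (Finset.univ.image v))
    _ = _ := lintegral_congr fun u =>
        lintegral_image_congr (Fintype.equivFinOfCardEq (Fintype.card_of_subtype t hst)) (g (Finset.univ.image u))

end Generic

end PTCF

namespace PTCF

/-! ### The Lebesgue–Poisson measure on finite sequences. -/

section LebesguePoisson

variable {d : ℕ}

/-- Finite sequences of points. -/
abbrev Seqs (d : ℕ) := (n : ℕ) × (Fin n → Pt d)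

/-- The configuration of a finite sequence. -/
noncomputable def conf (τ : Seqs d) : Finset (Pt d) := Finset.univ.image τ.2

/-- A sequence of `n` points as a finite sequence. -/
def seqMk (n : ℕ) (x : Fin n → Pt d) : Seqs d := ⟨n, x⟩

/-- The Lebesgue–Poisson measure `λ_σ` on finite sequences. -/
noncomputable def lpMeasure (d : ℕ) : Measure (Seqs d) :=
  Measure.sum fun n => ENNReal.ofReal (1 / (n.factorial : ℝ)) • (volume.map (seqMk n))

lemma seqMk_injective (n : ℕ) : Function.Injective (seqMk n : (Fin n → Pt d) → Seqs d) :=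
  fun _ _ h => eq_of_heq (Sigma.mk.inj h).2

lemma measurable_seqMk (n : ℕ) : Measurable (seqMk n : (Fin n → Pt d) → Seqs d) := by
  rw [measurable_iff_le_map]
  exact iInf_le _ n

lemma measurableEmbedding_seqMk (n : ℕ) :
    MeasurableEmbedding (seqMk n : (Fin n → Pt d) → Seqs d) := by
  refine ⟨seqMk_injective n, measurable_seqMk n, fun {s} hs => ?_⟩
  change MeasurableSet[⨅ a, _] _
  rw [MeasurableSpace.measurableSet_iInf]
  intro k
  change MeasurableSet (seqMk k ⁻¹' (seqMk n '' s))
  by_cases h : k = n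
  · subst h
    rwa [Set.preimage_image_eq _ (seqMk_injective k)]
  · convert MeasurableSet.empty
    ext x
    simp only [Set.mem_preimage, Set.mem_image, Set.mem_empty_iff_false, iff_false]
    rintro ⟨y, -, e⟩
    exact h (congrArg Sigma.fst e).symm

instance : SFinite (lpMeasure d) := by unfold lpMeasure; infer_instance

lemma invFactorial_ne_zero (n : ℕ) : ENNReal.ofReal (1 / (n.factorial : ℝ)) ≠ 0 := by
  rw [Ne, ENNReal.ofReal_eq_zero, not_le]; positivity

lemma aestronglyMeasurable_lp {f : Seqs d → ℝ} :
    AEStronglyMeasurable f (lpMeasure d) ↔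
      ∀ n, AEStronglyMeasurable (fun x : Fin n → Pt d => f ⟨n, x⟩) volume := by
  simp only [aestronglyMeasurable_iff_aemeasurable, lpMeasure, aemeasurable_sum_measure_iff]
  refine forall_congr' fun n => ?_
  rw [aemeasurable_smul_measure_iff (invFactorial_ne_zero n),
    (measurableEmbedding_seqMk n).aemeasurable_map_iff]
  rfl

lemma lintegral_lp (f : Seqs d → ENNReal) :
    ∫⁻ τ, f τ ∂(lpMeasure d) =
      ∑' n, ENNReal.ofReal (1 / (n.factorial : ℝ)) * ∫⁻ x : Fin n → Pt d, f ⟨n, x⟩ := by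
  rw [lpMeasure, lintegral_sum_measure]
  refine tsum_congr fun n => ?_
  rw [lintegral_smul_measure, (measurableEmbedding_seqMk n).lintegral_map, smul_eq_mul]
  rfl

lemma ae_lp {p : Seqs d → Prop} :
    (∀ᵐ τ ∂(lpMeasure d), p τ) ↔ ∀ n, ∀ᵐ x : Fin n → Pt d, p ⟨n, x⟩ := by
  rw [lpMeasure, Measure.ae_sum_iff]
  refine forall_congr' fun n => ?_
  rw [Measure.ae_ennreal_smul_measure_iff (invFactorial_ne_zero n), (measurableEmbedding_seqMk n).ae_map_iff]
  rfl

lemma integral_smul_map (f : Seqs d → ℝ) (n : ℕ) :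
    ∫ τ, f τ ∂(ENNReal.ofReal (1 / (n.factorial : ℝ)) • (volume.map (seqMk n))) =
      1 / (n.factorial : ℝ) * ∫ x : Fin n → Pt d, f ⟨n, x⟩ := by
  rw [integral_smul_measure, (measurableEmbedding_seqMk n).integral_map,
    ENNReal.toReal_ofReal (by positivity), smul_eq_mul]
  rfl

/-- Representing the sum over n as one measure on finite sequences makes Fubini's theorem and
dominated convergence available for `lpIntegral`. -/
lemma integrable_lp_iff {F : Finset (Pt d) → ℝ} :
    Integrable (fun τ => F (conf τ)) (lpMeasure d) ↔ LPIntegrable F := by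
  rw [lpMeasure, integrable_sum_measure_iff, LPIntegrable]
  refine and_congr (forall_congr' fun n => ?_) ?_
  · rw [integrable_smul_measure (invFactorial_ne_zero n) ENNReal.ofReal_ne_top,
      (measurableEmbedding_seqMk n).integrable_map_iff]
    rfl
  · simp only [integral_smul_map]
    rfl

lemma integral_lp {F : Finset (Pt d) → ℝ} (hF : LPIntegrable F) :
    lpIntegral 1 F = ∫ τ, F (conf τ) ∂(lpMeasure d) := by
  have h := integrable_lp_iff.2 hF
  rw [lpMeasure] at h ⊢
  rw [integral_sum_measure h, lpIntegral]
  refine tsum_congr fun n => ?_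
  rw [integral_smul_map, one_pow]
  rfl

lemma ae_conf_disjoint (hd : 1 ≤ d) (X : Finset (Pt d)) :
    ∀ᵐ τ ∂(lpMeasure d), Disjoint (conf τ) X := by
  rw [ae_lp]
  intro n
  filter_upwards [ae_isGeneric hd X] with x hx
  exact hx.disjoint_image _

/-- The points of a sequence are almost surely distinct, so z^n is the power z^{|γ|} and may be
moved into the integrand. -/
lemma lpIntegral_eq_one (hd : 1 ≤ d) (z : ℝ) (F : Finset (Pt d) → ℝ) :
    lpIntegral z F = lpIntegral 1 fun γ => z ^ γ.card * F γ := by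
  refine tsum_congr fun n => ?_
  rw [one_pow, div_mul_eq_mul_div, ← integral_const_mul, one_div_mul_eq_div]
  congr 1
  refine integral_congr_ae ?_
  filter_upwards [ae_isGeneric hd ∅] with x hx
  rw [Finset.card_image_of_injective _ hx.1, Finset.card_univ, Fintype.card_fin]

lemma lpIntegral_congr_ae {F G : Finset (Pt d) → ℝ}
    (h : ∀ᵐ τ ∂(lpMeasure d), F (conf τ) = G (conf τ)) : lpIntegral 1 F = lpIntegral 1 G := by
  rw [ae_lp] at h
  refine tsum_congr fun n => ?_
  congr 1
  exact integral_congr_ae (h n)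

/-- With the index set `Fin k ⊕ Fin l` and its two halves, a function of two configurations becomes
a function on a product space. -/
lemma JointMeas.aemeasurable_seq {E : Type*} [MeasurableSpace E]
    {g : Finset (Pt d) → Finset (Pt d) → E} (hg : JointMeas g) (k l : ℕ) :
    AEMeasurable (fun p : (Fin k → Pt d) × (Fin l → Pt d) =>
      g (Finset.univ.image p.1) (Finset.univ.image p.2)) volume := by
  have hmp := volume_measurePreserving_sumPiEquivProdPi (fun _ : Fin k ⊕ Fin l => Pt d)
  rw [← hmp.aemeasurable_comp_iff (MeasurableEquiv.measurableEmbedding _)]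
  have h := hg (Fin k ⊕ Fin l) (Finset.univ.image Sum.inl) (Finset.univ.image Sum.inr) (by
    rw [Finset.disjoint_left]
    intro a ha hb
    obtain ⟨i, -, rfl⟩ := Finset.mem_image.1 ha
    obtain ⟨j, -, e⟩ := Finset.mem_image.1 hb
    cases e)
  refine h.congr (Eventually.of_forall fun x => ?_)
  simp only [Finset.image_image]
  rfl

/-- Integration over pairs (subset, complement) is integration over pairs of configurations. -/
lemma lintegral_lp_sum_powerset (hd : 1 ≤ d) (g : Finset (Pt d) → Finset (Pt d) → ENNReal)
    (hg : JointMeas g) :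
    ∫⁻ τ, ∑ ξ ∈ (conf τ).powerset, g ξ (conf τ \ ξ) ∂(lpMeasure d) =
      ∫⁻ τ, ∫⁻ τ', g (conf τ) (conf τ') ∂(lpMeasure d) ∂(lpMeasure d) := by
  set I : ℕ → ℕ → ENNReal := fun k l => ∫⁻ u : Fin k → Pt d, ∫⁻ v : Fin l → Pt d,
    g (Finset.univ.image u) (Finset.univ.image v) with hI
  set w : ℕ → ENNReal := fun n => ENNReal.ofReal (1 / (n.factorial : ℝ)) with hw
  -- The integral for a subset of the n indices depends only on its size k, and there are n choose k
  -- such subsets.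
  have h1 : ∀ n, ∫⁻ x : Fin n → Pt d, ∑ ξ ∈ (conf ⟨n, x⟩).powerset, g ξ (conf ⟨n, x⟩ \ ξ) =
      ∑ k ∈ Finset.range (n + 1), (n.choose k : ENNReal) * I k (n - k) := by
    intro n
    have h2 : ∫⁻ x : Fin n → Pt d, ∑ ξ ∈ (conf ⟨n, x⟩).powerset, g ξ (conf ⟨n, x⟩ \ ξ) =
        ∫⁻ x : Fin n → Pt d, ∑ α ∈ (Finset.univ : Finset (Fin n)).powerset,
          g (α.image x) (αᶜ.image x) := by
      refine lintegral_congr_ae ?_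
      filter_upwards [ae_isGeneric hd ∅] with x hx
      simp only [conf]
      rw [sum_powerset_image x hx.1]
      refine Finset.sum_congr rfl fun α _ => ?_
      rw [image_sdiff_image hx.1, ← Finset.compl_eq_univ_sdiff]
    have hm : ∀ α : Finset (Fin n), AEMeasurable
        (fun x : Fin n → Pt d => g (α.image x) (αᶜ.image x)) volume := fun α =>
      hg (Fin n) α αᶜ disjoint_compl_right
    rw [h2, lintegral_finsetSum' _ fun α _ => hm α]
    have h3 : ∀ α ∈ (Finset.univ : Finset (Fin n)).powerset,
        ∫⁻ x : Fin n → Pt d, g (α.image x) (αᶜ.image x) = I α.card (n - α.card) := by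
      intro α _
      have h4 := lintegral_split g (fun _ => Finset.mem_compl) (hm α)
      have hc : Finset.card αᶜ = n - α.card := by rw [Finset.card_compl, Fintype.card_fin]
      rw [h4, hc]
    rw [Finset.sum_congr rfl h3, Finset.sum_powerset_apply_card (fun k => I k (n - k)),
      Finset.card_univ, Fintype.card_fin]
    refine Finset.sum_congr rfl fun k _ => ?_
    rw [nsmul_eq_mul]
  have hR : ∫⁻ τ, ∫⁻ τ', g (conf τ) (conf τ') ∂(lpMeasure d) ∂(lpMeasure d) =
      ∑' k, ∑' l, w k * (w l * I k l) := by
    rw [lintegral_lp]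
    refine tsum_congr fun k => ?_
    rw [ENNReal.tsum_mul_left]
    congr 1
    simp_rw [lintegral_lp]
    rw [lintegral_tsum]
    · refine tsum_congr fun l => ?_
      rw [lintegral_const_mul' _ _ ENNReal.ofReal_ne_top]
      rfl
    · intro l
      have := hg.aemeasurable_seq k l
      rw [Measure.volume_eq_prod] at this
      exact this.lintegral_prod_right'.const_mul _
  -- The double series is summed along k + l = n, where (n choose k)/n! = 1/(k! (n-k)!) matches the
  -- coefficients.
  rw [lintegral_lp, hR, ← ENNReal.tsum_prod,
    ← (Finset.HasAntidiagonal.sigmaAntidiagonalEquivProd (A := ℕ)).tsum_eq, ENNReal.tsum_sigma']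
  refine tsum_congr fun n => ?_
  rw [h1, tsum_fintype, Finset.mul_sum]
  rw [Finset.univ_eq_attach]
  simp only [Finset.HasAntidiagonal.sigmaAntidiagonalEquivProd_apply]
  rw [Finset.sum_attach (Finset.HasAntidiagonal.antidiagonal n) (fun p => w p.1 * (w p.2 * I p.1 p.2)),
    Finset.Nat.sum_antidiagonal_eq_sum_range_succ (fun k l => w k * (w l * I k l))]
  refine Finset.sum_congr rfl fun k hk => ?_
  have hk' : k ≤ n := by simpa [Nat.lt_succ_iff] using hk
  rw [← mul_assoc, ← mul_assoc]
  congr 1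
  rw [hw]
  simp only
  rw [← ENNReal.ofReal_natCast, ← ENNReal.ofReal_mul (by positivity),
    ← ENNReal.ofReal_mul (by positivity)]
  congr 1
  rw [Nat.cast_choose ℝ hk']
  have := Nat.factorial_pos n
  field_simp

lemma aestronglyMeasurable_lp_prod {g : Finset (Pt d) → Finset (Pt d) → ℝ} (hg : JointMeas g) :
    AEStronglyMeasurable (fun p : Seqs d × Seqs d => g (conf p.1) (conf p.2))
      ((lpMeasure d).prod (lpMeasure d)) := by
  rw [aestronglyMeasurable_iff_aemeasurable, lpMeasure, Measure.prod_sum,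
    aemeasurable_sum_measure_iff]
  rintro ⟨k, l⟩
  simp only
  rw [Measure.prod_smul_left, Measure.prod_smul_right,
    aemeasurable_smul_measure_iff (invFactorial_ne_zero k),
    aemeasurable_smul_measure_iff (invFactorial_ne_zero l),
    Measure.map_prod_map _ _ (measurable_seqMk k) (measurable_seqMk l),
    ((measurableEmbedding_seqMk k).prodMap (measurableEmbedding_seqMk l)).aemeasurable_map_iff,
    ← Measure.volume_eq_prod]
  exact hg.aemeasurable_seq k l

lemma JointMeas.aestronglyMeasurable_powerset (hd : 1 ≤ d)
    {g : Finset (Pt d) → Finset (Pt d) → ℝ} (hg : JointMeas g) :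
    AEStronglyMeasurable (fun τ => ∑ ξ ∈ (conf τ).powerset, g ξ (conf τ \ ξ)) (lpMeasure d) := by
  rw [aestronglyMeasurable_lp]
  intro n
  rw [aestronglyMeasurable_iff_aemeasurable]
  have : AEMeasurable (fun x : Fin n → Pt d => ∑ α ∈ (Finset.univ : Finset (Fin n)).powerset,
      g (α.image x) (αᶜ.image x)) volume :=
    Finset.aemeasurable_fun_sum _ fun α _ => hg (Fin n) α αᶜ disjoint_compl_right
  refine this.congr ?_
  filter_upwards [ae_isGeneric hd ∅] with x hx
  simp only [conf]
  rw [sum_powerset_image x hx.1]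
  refine Finset.sum_congr rfl fun α _ => ?_
  rw [image_sdiff_image hx.1, ← Finset.compl_eq_univ_sdiff]

lemma integrable_lp_prod {g : Finset (Pt d) → Finset (Pt d) → ℝ} (hg : JointMeas g)
    (hfin : ∫⁻ τ, ∫⁻ τ', ENNReal.ofReal |g (conf τ) (conf τ')| ∂(lpMeasure d) ∂(lpMeasure d) < ⊤) :
    Integrable (fun p : Seqs d × Seqs d => g (conf p.1) (conf p.2))
      ((lpMeasure d).prod (lpMeasure d)) := by
  refine ⟨aestronglyMeasurable_lp_prod hg, ?_⟩
  rw [hasFiniteIntegral_iff_norm]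
  simp only [Real.norm_eq_abs]
  rw [lintegral_prod]
  · exact hfin
  · exact (aestronglyMeasurable_lp_prod
      (hg.comp measurable_abs)).aemeasurable.ennreal_ofReal

lemma integrable_lp_powerset (hd : 1 ≤ d) {g : Finset (Pt d) → Finset (Pt d) → ℝ}
    (hg : JointMeas g)
    (hfin : ∫⁻ τ, ∫⁻ τ', ENNReal.ofReal |g (conf τ) (conf τ')| ∂(lpMeasure d) ∂(lpMeasure d) < ⊤) :
    Integrable (fun τ => ∑ ξ ∈ (conf τ).powerset, g ξ (conf τ \ ξ)) (lpMeasure d) := by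
  refine ⟨hg.aestronglyMeasurable_powerset hd, ?_⟩
  rw [hasFiniteIntegral_iff_norm]
  have hm : JointMeas fun ξ γ => ENNReal.ofReal |g ξ γ| :=
    (hg.comp measurable_abs).comp ENNReal.measurable_ofReal
  rw [← lintegral_lp_sum_powerset hd _ hm] at hfin
  refine lt_of_le_of_lt (lintegral_mono fun τ => ?_) hfin
  rw [← ENNReal.ofReal_sum_of_nonneg fun _ _ => abs_nonneg _]
  exact ENNReal.ofReal_le_ofReal (Finset.abs_sum_le_sum_abs _ _)

/-- The identity for nonnegative functions applies to the positive and negative parts of g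
separately, both dominated by |g|; the sum over subsets is split termwise. -/
lemma integral_lp_powerset (hd : 1 ≤ d) {g : Finset (Pt d) → Finset (Pt d) → ℝ}
    (hg : JointMeas g)
    (hfin : ∫⁻ τ, ∫⁻ τ', ENNReal.ofReal |g (conf τ) (conf τ')| ∂(lpMeasure d) ∂(lpMeasure d) < ⊤) :
    ∫ τ, ∑ ξ ∈ (conf τ).powerset, g ξ (conf τ \ ξ) ∂(lpMeasure d) =
      ∫ τ, ∫ τ', g (conf τ) (conf τ') ∂(lpMeasure d) ∂(lpMeasure d) := by
  have key : ∀ h : ℝ → ℝ, Measurable h → (∀ r, 0 ≤ h r) → (∀ r, h r ≤ |r|) →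
      Integrable (fun τ => ∑ ξ ∈ (conf τ).powerset, h (g ξ (conf τ \ ξ))) (lpMeasure d) ∧
      Integrable (fun p : Seqs d × Seqs d => h (g (conf p.1) (conf p.2)))
        ((lpMeasure d).prod (lpMeasure d)) ∧
      ∫ τ, ∑ ξ ∈ (conf τ).powerset, h (g ξ (conf τ \ ξ)) ∂(lpMeasure d) =
        ∫ p, h (g (conf p.1) (conf p.2)) ∂((lpMeasure d).prod (lpMeasure d)) := by
    intro h hh h0 hle
    have hgh : JointMeas fun ξ γ => h (g ξ γ) := hg.comp hh
    have hfin' : ∫⁻ τ, ∫⁻ τ', ENNReal.ofReal |h (g (conf τ) (conf τ'))|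
        ∂(lpMeasure d) ∂(lpMeasure d) < ⊤ := by
      refine lt_of_le_of_lt (lintegral_mono fun τ => lintegral_mono fun τ' => ?_) hfin
      rw [abs_of_nonneg (h0 _)]
      exact ENNReal.ofReal_le_ofReal (hle _)
    have hi := integrable_lp_powerset hd hgh hfin'
    have hi' := integrable_lp_prod hgh hfin'
    refine ⟨hi, hi', ?_⟩
    rw [integral_eq_lintegral_of_nonneg_ae
        (Eventually.of_forall fun τ => Finset.sum_nonneg fun _ _ => h0 _) hi.1,
      integral_eq_lintegral_of_nonneg_ae (Eventually.of_forall fun p => h0 _) hi'.1,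
      lintegral_prod _ hi'.1.aemeasurable.ennreal_ofReal]
    congr 1
    rw [← lintegral_lp_sum_powerset hd (fun ξ γ => ENNReal.ofReal (h (g ξ γ)))
      (hgh.comp ENNReal.measurable_ofReal)]
    refine lintegral_congr fun τ => ?_
    rw [ENNReal.ofReal_sum_of_nonneg fun _ _ => h0 _]
  obtain ⟨a1, a2, a3⟩ := key (fun r => max r 0) (measurable_id.max measurable_const)
    (fun r => le_max_right _ _) (fun r => max_le (le_abs_self r) (abs_nonneg r))
  obtain ⟨b1, b2, b3⟩ := key (fun r => max (-r) 0) (measurable_neg.max measurable_const)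
    (fun r => le_max_right _ _) (fun r => max_le (neg_le_abs r) (abs_nonneg r))
  have hsplit : ∀ r : ℝ, r = max r 0 - max (-r) 0 := fun r => by
    rcases le_total r 0 with h | h
    · rw [max_eq_right h, max_eq_left (by linarith)]; ring
    · rw [max_eq_left h, max_eq_right (by linarith)]; ring
  rw [← integral_prod _ (integrable_lp_prod hg hfin)]
  calc ∫ τ, ∑ ξ ∈ (conf τ).powerset, g ξ (conf τ \ ξ) ∂(lpMeasure d)
      = ∫ τ, (∑ ξ ∈ (conf τ).powerset, max (g ξ (conf τ \ ξ)) 0 -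
          ∑ ξ ∈ (conf τ).powerset, max (-g ξ (conf τ \ ξ)) 0) ∂(lpMeasure d) := by
        refine integral_congr_ae (Eventually.of_forall fun τ => ?_)
        simp only
        rw [← Finset.sum_sub_distrib]
        exact Finset.sum_congr rfl fun ξ _ => hsplit _
    _ = ∫ p, max (g (conf p.1) (conf p.2)) 0 ∂((lpMeasure d).prod (lpMeasure d)) -
          ∫ p, max (-g (conf p.1) (conf p.2)) 0 ∂((lpMeasure d).prod (lpMeasure d)) := by
        rw [integral_sub a1 b1, a3, b3]
    _ = _ := by
        rw [← integral_sub a2 b2]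
        exact integral_congr_ae (Eventually.of_forall fun p => (hsplit _).symm)

end LebesguePoisson

end PTCF

namespace PTCF

/-! ### The cluster recursion with single points as blocks, and measurability. -/

section Recursion

lemma sum_powerset_union {ι M : Type*} [DecidableEq ι] [AddCommMonoid M] {S S' : Finset ι}
    (h : Disjoint S S') (g : Finset ι → M) :
    ∑ U ∈ (S ∪ S').powerset, g U = ∑ W ∈ S'.powerset, ∑ U ∈ S.powerset, g (U ∪ W) := by
  rw [Finset.sum_sigma']
  have hd : ∀ x, x ∈ S → x ∉ S' := fun x hx => Finset.disjoint_left.1 h hx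
  refine Finset.sum_bij' (fun U _ => ⟨U ∩ S', U ∩ S⟩) (fun t _ => t.2 ∪ t.1) ?_ ?_ ?_ ?_ ?_
  · intro U _
    simp only [Finset.mem_sigma, Finset.mem_powerset]
    exact ⟨Finset.inter_subset_right, Finset.inter_subset_right⟩
  · rintro ⟨W, U⟩ h
    simp only [Finset.mem_sigma, Finset.mem_powerset] at h ⊢
    exact Finset.union_subset_union h.2 h.1
  · intro U hU
    have hU := Finset.mem_powerset.1 hU
    simp only
    rw [← Finset.inter_union_distrib_left, Finset.inter_eq_left.2 hU]
  · rintro ⟨W, U⟩ h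
    simp only [Finset.mem_sigma, Finset.mem_powerset] at h
    have h1 : (U ∪ W) ∩ S' = W := by
      ext x
      have := hd x; have := @h.1 x; have := @h.2 x
      simp only [Finset.mem_inter, Finset.mem_union]; tauto
    have h2 : (U ∪ W) ∩ S = U := by
      ext x
      have := hd x; have := @h.1 x; have := @h.2 x
      simp only [Finset.mem_inter, Finset.mem_union]; tauto
    simp only [h1, h2]
  · intro U hU
    have hU := Finset.mem_powerset.1 hU
    simp only
    rw [← Finset.inter_union_distrib_left, Finset.inter_eq_left.2 hU]

variable {d : ℕ}

lemma mem_pts {V : Type*} [DecidableEq V] {S : Finset (Finset V)} {y : V} :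
    y ∈ pts S ↔ ∃ B ∈ S, y ∈ B := by simp

lemma disjoint_singles {S : Finset (Finset (Pt d))} {γ : Finset (Pt d)}
    (hγ : Disjoint γ (pts S)) : Disjoint S (singles γ) := by
  rw [Finset.disjoint_left]
  intro B hB hB'
  obtain ⟨y, hy, rfl⟩ := Finset.mem_image.1 hB'
  exact Finset.disjoint_left.1 hγ hy (mem_pts.2 ⟨_, hB, Finset.mem_singleton_self y⟩)

lemma BlockSystem.union_singles {A : Finset (Pt d)} {S : Finset (Finset (Pt d))}
    {γ : Finset (Pt d)} (h : BlockSystem A S) (hA : Disjoint γ A) (hS : Disjoint γ (pts S)) :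
    BlockSystem A (S ∪ singles γ) := by
  have key : ∀ B ∈ S, ∀ y ∈ γ, y ∉ B := fun B hB y hy hyB =>
    Finset.disjoint_left.1 hS hy (mem_pts.2 ⟨B, hB, hyB⟩)
  refine ⟨fun B hB => ?_, fun B hB B' hB' hne => ?_, fun B hB => ?_⟩
  · rcases Finset.mem_union.1 hB with hB | hB
    · exact h.nonempty B hB
    · obtain ⟨y, hy, rfl⟩ := Finset.mem_image.1 hB
      exact Finset.singleton_nonempty y
  · rcases Finset.mem_union.1 hB with hB | hB <;> rcases Finset.mem_union.1 hB' with hB' | hB'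
    · exact h.pairwise B hB B' hB' hne
    · obtain ⟨y, hy, rfl⟩ := Finset.mem_image.1 hB'
      exact Finset.disjoint_singleton_right.2 (key B hB y hy)
    · obtain ⟨y, hy, rfl⟩ := Finset.mem_image.1 hB
      exact Finset.disjoint_singleton_left.2 (key B' hB' y hy)
    · obtain ⟨y, hy, rfl⟩ := Finset.mem_image.1 hB
      obtain ⟨y', hy', rfl⟩ := Finset.mem_image.1 hB'
      exact Finset.disjoint_singleton.2 fun e => hne (by rw [e])
  · rcases Finset.mem_union.1 hB with hB | hB
    · exact h.root B hB
    · obtain ⟨y, hy, rfl⟩ := Finset.mem_image.1 hB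
      exact Finset.disjoint_singleton_right.2 (Finset.disjoint_left.1 hA hy)

lemma singles_injective : Function.Injective (fun y : Pt d => ({y} : Finset (Pt d))) :=
  Finset.singleton_injective

lemma union_singles_sdiff {S U : Finset (Finset (Pt d))} {γ ξ : Finset (Pt d)} (hU : U ⊆ S)
    (hξ : ξ ⊆ γ) (hS : Disjoint γ (pts S)) :
    (S ∪ singles γ) \ (U ∪ singles ξ) = (S \ U) ∪ singles (γ \ ξ) := by
  have hd := disjoint_singles hS
  have h1 : singles (γ \ ξ) = singles γ \ singles ξ := Finset.image_sdiff _ _ singles_injective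
  rw [h1]
  ext B
  have h2 : singles ξ ⊆ singles γ := Finset.image_subset_image hξ
  have a1 := @hU B
  have a2 := @h2 B
  have a3 : B ∈ S → B ∉ singles γ := fun h => Finset.disjoint_left.1 hd h
  simp only [Finset.mem_sdiff, Finset.mem_union]
  tauto

/-- The cluster recursion when some of the blocks are single points. -/
lemma ClusterRec.step_singles {p c : Pt d → Pt d → ℝ} {Q : Finset (Pt d) → Pt d → Prop}
    {F : Finset (Pt d) → Finset (Finset (Pt d)) → ℝ} (hF : ClusterRec p c Q F)
    {A : Finset (Pt d)} {S : Finset (Finset (Pt d))} {γ : Finset (Pt d)} (h : BlockSystem A S)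
    (hA : Disjoint γ A) (hS : Disjoint γ (pts S)) {x : Pt d} (hx : x ∈ A) (hQ : Q A x) :
    F A (S ∪ singles γ) = (∏ y ∈ A.erase x, p x y) *
      ∑ ξ ∈ γ.powerset, ∑ U ∈ S.powerset, (∏ B ∈ U, absorbWeight c x B) * (∏ y ∈ ξ, c x y) *
        F (A.erase x ∪ pts U ∪ ξ) ((S \ U) ∪ singles (γ \ ξ)) := by
  rw [hF.step A _ (h.union_singles hA hS) x hx hQ, sum_powerset_union (disjoint_singles hS)]
  congr 1
  rw [singles, sum_powerset_image _ singles_injective]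
  refine Finset.sum_congr rfl fun ξ hξ => Finset.sum_congr rfl fun U hU => ?_
  have hξ := Finset.mem_powerset.1 hξ
  have hU := Finset.mem_powerset.1 hU
  change (∏ B ∈ U ∪ singles ξ, _) * F (_ ∪ pts (U ∪ singles ξ)) ((S ∪ singles γ) \ (U ∪ singles ξ)) = _
  rw [union_singles_sdiff hU hξ hS, pts_union, pts_singles, Finset.union_assoc, Finset.prod_union
    ((disjoint_singles hS).mono hU (show singles ξ ⊆ singles γ from Finset.image_subset_image hξ))]
  congr 2
  rw [singles, Finset.prod_image fun a _ b _ e => singles_injective e]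
  exact Finset.prod_congr rfl fun y _ => by simp [absorbWeight]

lemma BlockSystem.absorb_singles {A : Finset (Pt d)} {S U : Finset (Finset (Pt d))}
    {ξ A' : Finset (Pt d)} (h : BlockSystem A S) (hA : A' ⊆ A) (hU : U ⊆ S)
    (hξ : Disjoint ξ (pts S)) : BlockSystem (A' ∪ pts U ∪ ξ) (S \ U) := by
  have h1 := h.absorb hA hU
  refine ⟨h1.nonempty, h1.pairwise, fun B hB => ?_⟩
  rw [Finset.disjoint_union_left]
  refine ⟨h1.root B hB, hξ.mono_right ?_⟩
  exact Finset.subset_biUnion_of_mem id (Finset.sdiff_subset hB)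

lemma measurable_absorbWeight {c : Pt d → Pt d → ℝ}
    (hc : Measurable fun q : Pt d × Pt d => c q.1 q.2) (B : Finset (Pt d)) :
    Measurable fun x => absorbWeight c x B := by
  unfold absorbWeight
  exact (Finset.measurable_prod _ fun y _ => measurable_const.add
    (hc.comp (measurable_id.prodMk measurable_const))).sub measurable_const

/-- At generic x the recursion writes F as a finite combination of measurable weights and values of
F with one point fewer, so induction on the number of points applies. The recursion must hold for
every removed point, because a selection need not be measurable. -/
lemma ClusterRec.aemeasurable (hd : 1 ≤ d) {p c : Pt d → Pt d → ℝ}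
    {F : Finset (Pt d) → Finset (Finset (Pt d)) → ℝ}
    (hF : ClusterRec p c (fun _ _ => True) F)
    (hp : Measurable fun q : Pt d × Pt d => p q.1 q.2)
    (hc : Measurable fun q : Pt d × Pt d => c q.1 q.2) {κ : Type} [Fintype κ] (s t : Finset κ)
    (A : Finset (Pt d)) (S : Finset (Finset (Pt d))) (h : BlockSystem A S) (hst : Disjoint s t) :
    AEMeasurable (fun x : κ → Pt d => F (A ∪ s.image x) (S ∪ singles (t.image x))) volume := by
  induction hN : A.card + (pts S).card + s.card + t.card using Nat.strong_induction_on
    generalizing A S s t with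
  | _ N ih =>
    -- Common argument for the two ways of choosing the removed point `w x`: a fixed point of A, or,
    -- when A is empty, one of the variables.
    have main : ∀ (w : (κ → Pt d) → Pt d) (A' : Finset (Pt d)) (s' : Finset κ), Measurable w →
        A' ⊆ A → s' ⊆ s → A'.card + s'.card < A.card + s.card →
        (∀ x, IsGeneric (A ∪ pts S) x → w x ∈ A ∪ s.image x ∧
          (A ∪ s.image x).erase (w x) = A' ∪ s'.image x) →
        AEMeasurable (fun x : κ → Pt d => F (A ∪ s.image x) (S ∪ singles (t.image x))) volume := by
      intro w A' s' hw hA' hs' hcard hwx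
      have hG : AEMeasurable (fun x : κ → Pt d =>
          ((∏ y ∈ A', p (w x) y) * ∏ i ∈ s', p (w x) (x i)) *
          ∑ α ∈ t.powerset, ∑ U ∈ S.powerset,
            (∏ B ∈ U, absorbWeight c (w x) B) * (∏ i ∈ α, c (w x) (x i)) *
              F ((A' ∪ pts U) ∪ (s' ∪ α).image x) ((S \ U) ∪ singles ((t \ α).image x)))
          volume := by
        refine AEMeasurable.mul (Measurable.aemeasurable ?_) ?_
        · exact (Finset.measurable_prod _ fun y _ => hp.comp (hw.prodMk measurable_const)).mul
            (Finset.measurable_prod _ fun i _ => hp.comp (hw.prodMk (measurable_pi_apply i)))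
        · refine Finset.aemeasurable_fun_sum _ fun α hα => Finset.aemeasurable_fun_sum _ fun U hU => ?_
          have hα := Finset.mem_powerset.1 hα
          have hU := Finset.mem_powerset.1 hU
          refine AEMeasurable.mul (Measurable.aemeasurable ?_) ?_
          · exact (Finset.measurable_prod _ fun B _ => (measurable_absorbWeight hc B).comp hw).mul
              (Finset.measurable_prod _ fun i _ => hc.comp (hw.prodMk (measurable_pi_apply i)))
          · refine ih _ ?_ (s' ∪ α) (t \ α) _ _ (h.absorb hA' hU) ?_ rfl
            · have h1 := Finset.card_union_le A' (pts U)
              have h2 := Finset.card_union_le s' α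
              have h3 := Finset.card_sdiff_add_card_eq_card hα
              have h4 : (pts U).card + (pts (S \ U)).card = (pts S).card := by
                rw [← pts_union_pts_sdiff hU, Finset.card_union_of_disjoint]
                exact (h.absorb (Finset.empty_subset A) hU).disjoint_pts.mono_left
                  Finset.subset_union_right
              omega
            · rw [Finset.disjoint_union_left]
              exact ⟨(hst.mono_left hs').mono_right Finset.sdiff_subset,
                Finset.disjoint_sdiff⟩
      refine hG.congr ?_
      filter_upwards [ae_isGeneric hd (A ∪ pts S)] with x hx
      obtain ⟨hw1, hw2⟩ := hwx x hx
      have hinj := hx.1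
      have hdi : ∀ r : Finset κ, Disjoint (r.image x) (A ∪ pts S) := fun r => hx.disjoint_image r
      have hAs : BlockSystem (A ∪ s.image x) S := by
        have := h.absorb_singles (A' := A) (U := ∅) (ξ := s.image x) le_rfl (Finset.empty_subset _)
          ((hdi s).mono_right Finset.subset_union_right)
        simpa using this
      have hst' : Disjoint (s.image x) (t.image x) := (Finset.disjoint_image hinj).2 hst
      symm
      rw [hF.step_singles hAs (Finset.disjoint_union_right.2
        ⟨(hdi t).mono_right Finset.subset_union_left, hst'.symm⟩)
        ((hdi t).mono_right Finset.subset_union_right) hw1 trivial, hw2, Finset.prod_union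
        (((hdi s').mono_right (hA'.trans Finset.subset_union_left)).symm),
        Finset.prod_image fun a _ b _ e => hinj e, sum_powerset_image x hinj]
      congr 1
      refine Finset.sum_congr rfl fun α _ => Finset.sum_congr rfl fun U _ => ?_
      rw [Finset.prod_image fun a _ b _ e => hinj e, image_sdiff_image hinj, Finset.image_union]
      congr 2
      ext y
      simp only [Finset.mem_union]
      tauto
    rcases A.eq_empty_or_nonempty with rfl | ⟨x₀, hx₀⟩
    · rcases s.eq_empty_or_nonempty with rfl | ⟨i, hi⟩
      · refine (aemeasurable_const (b := if S = ∅ ∧ t = ∅ then (1 : ℝ) else 0)).congr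
          (Eventually.of_forall fun x => ?_)
        simp only [Finset.image_empty, Finset.union_empty, hF.base, singles,
          Finset.union_eq_empty, Finset.image_eq_empty]
      · refine main (fun x => x i) ∅ (s.erase i) (measurable_pi_apply i) le_rfl
          (Finset.erase_subset _ _) ?_ fun x hx => ?_
        · rw [Finset.card_erase_of_mem hi]
          have := Finset.card_pos.2 ⟨i, hi⟩
          omega
        · refine ⟨by simpa using ⟨i, hi, rfl⟩, ?_⟩
          rw [Finset.empty_union, Finset.empty_union, Finset.image_erase hx.1]
    · refine main (fun _ => x₀) (A.erase x₀) s measurable_const (Finset.erase_subset _ _) le_rfl ?_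
        fun x hx => ?_
      · rw [Finset.card_erase_of_mem hx₀]
        have := Finset.card_pos.2 ⟨x₀, hx₀⟩
        omega
      · refine ⟨Finset.mem_union_left _ hx₀, ?_⟩
        rw [Finset.erase_union_distrib, Finset.erase_eq_of_notMem (s := s.image x)]
        intro hmem
        exact Finset.disjoint_left.1 (hx.disjoint_image s) hmem (Finset.mem_union_left _ hx₀)

lemma ClusterRec.jointMeas (hd : 1 ≤ d) {p c : Pt d → Pt d → ℝ}
    {F : Finset (Pt d) → Finset (Finset (Pt d)) → ℝ}
    (hF : ClusterRec p c (fun _ _ => True) F)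
    (hp : Measurable fun q : Pt d × Pt d => p q.1 q.2)
    (hc : Measurable fun q : Pt d × Pt d => c q.1 q.2)
    {A : Finset (Pt d)} {S : Finset (Finset (Pt d))} (h : BlockSystem A S) :
    JointMeas fun ξ γ => F (A ∪ ξ) (S ∪ singles γ) :=
  fun _ _ s t hst => hF.aemeasurable hd hp hc s t A S h hst

end Recursion

end PTCF

namespace PTCF

/-! ### Weighted binomial identities. -/

section Counting

/-- Without weights this is the binomial theorem; each i contributes w i times (M+1)^(|K|-1). The
factor M + 1 on the left avoids that exponent, which is meaningless for empty K. -/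
lemma sum_powerset_weight {ι : Type*} [DecidableEq ι] (w : ι → ℝ) (M a : ℝ) (K : Finset ι) :
    (M + 1) * ∑ U ∈ K.powerset, (a + ∑ i ∈ U, w i) * M ^ (K.card - U.card) =
      (a * (M + 1) + ∑ i ∈ K, w i) * (M + 1) ^ K.card := by
  induction K using Finset.induction_on generalizing a with
  | empty => simp; ring
  | insert i K hi ih =>
    rw [Finset.sum_powerset_insert hi, Finset.sum_insert hi, Finset.card_insert_of_notMem hi]
    have h1 : ∑ U ∈ K.powerset, (a + ∑ i ∈ U, w i) * M ^ (K.card + 1 - U.card) =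
        M * ∑ U ∈ K.powerset, (a + ∑ i ∈ U, w i) * M ^ (K.card - U.card) := by
      rw [Finset.mul_sum]
      refine Finset.sum_congr rfl fun U hU => ?_
      have := Finset.card_le_card (Finset.mem_powerset.1 hU)
      rw [Nat.succ_sub this, pow_succ]; ring
    have h2 : ∑ U ∈ K.powerset, (a + ∑ i ∈ insert i U, w i) *
          M ^ (K.card + 1 - (insert i U).card) =
        ∑ U ∈ K.powerset, ((a + w i) + ∑ i ∈ U, w i) * M ^ (K.card - U.card) := by
      refine Finset.sum_congr rfl fun U hU => ?_
      have hiU : i ∉ U := fun h => hi (Finset.mem_powerset.1 hU h)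
      rw [Finset.sum_insert hiU, Finset.card_insert_of_notMem hiU, Nat.add_sub_add_right]; ring
    rw [h1, h2]
    linear_combination M * ih a + ih (a + w i)

/-- The binomial identity is used for the blocks and for the n single points, which have weight one.
It is what lets the Cayley type bound reproduce itself under the recursion. -/
lemma sum_powerset_powerset_weight {ι : Type*} [DecidableEq ι] (w : ι → ℝ) {M : ℝ} (hM : 0 < M)
    (a : ℝ) (S : Finset ι) (n : ℕ) :
    ∑ α ∈ (Finset.univ : Finset (Fin n)).powerset, ∑ U ∈ S.powerset,
        (a + ∑ i ∈ U, w i + α.card) * M ^ (S.card - U.card + (n - α.card)) =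
      (a * (M + 1) + ∑ i ∈ S, w i + n) * (M + 1) ^ (S.card + n) / (M + 1) := by
  have hM1 : M + 1 ≠ 0 := by positivity
  have h1 : ∀ α : Finset (Fin n), ∑ U ∈ S.powerset,
      (a + ∑ i ∈ U, w i + α.card) * M ^ (S.card - U.card + (n - α.card)) =
      (M + 1) ^ S.card * ((a + (∑ i ∈ S, w i) / (M + 1) + ∑ _i ∈ α, (1 : ℝ)) *
        M ^ ((Finset.univ : Finset (Fin n)).card - α.card)) := by
    intro α
    have h := sum_powerset_weight w M (a + α.card) S
    have h' : ∑ U ∈ S.powerset, (a + α.card + ∑ i ∈ U, w i) * M ^ (S.card - U.card) =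
        ((a + α.card) * (M + 1) + ∑ i ∈ S, w i) * (M + 1) ^ S.card / (M + 1) := by
      rw [eq_div_iff hM1, mul_comm, h]
    rw [Finset.card_univ, Fintype.card_fin, Finset.sum_const, nsmul_eq_mul, mul_one]
    calc _ = (∑ U ∈ S.powerset, (a + α.card + ∑ i ∈ U, w i) * M ^ (S.card - U.card)) *
          M ^ (n - α.card) := by
            rw [Finset.sum_mul]
            refine Finset.sum_congr rfl fun U _ => ?_
            rw [pow_add]; ring
      _ = _ := by rw [h']; field_simp; ring
  rw [Finset.sum_congr rfl fun α _ => h1 α, ← Finset.mul_sum]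
  have h := sum_powerset_weight (fun _ : Fin n => (1 : ℝ)) M (a + (∑ i ∈ S, w i) / (M + 1))
    Finset.univ
  rw [eq_div_iff hM1, mul_assoc, mul_comm _ (M + 1), h, Finset.card_univ, Fintype.card_fin,
    Finset.sum_const, Finset.card_univ, Fintype.card_fin, nsmul_eq_mul, mul_one, pow_add]
  field_simp

end Counting

/-! ### Domination by forests and the integrated forest count. -/

section ForestBounds

variable {d : ℕ} {φ : ℝ → EReal} {β : ℝ}

/-- The sum over forests of the products of `ν_β` over the edges. -/
noncomputable def forestNu (φ : ℝ → EReal) (β : ℝ) (A : Finset (Pt d))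
    (S : Finset (Finset (Pt d))) : ℝ :=
  ∑ f ∈ parentForests A S, ∏ e ∈ f, onPair (fun r => |mayer φ β r|) e

lemma forestNu_nonneg (A : Finset (Pt d)) (S : Finset (Finset (Pt d))) :
    0 ≤ forestNu φ β A S := by
  refine Finset.sum_nonneg fun f _ => Finset.prod_nonneg fun e _ => ?_
  induction e using Sym2.inductionOn with
  | _ x y => exact abs_nonneg _

lemma forestNu_clusterRec :
    ClusterRec (fun _ _ => 1) (fun x y => nu d φ β (x - y)) (fun _ _ => True) (forestNu φ β) :=
  forestSum_clusterRec _ _ fun x y => abs_mayer_dist x y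

lemma gibbs_clusterRec (hφ : AssumptionA d φ) (hβ : 0 < β) :
    ClusterRec (bond (d := d) φ β) (fun x y => bond φ β x y - 1) (fun _ _ => True)
      (trunc (gibbs φ β)) :=
  trunc_clusterRec _ _ (gibbs_empty β) fun A x hx => gibbs_erase hφ hβ A x hx

/-- After expansion, the weight is a polynomial in the values of c with nonnegative coefficients and
no constant term; the induction adds one factor at a time. -/
lemma abs_absorbWeight_le {V : Type*} (c c' : V → V → ℝ) (x : V)
    (h : ∀ y, |c x y| = c' x y) (B : Finset V) :
    |absorbWeight c x B| ≤ absorbWeight c' x B := by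
  induction B using Finset.cons_induction with
  | empty => simp [absorbWeight]
  | cons y B hy ih =>
    unfold absorbWeight at ih ⊢
    rw [Finset.prod_cons, Finset.prod_cons]
    have h0 : 0 ≤ c' x y := h y ▸ abs_nonneg _
    calc |(1 + c x y) * ∏ y ∈ B, (1 + c x y) - 1|
        = |(1 + c x y) * (∏ y ∈ B, (1 + c x y) - 1) + c x y| := by congr 1; ring
      _ ≤ |1 + c x y| * |∏ y ∈ B, (1 + c x y) - 1| + |c x y| := by
          rw [← abs_mul]; exact abs_add_le _ _
      _ ≤ (1 + c' x y) * (∏ y ∈ B, (1 + c' x y) - 1) + c' x y := by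
          have : |1 + c x y| ≤ 1 + c' x y := by
            rw [← h y]; exact (abs_add_le _ _).trans (by simp)
          rw [h y]
          gcongr
      _ = _ := by ring

lemma absorbWeight_nonneg {V : Type*} (c : V → V → ℝ) (x : V) (h : ∀ y, 0 ≤ c x y)
    (B : Finset V) : 0 ≤ absorbWeight c x B :=
  (abs_nonneg _).trans (abs_absorbWeight_le c c x (fun y => abs_of_nonneg (h y)) B)

/-- The truncation obeys its recursion at every point of the root, so the point provided by
stability may be removed, at a cost of at most e^{2βB}. With absolute values on the Mayer factors,
what remains is the recursion of the forest sum. -/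
lemma abs_trunc_gibbs_le (hφ : AssumptionA d φ) (hβ : 0 < β) {B : ℝ} (hB : IsStable d φ B)
    (A : Finset (Pt d)) (S : Finset (Finset (Pt d))) (h : BlockSystem A S) :
    |trunc (gibbs φ β) A S| ≤ Real.exp (2 * β * B) ^ numPts A S * forestNu φ β A S := by
  obtain ⟨sel, hsel⟩ := exists_selection hφ hB
  induction hN : numPts A S using Nat.strong_induction_on generalizing A S with
  | _ N ih =>
    rcases A.eq_empty_or_nonempty with rfl | hA
    · rw [(gibbs_clusterRec hφ hβ).base, forestNu_clusterRec.base]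
      split_ifs with hS
      · subst hS
        rw [← hN]; simp [numPts]
      · simp
    · have hx := (hsel A hA).1
      rw [(gibbs_clusterRec hφ hβ).step A S h _ hx trivial,
        forestNu_clusterRec.step A S h _ hx trivial, abs_mul,
        abs_of_nonneg (Finset.prod_nonneg fun y _ => bond_nonneg β _ y), Finset.prod_const_one,
        one_mul]
      have hpos : 0 < Real.exp (2 * β * B) := Real.exp_pos _
      obtain ⟨N', rfl⟩ : ∃ N', N = N' + 1 := ⟨N - 1, by
        have := h.numPts_absorb hx (Finset.empty_subset S); omega⟩
      rw [pow_succ', mul_assoc, Finset.mul_sum]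
      refine mul_le_mul (hsel.prod_bond_le hφ hβ hA) ?_ (abs_nonneg _) hpos.le
      refine (Finset.abs_sum_le_sum_abs _ _).trans (Finset.sum_le_sum fun U hU => ?_)
      have hU := Finset.mem_powerset.1 hU
      have hN' : numPts (A.erase (sel A) ∪ pts U) (S \ U) = N' := by
        have := h.numPts_absorb hx hU; omega
      have h1 := ih _ (by omega) _ _ (h.absorb (Finset.erase_subset _ _) hU) hN'
      rw [abs_mul, Finset.abs_prod, mul_left_comm]
      refine mul_le_mul (Finset.prod_le_prod (fun _ _ => abs_nonneg _) fun C _ => ?_) h1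
        (abs_nonneg _) (Finset.prod_nonneg fun C _ => absorbWeight_nonneg _ _
          (fun y => nu_nonneg _) C)
      exact abs_absorbWeight_le _ _ _ (fun y => abs_mayer_dist _ _) C

lemma one_le_nu0Tilde : 1 ≤ nu0Tilde d φ β := le_max_left _ _

lemma absorbWeight_nu_le (hφ : AssumptionA d φ) (hβ : 0 < β) (x : Pt d) (B : Finset (Pt d)) :
    absorbWeight (fun x y => nu d φ β (x - y)) x B ≤ (2 * nu0Tilde d φ β) ^ B.card := by
  unfold absorbWeight
  have : ∏ y ∈ B, (1 + nu d φ β (x - y)) ≤ ∏ _y ∈ B, (2 * nu0Tilde d φ β) := by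
    refine Finset.prod_le_prod (fun y _ => by have := nu_nonneg (φ := φ) (β := β) (x - y); linarith)
      fun y _ => ?_
    have h1 : nu d φ β (x - y) ≤ nu0Tilde d φ β := (nu_le_nu0 hφ hβ _).trans (le_max_right _ _)
    have h2 := one_le_nu0Tilde (d := d) (φ := φ) (β := β)
    linarith
  rw [Finset.prod_const] at this
  linarith

lemma lintegral_prod_nu (hφ : AssumptionA d φ) (hβ : 0 < β) (x : Pt d) (n : ℕ) :
    ∫⁻ u : Fin n → Pt d, ENNReal.ofReal (∏ i, nu d φ β (x - u i)) =
      ENNReal.ofReal (nu1 d φ β ^ n) := by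
  have hi : Integrable (fun y => nu d φ β (x - y)) := (integrable_nu hφ hβ).comp_sub_left x
  have hp : Integrable fun u : Fin n → Pt d => ∏ i, nu d φ β (x - u i) :=
    Integrable.fintype_prod (f := fun _ y => nu d φ β (x - y)) fun _ => hi
  rw [← ofReal_integral_eq_lintegral_ofReal hp
    (Eventually.of_forall fun u => Finset.prod_nonneg fun i _ => nu_nonneg _),
    integral_fintype_prod_volume_eq_pow (fun y => nu d φ β (x - y)), Fintype.card_fin,
    integral_sub_left_eq_self (fun y => nu d φ β y) volume x]
  rfl

lemma measurable_nu_sub (hφ : AssumptionA d φ) (hβ : 0 < β) :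
    Measurable fun q : Pt d × Pt d => nu d φ β (q.1 - q.2) :=
  (measurable_nu hφ hβ).comp (measurable_fst.sub measurable_snd)

lemma card_pts {S U : Finset (Finset (Pt d))} {A : Finset (Pt d)} (h : BlockSystem A S)
    (hU : U ⊆ S) : (pts U).card = ∑ B ∈ U, B.card :=
  Finset.card_biUnion fun B hB B' hB' hne => h.pairwise B (hU hB) B' (hU hB') hne

set_option maxHeartbeats 1000000 in
/-- The integral of the forest sum over the positions of the one-point blocks. -/
lemma lintegral_forestNu_le (hd : 1 ≤ d) (hφ : AssumptionA d φ) (hβ : 0 < β) (n : ℕ)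
    (A : Finset (Pt d)) (S : Finset (Finset (Pt d))) (h : BlockSystem A S) (N : ℕ)
    (hN : A.card + (pts S).card + n = N) (hN1 : 1 ≤ N) :
    ∫⁻ y : Fin n → Pt d, ENNReal.ofReal (forestNu φ β A (S ∪ singles (Finset.univ.image y))) ≤
      ENNReal.ofReal (nu1 d φ β ^ n * (2 * nu0Tilde d φ β) ^ (pts S).card *
        (A.card * (N : ℝ) ^ (S.card + n) / N)) := by
  induction N generalizing n A S with
  | zero => omega
  | succ M ih =>
    have hq := forestNu_clusterRec (d := d) (φ := φ) (β := β)
    have hn1 : 0 < nu1 d φ β := nu1_pos hφ hβ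
    have hn0 := one_le_nu0Tilde (d := d) (φ := φ) (β := β)
    -- With an empty root and N ≥ 1 some block is left over almost everywhere, and the forest sum
    -- vanishes. For n > 0 its points are blocks; for n = 0 the set S is not empty.
    rcases A.eq_empty_or_nonempty with rfl | ⟨x, hx⟩
    · refine le_of_eq_of_le ?_ zero_le
      refine (lintegral_congr fun y => ?_).trans lintegral_zero
      rw [hq.base, if_neg, ENNReal.ofReal_zero]
      intro h0
      rw [Finset.union_eq_empty] at h0
      obtain ⟨rfl, h2⟩ := h0
      rw [singles, Finset.image_eq_empty, Finset.image_eq_empty, Finset.univ_eq_empty_iff] at h2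
      have h3 : n = 0 := by
        rw [← Fintype.card_fin n]; exact Fintype.card_eq_zero_iff.2 h2
      subst h3
      simp at hN
    · have hApos := Finset.card_pos.2 ⟨x, hx⟩
      have hA' := Finset.card_erase_of_mem hx
      -- M is the number of points left after one removal. The induction bound divides by M, so the
      -- case of a single root point without blocks is separate.
      rcases Nat.eq_zero_or_pos M with rfl | hM
      · have hn : n = 0 := by omega
        have hS : S = ∅ := by
          by_contra hS
          obtain ⟨B, hB⟩ := Finset.nonempty_iff_ne_empty.2 hS
          obtain ⟨y, hy⟩ := h.nonempty B hB
          have := Finset.card_pos.2 ⟨y, mem_pts.2 ⟨B, hB, hy⟩⟩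
          omega
        have hA1 : A.card = 1 := by omega
        have hA0 : A.erase x = ∅ := Finset.card_eq_zero.1 (by omega)
        subst hn hS
        have : ∀ y : Fin 0 → Pt d, forestNu φ β A (∅ ∪ singles (Finset.univ.image y)) = 1 := by
          intro y
          have hs : (∅ : Finset (Finset (Pt d))) ∪ singles (Finset.univ.image y) = ∅ := by
            simp [singles]
          rw [hs, hq.step A ∅ h x hx trivial, hA0]
          simp [hq.base]
        simp only [this, hA1]
        simp [volume_pi]
      · set C := 2 * nu0Tilde d φ β with hC
        set ν₁ := nu1 d φ β with hν₁
        have hMr : (0 : ℝ) < M := by exact_mod_cast hM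
        have hCpos : 0 < C := by rw [hC]; linarith
        have hcard : ∀ U ∈ S.powerset, (pts U).card + (pts (S \ U)).card = (pts S).card := by
          intro U hU
          have hU := Finset.mem_powerset.1 hU
          rw [← pts_union_pts_sdiff hU, Finset.card_union_of_disjoint]
          exact (h.absorb (Finset.empty_subset A) hU).disjoint_pts.mono_left
            Finset.subset_union_right
        let wt : Finset (Finset (Pt d)) → ℝ := fun U =>
          ∏ B ∈ U, absorbWeight (fun x y => nu d φ β (x - y)) x B
        have hwt0 : ∀ U, 0 ≤ wt U := fun U =>
          Finset.prod_nonneg fun B _ => absorbWeight_nonneg _ _ (fun y => nu_nonneg _) B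
        have hwt : ∀ U ∈ S.powerset, wt U ≤ C ^ (pts U).card := by
          intro U hU
          rw [card_pts h (Finset.mem_powerset.1 hU), ← Finset.prod_pow_eq_pow_sum]
          exact Finset.prod_le_prod (fun B _ => absorbWeight_nonneg _ _ (fun y => nu_nonneg _) B)
            fun B _ => absorbWeight_nu_le hφ hβ x B
        let g : Finset (Finset (Pt d)) → Finset (Pt d) → Finset (Pt d) → ℝ := fun U ξ γ =>
          (∏ y ∈ ξ, nu d φ β (x - y)) *
            forestNu φ β (A.erase x ∪ pts U ∪ ξ) ((S \ U) ∪ singles γ)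
        have hg0 : ∀ U ξ γ, 0 ≤ g U ξ γ := fun U ξ γ =>
          mul_nonneg (Finset.prod_nonneg fun y _ => nu_nonneg _) (forestNu_nonneg _ _)
        have hgm : ∀ U ∈ S.powerset, JointMeas fun ξ γ => ENNReal.ofReal (g U ξ γ) := by
          intro U hU
          refine ((JointMeas.of_prod hd ((measurable_nu hφ hβ).comp
            (measurable_const.sub measurable_id))).mul
            (hq.jointMeas hd measurable_const (measurable_nu_sub hφ hβ)
              (h.absorb (Finset.erase_subset _ _) (Finset.mem_powerset.1 hU)))).comp
            ENNReal.measurable_ofReal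
        have hexp : ∀ᵐ y : Fin n → Pt d,
            ENNReal.ofReal (forestNu φ β A (S ∪ singles (Finset.univ.image y))) =
            ∑ α ∈ (Finset.univ : Finset (Fin n)).powerset, ∑ U ∈ S.powerset,
              ENNReal.ofReal (wt U) * ENNReal.ofReal (g U (α.image y) (αᶜ.image y)) := by
          filter_upwards [ae_isGeneric hd (A ∪ pts S)] with y hy
          have hdi := hy.disjoint_image Finset.univ
          rw [hq.step_singles h (hdi.mono_right Finset.subset_union_left)
            (hdi.mono_right Finset.subset_union_right) hx trivial, Finset.prod_const_one, one_mul,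
            sum_powerset_image y hy.1, ENNReal.ofReal_sum_of_nonneg]
          · refine Finset.sum_congr rfl fun α _ => ?_
            rw [ENNReal.ofReal_sum_of_nonneg]
            · refine Finset.sum_congr rfl fun U _ => ?_
              rw [← ENNReal.ofReal_mul (hwt0 U), image_sdiff_image hy.1,
                ← Finset.compl_eq_univ_sdiff, mul_assoc]
            · intro U _
              rw [mul_assoc]
              exact mul_nonneg (hwt0 U) (hg0 U _ _)
          · intro α _
            refine Finset.sum_nonneg fun U _ => ?_
            rw [mul_assoc]
            exact mul_nonneg (hwt0 U) (hg0 U _ _)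
        -- For fixed absorbed points the induction hypothesis integrates out the other n - |α|
        -- points, with a root of |A| - 1 + ∑_{B∈U} |B| + |α| points. The absorbed points carry only
        -- ∏ ν(x - u_i), whose integral is ν₁^|α|.
        have hterm : ∀ α : Finset (Fin n), ∀ U ∈ S.powerset,
            ∫⁻ y : Fin n → Pt d, ENNReal.ofReal (g U (α.image y) (αᶜ.image y)) ≤
              ENNReal.ofReal (ν₁ ^ α.card * (ν₁ ^ (n - α.card) * C ^ (pts (S \ U)).card *
                ((((A.card - 1 : ℕ) : ℝ) + ∑ B ∈ U, (B.card : ℝ) + α.card) *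
                  (M : ℝ) ^ (S.card - U.card + (n - α.card)) / M))) := by
          intro α U hU
          have hU' := Finset.mem_powerset.1 hU
          have hsp := lintegral_split (fun ξ γ => ENNReal.ofReal (g U ξ γ))
            (fun _ => Finset.mem_compl) (hgm U hU (Fin n) α αᶜ disjoint_compl_right)
          have hsp' : ∫⁻ y : Fin n → Pt d, ENNReal.ofReal (g U (α.image y) (αᶜ.image y)) =
              ∫⁻ u : Fin α.card → Pt d, ∫⁻ v : Fin (n - α.card) → Pt d,
                ENNReal.ofReal (g U (Finset.univ.image u) (Finset.univ.image v)) := by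
            have hc : Finset.card αᶜ = n - α.card := by rw [Finset.card_compl, Fintype.card_fin]
            rw [hsp, hc]
          rw [hsp', ENNReal.ofReal_mul (pow_nonneg hn1.le _), ← lintegral_prod_nu hφ hβ x,
            ← lintegral_mul_const' _ _ ENNReal.ofReal_ne_top]
          refine lintegral_mono_ae ?_
          filter_upwards [ae_isGeneric hd (A ∪ pts S)] with u hu
          have hdi := hu.disjoint_image Finset.univ
          have hBS := h.absorb_singles (A' := A.erase x) (Finset.erase_subset _ _) hU'
            (hdi.mono_right Finset.subset_union_right)
          have hrc : (A.erase x ∪ pts U ∪ Finset.univ.image u).card =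
              A.card - 1 + ∑ B ∈ U, B.card + α.card := by
            rw [Finset.card_union_of_disjoint, Finset.card_union_of_disjoint, hA', card_pts h hU',
              Finset.card_image_of_injective _ hu.1, Finset.card_univ, Fintype.card_fin]
            · exact (h.mono (Finset.erase_subset _ _) hU').disjoint_pts
            · exact (hdi.mono_right (Finset.union_subset_union (Finset.erase_subset _ _)
                (Finset.biUnion_subset_biUnion_of_subset_left id hU'))).symm
          have hle := Finset.card_le_univ α
          rw [Fintype.card_fin] at hle
          have hcU := hcard U hU
          have hi := ih (n - α.card) _ (S \ U) hBS (by
            rw [hrc, ← card_pts h hU']; omega) hM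
          rw [hrc, Finset.card_sdiff_of_subset hU'] at hi
          push_cast at hi
          simp only [g]
          rw [Finset.prod_image fun a _ b _ e => hu.1 e]
          simp_rw [ENNReal.ofReal_mul (p := ∏ i, nu d φ β (x - u i))
            (Finset.prod_nonneg fun i _ => nu_nonneg _)]
          rw [lintegral_const_mul' _ _ ENNReal.ofReal_ne_top]
          gcongr
        have hgm' : ∀ (α : Finset (Fin n)), ∀ U ∈ S.powerset, AEMeasurable
            (fun y : Fin n → Pt d => ENNReal.ofReal (g U (α.image y) (αᶜ.image y))) volume :=
          fun α U hU => hgm U hU (Fin n) α _ (Finset.disjoint_left.2 fun _ h h' => Finset.mem_compl.1 h' h)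
        rw [lintegral_congr_ae hexp, lintegral_finsetSum' _ fun α _ =>
          Finset.aemeasurable_fun_sum _ fun U hU => (hgm' α U hU).const_mul _]
        have hnn : ∀ (α : Finset (Fin n)) (U : Finset (Finset (Pt d))),
            0 ≤ ν₁ ^ n * C ^ (pts S).card / M *
              ((((A.card - 1 : ℕ) : ℝ) + ∑ B ∈ U, (B.card : ℝ) + α.card) *
                  (M : ℝ) ^ (S.card - U.card + (n - α.card))) := fun α U =>
          mul_nonneg (div_nonneg (mul_nonneg (pow_nonneg hn1.le _) (pow_nonneg hCpos.le _)) hMr.le)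
            (mul_nonneg (add_nonneg (add_nonneg (Nat.cast_nonneg _)
              (Finset.sum_nonneg fun _ _ => Nat.cast_nonneg _)) (Nat.cast_nonneg _))
              (pow_nonneg hMr.le _))
        have hstep : ∀ α ∈ (Finset.univ : Finset (Fin n)).powerset,
            ∫⁻ y : Fin n → Pt d, ∑ U ∈ S.powerset,
              ENNReal.ofReal (wt U) * ENNReal.ofReal (g U (α.image y) (αᶜ.image y)) ≤
            ENNReal.ofReal (∑ U ∈ S.powerset, ν₁ ^ n * C ^ (pts S).card / M *
              ((((A.card - 1 : ℕ) : ℝ) + ∑ B ∈ U, (B.card : ℝ) + α.card) *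
                  (M : ℝ) ^ (S.card - U.card + (n - α.card)))) := by
          intro α _
          rw [lintegral_finsetSum' _ fun U hU => (hgm' α U hU).const_mul _,
            ENNReal.ofReal_sum_of_nonneg fun U _ => hnn α U]
          refine Finset.sum_le_sum fun U hU => ?_
          rw [lintegral_const_mul'' _ (hgm' α U hU)]
          refine (mul_le_mul' (ENNReal.ofReal_le_ofReal (hwt U hU)) (hterm α U hU)).trans ?_
          rw [← ENNReal.ofReal_mul (pow_nonneg hCpos.le _)]
          refine ENNReal.ofReal_le_ofReal (le_of_eq ?_)
          have hle := Finset.card_le_univ α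
          rw [Fintype.card_fin] at hle
          have e0 : ν₁ ^ n = ν₁ ^ α.card * ν₁ ^ (n - α.card) := by
            rw [← pow_add, Nat.add_sub_cancel' hle]
          rw [← hcard U hU, pow_add C, e0]
          ring
        refine (Finset.sum_le_sum hstep).trans ?_
        rw [← ENNReal.ofReal_sum_of_nonneg fun α _ => Finset.sum_nonneg fun U _ => hnn α U]
        refine ENNReal.ofReal_le_ofReal (le_of_eq ?_)
        simp_rw [← Finset.mul_sum]
        rw [sum_powerset_powerset_weight _ hMr]
        have e1 : ∑ B ∈ S, (B.card : ℝ) = (pts S).card := by rw [card_pts h le_rfl]; push_cast; rfl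
        have e2 : (A.card : ℝ) + (pts S).card + n = M + 1 := by exact_mod_cast hN
        rw [e1, Nat.cast_sub hApos]
        push_cast
        -- This equality closes the induction: the root, block and point contributions combine to
        -- |A| M, and M cancels the denominator of the induction hypothesis.
        have e3 : ((A.card : ℝ) - 1) * (M + 1) + (pts S).card + n = A.card * M := by
          linear_combination e2
        rw [e3]
        field_simp

end ForestBounds

end PTCF

namespace PTCF

/-! ### Pointwise and integrated bounds for the kernels. -/

section KernelBounds

/-- The hypotheses on the potential, the temperature, the stability constant and the activity. -/
structure Regime (d : ℕ) (φ : ℝ → EReal) (β B z : ℝ) : Prop where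
  dim : 1 ≤ d
  pot : AssumptionA d φ
  beta : 0 < β
  nonneg : 0 ≤ B
  stable : IsStable d φ B
  pos : 0 < z
  small : z * Real.exp (2 * β * B + 2) * nu1 d φ β < 1

/-- Position dependent activities bounded by `z`. -/
structure IsActivity {d : ℕ} (z : ℝ) (ζ : Pt d → ℝ) : Prop where
  meas : Measurable ζ
  nonneg : ∀ x, 0 ≤ ζ x
  le : ∀ x, ζ x ≤ z

variable {d : ℕ} {φ : ℝ → EReal} {β B z : ℝ}

/-- The kernel for a root `A`, blocks `S`, additional points `γ` and the activity `ζ`. -/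
noncomputable def kern (φ : ℝ → EReal) (β : ℝ) (ζ : Pt d → ℝ) (A : Finset (Pt d))
    (S : Finset (Finset (Pt d))) (γ : Finset (Pt d)) : ℝ :=
  (∏ x ∈ A ∪ pts S ∪ γ, ζ x) * trunc (gibbs φ β) A (S ∪ singles γ)

lemma BlockSystem.card_union {A : Finset (Pt d)} {S : Finset (Finset (Pt d))} {γ : Finset (Pt d)}
    (h : BlockSystem A S) (hγ : Disjoint γ (A ∪ pts S)) :
    (A ∪ pts S ∪ γ).card = A.card + (pts S).card + γ.card := by
  rw [Finset.card_union_of_disjoint hγ.symm, Finset.card_union_of_disjoint h.disjoint_pts]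

lemma numPts_union_singles (A : Finset (Pt d)) (S : Finset (Finset (Pt d))) (γ : Finset (Pt d)) :
    numPts A (S ∪ singles γ) = (A ∪ pts S ∪ γ).card := by
  rw [numPts, pts_union, pts_singles, Finset.union_assoc]

lemma IsActivity.prod_nonneg {ζ : Pt d → ℝ} (hζ : IsActivity z ζ) (X : Finset (Pt d)) :
    0 ≤ ∏ x ∈ X, ζ x := Finset.prod_nonneg fun x _ => hζ.nonneg x

lemma IsActivity.prod_le {ζ : Pt d → ℝ} (hζ : IsActivity z ζ) (X : Finset (Pt d)) :
    ∏ x ∈ X, ζ x ≤ z ^ X.card := by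
  rw [← Finset.prod_const]
  exact Finset.prod_le_prod (fun x _ => hζ.nonneg x) fun x _ => hζ.le x

lemma abs_kern_le (hr : Regime d φ β B z) {ζ : Pt d → ℝ} (hζ : IsActivity z ζ) {A : Finset (Pt d)}
    {S : Finset (Finset (Pt d))} {γ : Finset (Pt d)} (h : BlockSystem A S)
    (hγ : Disjoint γ (A ∪ pts S)) :
    |kern φ β ζ A S γ| ≤ (z * Real.exp (2 * β * B)) ^ (A.card + (pts S).card + γ.card) *
      forestNu φ β A (S ∪ singles γ) := by
  have h1 := abs_trunc_gibbs_le hr.pot hr.beta hr.stable A (S ∪ singles γ)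
    (h.union_singles (hγ.mono_right Finset.subset_union_left)
      (hγ.mono_right Finset.subset_union_right))
  rw [numPts_union_singles] at h1
  rw [kern, abs_mul, abs_of_nonneg (hζ.prod_nonneg _), mul_pow, mul_assoc, ← h.card_union hγ]
  exact mul_le_mul (hζ.prod_le _) h1 (abs_nonneg _) (pow_nonneg hr.pos.le _)

lemma pow_le_factorial_mul_exp (x : ℝ) (hx : 0 ≤ x) (k : ℕ) :
    x ^ k ≤ k.factorial * Real.exp x := by
  have h := Real.pow_div_factorial_le_exp x hx k
  rwa [div_le_iff₀ (by positivity), mul_comm] at h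

/-- Both N^n ≤ n! e^N and N^{|S|} ≤ |S|! e^N are used, which produces e^{2N} and hence the constant
e² in the smallness condition. The bound is valid without any blocks and is exponential in |A|, as
the growth class requires. -/
lemma lintegral_forestNu_le_crude (hd : 1 ≤ d) (hφ : AssumptionA d φ) (hβ : 0 < β) (n : ℕ)
    (A : Finset (Pt d)) (S : Finset (Finset (Pt d))) (h : BlockSystem A S) :
    ∫⁻ y : Fin n → Pt d, ENNReal.ofReal (forestNu φ β A (S ∪ singles (Finset.univ.image y))) ≤
      ENNReal.ofReal (nu1 d φ β ^ n * (2 * nu0Tilde d φ β) ^ (pts S).card *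
        (n.factorial * S.card.factorial *
          Real.exp 2 ^ (A.card + (pts S).card + n))) := by
  have hn1 : 0 < nu1 d φ β := nu1_pos hφ hβ
  have hn0 := one_le_nu0Tilde (d := d) (φ := φ) (β := β)
  rcases Nat.eq_zero_or_pos (A.card + (pts S).card + n) with h0 | h0
  · have hn : n = 0 := by omega
    have hA : A = ∅ := Finset.card_eq_zero.1 (by omega)
    have hP : (pts S).card = 0 := by omega
    have hS : S = ∅ := by
      by_contra hS
      obtain ⟨B, hB⟩ := Finset.nonempty_iff_ne_empty.2 hS
      obtain ⟨y, hy⟩ := h.nonempty B hB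
      have := Finset.card_pos.2 ⟨y, mem_pts.2 ⟨B, hB, hy⟩⟩
      omega
    subst hn hA hS
    simp [forestNu_clusterRec.base, singles, volume_pi]
  · refine (lintegral_forestNu_le hd hφ hβ n A S h _ rfl h0).trans (ENNReal.ofReal_le_ofReal ?_)
    set N := A.card + (pts S).card + n with hN
    have hNr : (0 : ℝ) < N := by exact_mod_cast h0
    have hAN : (A.card : ℝ) ≤ N := by exact_mod_cast (by omega : A.card ≤ N)
    refine mul_le_mul_of_nonneg_left ?_ (by positivity)
    calc (A.card : ℝ) * (N : ℝ) ^ (S.card + n) / N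
        ≤ N * (N : ℝ) ^ (S.card + n) / N := by gcongr
      _ = (N : ℝ) ^ n * (N : ℝ) ^ S.card := by rw [pow_add]; field_simp
      _ ≤ (n.factorial * Real.exp N) * (S.card.factorial * Real.exp N) :=
          mul_le_mul (pow_le_factorial_mul_exp _ hNr.le _) (pow_le_factorial_mul_exp _ hNr.le _)
            (by positivity) (by positivity)
      _ = _ := by
          have : Real.exp 2 ^ N = Real.exp N * Real.exp N := by
            rw [← Real.exp_add, ← Real.exp_nat_mul]; ring_nf
          rw [this]; ring

/-- The constant in the growth bound of the integrated kernels. -/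
noncomputable def growthConst (φ : ℝ → EReal) (β B z : ℝ) (S : Finset (Finset (Pt d))) : ℝ :=
  (2 * nu0Tilde d φ β) ^ (pts S).card * S.card.factorial *
    (z * Real.exp (2 * β * B + 2)) ^ (pts S).card *
    (1 - z * Real.exp (2 * β * B + 2) * nu1 d φ β)⁻¹

lemma growthConst_nonneg (hr : Regime d φ β B z) (S : Finset (Finset (Pt d))) :
    0 ≤ growthConst φ β B z S := by
  have hn0 := one_le_nu0Tilde (d := d) (φ := φ) (β := β)
  have := hr.pos
  have : 0 < 1 - z * Real.exp (2 * β * B + 2) * nu1 d φ β := by linarith [hr.small]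
  unfold growthConst
  positivity

/-- Summation over the number of one-point blocks. -/
lemma lintegral_lp_forestNu_le_of (hr : Regime d φ β B z) {A : Finset (Pt d)}
    {S : Finset (Finset (Pt d))} {c : ℝ} (hc : 0 ≤ c)
    (h : ∀ n : ℕ, ∫⁻ y : Fin n → Pt d,
      ENNReal.ofReal (forestNu φ β A (S ∪ singles (Finset.univ.image y))) ≤
        ENNReal.ofReal (n.factorial * c * (Real.exp 2 * nu1 d φ β) ^ n)) :
    ∫⁻ τ, ENNReal.ofReal ((z * Real.exp (2 * β * B)) ^ (A.card + (pts S).card + (conf τ).card) *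
        forestNu φ β A (S ∪ singles (conf τ))) ∂(lpMeasure d) ≤
      ENNReal.ofReal ((z * Real.exp (2 * β * B)) ^ (A.card + (pts S).card) * c *
        (1 - z * Real.exp (2 * β * B + 2) * nu1 d φ β)⁻¹) := by
  have hn1 : 0 < nu1 d φ β := nu1_pos hr.pot hr.beta
  have hz := hr.pos
  set w := z * Real.exp (2 * β * B) with hw
  set v := z * Real.exp (2 * β * B + 2) with hv
  have hwv : w * Real.exp 2 = v := by rw [hw, hv, Real.exp_add]; ring
  have hwpos : 0 < w := by positivity
  have hq : 0 ≤ v * nu1 d φ β := by positivity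
  have hq1 : v * nu1 d φ β < 1 := hr.small
  set l := A.card + (pts S).card
  have hterm : ∀ n : ℕ, ENNReal.ofReal (1 / (n.factorial : ℝ)) * ∫⁻ x : Fin n → Pt d,
      ENNReal.ofReal (w ^ (l + (conf ⟨n, x⟩).card) *
        forestNu φ β A (S ∪ singles (conf ⟨n, x⟩))) ≤
      ENNReal.ofReal (w ^ l * c * (v * nu1 d φ β) ^ n) := by
    intro n
    have h1 : ∫⁻ x : Fin n → Pt d, ENNReal.ofReal (w ^ (l + (conf ⟨n, x⟩).card) *
        forestNu φ β A (S ∪ singles (conf ⟨n, x⟩))) =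
        ENNReal.ofReal (w ^ (l + n)) * ∫⁻ x : Fin n → Pt d,
          ENNReal.ofReal (forestNu φ β A (S ∪ singles (Finset.univ.image x))) := by
      rw [← lintegral_const_mul' _ _ ENNReal.ofReal_ne_top]
      refine lintegral_congr_ae ?_
      filter_upwards [ae_isGeneric hr.dim ∅] with x hx
      rw [conf, Finset.card_image_of_injective _ hx.1, Finset.card_univ, Fintype.card_fin,
        ← ENNReal.ofReal_mul (by positivity)]
    rw [h1]
    refine (mul_le_mul_right (mul_le_mul_right (h n) _) _).trans ?_
    rw [← ENNReal.ofReal_mul (by positivity), ← ENNReal.ofReal_mul (by positivity)]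
    refine ENNReal.ofReal_le_ofReal (le_of_eq ?_)
    rw [← hwv]
    have := Nat.factorial_pos n
    field_simp
    ring
  rw [lintegral_lp]
  refine (ENNReal.tsum_le_tsum hterm).trans ?_
  rw [← ENNReal.ofReal_tsum_of_nonneg (fun n => by positivity)
    ((summable_geometric_of_lt_one hq hq1).mul_left _), tsum_mul_left,
    tsum_geometric_of_lt_one hq hq1]

lemma lintegral_lp_forestNu_le (hr : Regime d φ β B z) {A : Finset (Pt d)}
    {S : Finset (Finset (Pt d))} (h : BlockSystem A S) :
    ∫⁻ τ, ENNReal.ofReal ((z * Real.exp (2 * β * B)) ^ (A.card + (pts S).card + (conf τ).card) *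
        forestNu φ β A (S ∪ singles (conf τ))) ∂(lpMeasure d) ≤
      ENNReal.ofReal (growthConst φ β B z S * (nu1 d φ β)⁻¹ ^ A.card) := by
  have hn1 : 0 < nu1 d φ β := nu1_pos hr.pot hr.beta
  have hn0 := one_le_nu0Tilde (d := d) (φ := φ) (β := β)
  have hz := hr.pos
  refine (lintegral_lp_forestNu_le_of hr (c := (2 * nu0Tilde d φ β) ^ (pts S).card *
    S.card.factorial * Real.exp 2 ^ (A.card + (pts S).card)) (by positivity) fun n =>
    (lintegral_forestNu_le_crude hr.dim hr.pot hr.beta n A S h).trans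
      (ENNReal.ofReal_le_ofReal (le_of_eq (by ring)))).trans (ENNReal.ofReal_le_ofReal ?_)
  set v := z * Real.exp (2 * β * B + 2) with hv
  have hwv : z * Real.exp (2 * β * B) * Real.exp 2 = v := by rw [hv, Real.exp_add]; ring
  have hvpos : 0 < v := by positivity
  have hinv : 0 < (1 - v * nu1 d φ β)⁻¹ := inv_pos.2 (by linarith [hr.small])
  -- The smallness condition is used a second time: besides summing the series, it turns v^{|A|}
  -- into the growth ν₁^{-|A|} of the solution class.
  have hvl : v ≤ (nu1 d φ β)⁻¹ := by
    rw [le_inv_comm₀ hvpos hn1, ← one_div, le_div_iff₀ hvpos]; linarith [hr.small]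
  have hpow : v ^ A.card ≤ (nu1 d φ β)⁻¹ ^ A.card := pow_le_pow_left₀ hvpos.le hvl _
  unfold growthConst
  rw [← hv]
  set P := (pts S).card
  calc _ = (2 * nu0Tilde d φ β) ^ P * S.card.factorial * v ^ P * (1 - v * nu1 d φ β)⁻¹ *
        v ^ A.card := by rw [← hwv]; ring
    _ ≤ _ := mul_le_mul_of_nonneg_left hpow (by positivity)

/-- With |S| = k + 1 the power is N^k N^n, where N = l + n. Here N^n ≤ n! e^{l+n}, while N^k = l^k
(1 + n/l)^k ≤ l^k e^n because k ≤ l. The factor |A| is absorbed into 2^{|A|}, and the polynomial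
dependence on l survives. -/
lemma lintegral_forestNu_le_sharp (hd : 1 ≤ d) (hφ : AssumptionA d φ) (hβ : 0 < β) (n : ℕ)
    (A : Finset (Pt d)) (S : Finset (Finset (Pt d))) (h : BlockSystem A S) (hS : S.Nonempty) :
    ∫⁻ y : Fin n → Pt d, ENNReal.ofReal (forestNu φ β A (S ∪ singles (Finset.univ.image y))) ≤
      ENNReal.ofReal (n.factorial * ((2 * Real.exp 1) ^ (A.card + (pts S).card) *
        nu0Tilde d φ β ^ (pts S).card * ((A.card + (pts S).card : ℕ) : ℝ) ^ (S.card - 1)) *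
          (Real.exp 2 * nu1 d φ β) ^ n) := by
  have hn1 : 0 < nu1 d φ β := nu1_pos hφ hβ
  have hn0 := one_le_nu0Tilde (d := d) (φ := φ) (β := β)
  have hcard : S.card ≤ (pts S).card := by
    rw [card_pts h le_rfl, Finset.card_eq_sum_ones]
    exact Finset.sum_le_sum fun B hB => Finset.card_pos.2 (h.nonempty B hB)
  have hSpos := Finset.card_pos.2 hS
  refine (lintegral_forestNu_le hd hφ hβ n A S h _ rfl (by omega)).trans
    (ENNReal.ofReal_le_ofReal ?_)
  obtain ⟨k, hk⟩ : ∃ k, S.card = k + 1 := ⟨S.card - 1, by omega⟩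
  rw [hk, Nat.add_sub_cancel]
  set P := (pts S).card
  set l := A.card + P with hl
  have hlpos : (0 : ℝ) < l := by exact_mod_cast (by omega : 0 < l)
  have hkl : (k : ℝ) ≤ l := by exact_mod_cast (by omega : k ≤ l)
  have hN : (0 : ℝ) < (l + n : ℕ) := by exact_mod_cast (by omega : 0 < l + n)
  have h1 : (A.card : ℝ) ≤ 2 ^ A.card := by exact_mod_cast Nat.lt_two_pow_self.le
  have h2 : ((l + n : ℕ) : ℝ) ^ n ≤ n.factorial * Real.exp (l + n : ℕ) :=
    pow_le_factorial_mul_exp _ hN.le n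
  have h3 : ((l + n : ℕ) : ℝ) ^ k ≤ (l : ℝ) ^ k * Real.exp n := by
    have e1 : ((l + n : ℕ) : ℝ) = l * (1 + n / l) := by push_cast; field_simp
    rw [e1, mul_pow]
    refine mul_le_mul_of_nonneg_left ?_ (by positivity)
    calc (1 + (n : ℝ) / l) ^ k ≤ Real.exp (n / l) ^ k := by
          refine pow_le_pow_left₀ (by positivity) ?_ k
          rw [add_comm]; exact Real.add_one_le_exp _
      _ = Real.exp (k * (n / l)) := by rw [Real.exp_nat_mul]
      _ ≤ Real.exp n := by
          apply Real.exp_le_exp.2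
          rw [mul_div_assoc', div_le_iff₀ hlpos, mul_comm]
          exact mul_le_mul_of_nonneg_left hkl (Nat.cast_nonneg n)
  calc nu1 d φ β ^ n * (2 * nu0Tilde d φ β) ^ P *
        (A.card * ((l + n : ℕ) : ℝ) ^ (k + 1 + n) / (l + n : ℕ))
      = nu1 d φ β ^ n * (2 * nu0Tilde d φ β) ^ P *
        (A.card * (((l + n : ℕ) : ℝ) ^ k * ((l + n : ℕ) : ℝ) ^ n)) := by
        rw [pow_add, pow_succ]; field_simp
    _ ≤ nu1 d φ β ^ n * (2 * nu0Tilde d φ β) ^ P * (2 ^ A.card *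
        (((l : ℝ) ^ k * Real.exp n) * (n.factorial * Real.exp (l + n : ℕ)))) := by gcongr
    _ = _ := by
        have e1 : Real.exp (l + n : ℕ) = Real.exp 1 ^ l * Real.exp n := by
          rw [← Real.exp_nat_mul, ← Real.exp_add]; push_cast; ring_nf
        have e2 : Real.exp 2 ^ n = Real.exp n * Real.exp n := by
          rw [← Real.exp_nat_mul, ← Real.exp_add]; ring_nf
        have e3 : (2 : ℝ) ^ l = 2 ^ A.card * 2 ^ P := by rw [hl, pow_add]
        rw [e1, mul_pow (Real.exp 2), e2, mul_pow 2 (Real.exp 1), e3, mul_pow]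
        ring

lemma measurable_bond_sub_one (hr : Regime d φ β B z) :
    Measurable fun q : Pt d × Pt d => bond φ β q.1 q.2 - 1 :=
  (measurable_bond hr.pot hr.beta).sub measurable_const

lemma aemeasurable_prod_union {κ : Type*} [Fintype κ] (hd : 1 ≤ d) {ζ : Pt d → ℝ}
    (hζ : Measurable ζ) (X : Finset (Pt d)) (s : Finset κ) :
    AEMeasurable (fun x : κ → Pt d => ∏ y ∈ X ∪ s.image x, ζ y) volume := by
  refine ((aemeasurable_prod_image hd ζ hζ s).const_mul (∏ y ∈ X, ζ y)).congr ?_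
  filter_upwards [ae_isGeneric hd X] with x hx
  rw [Finset.prod_union (hx.disjoint_image s).symm]

/-- Both factors are measurable: the activities as a product over generic points, the truncation
through its recursion at arbitrary points. -/
lemma jointMeas_kern (hr : Regime d φ β B z) {ζ : Pt d → ℝ} (hζ : IsActivity z ζ)
    {A : Finset (Pt d)} {S : Finset (Finset (Pt d))} (h : BlockSystem A S) :
    JointMeas fun ξ γ => kern φ β ζ (A ∪ ξ) S γ := by
  refine JointMeas.mul (fun κ _ s t _ => ?_) ((gibbs_clusterRec hr.pot hr.beta).jointMeas hr.dim
    (measurable_bond hr.pot hr.beta) (measurable_bond_sub_one hr) h)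
  refine (aemeasurable_prod_union hr.dim hζ.meas (A ∪ pts S) (s ∪ t)).congr
    (Eventually.of_forall fun x => ?_)
  simp only
  congr 1
  rw [Finset.image_union]
  ext y; simp only [Finset.mem_union]; tauto

lemma JointMeas.aemeasurable_right {E : Type*} [MeasurableSpace E]
    {g : Finset (Pt d) → Finset (Pt d) → E} (hg : JointMeas g) (n : ℕ) :
    AEMeasurable (fun x : Fin n → Pt d => g ∅ (Finset.univ.image x)) volume := by
  simpa using hg (Fin n) ∅ Finset.univ (Finset.disjoint_empty_left _)

lemma JointMeas.aemeasurable_left {E : Type*} [MeasurableSpace E]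
    {g : Finset (Pt d) → Finset (Pt d) → E} (hg : JointMeas g) (n : ℕ) :
    AEMeasurable (fun x : Fin n → Pt d => g (Finset.univ.image x) ∅) volume := by
  simpa using hg (Fin n) Finset.univ ∅ (Finset.disjoint_empty_right _)

lemma lintegral_abs_kern_le (hr : Regime d φ β B z) {ζ : Pt d → ℝ} (hζ : IsActivity z ζ)
    {A : Finset (Pt d)} {S : Finset (Finset (Pt d))} (h : BlockSystem A S) :
    ∫⁻ τ, ENNReal.ofReal |kern φ β ζ A S (conf τ)| ∂(lpMeasure d) ≤
      ENNReal.ofReal (growthConst φ β B z S * (nu1 d φ β)⁻¹ ^ A.card) := by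
  refine le_trans (lintegral_mono_ae ?_) (lintegral_lp_forestNu_le hr h)
  filter_upwards [ae_conf_disjoint hr.dim (A ∪ pts S)] with τ hτ
  exact ENNReal.ofReal_le_ofReal (abs_kern_le hr hζ h hτ)

lemma integrable_kern (hr : Regime d φ β B z) {ζ : Pt d → ℝ} (hζ : IsActivity z ζ)
    {A : Finset (Pt d)} {S : Finset (Finset (Pt d))} (h : BlockSystem A S) :
    Integrable (fun τ => kern φ β ζ A S (conf τ)) (lpMeasure d) := by
  refine ⟨aestronglyMeasurable_lp.2 fun n => ?_, ?_⟩
  · have := (jointMeas_kern hr hζ h).aemeasurable_right n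
    simp only [Finset.union_empty] at this
    exact this.aestronglyMeasurable
  · rw [hasFiniteIntegral_iff_norm]
    simp only [Real.norm_eq_abs]
    exact (lintegral_abs_kern_le hr hζ h).trans_lt ENNReal.ofReal_lt_top

lemma lpIntegrable_kern (hr : Regime d φ β B z) {ζ : Pt d → ℝ} (hζ : IsActivity z ζ)
    {A : Finset (Pt d)} {S : Finset (Finset (Pt d))} (h : BlockSystem A S) :
    LPIntegrable (kern φ β ζ A S) := integrable_lp_iff.1 (integrable_kern hr hζ h)

lemma abs_integral_le_of_lintegral_le {α : Type*} [MeasurableSpace α] {μ : Measure α} {f : α → ℝ}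
    {c : ℝ} (hc : 0 ≤ c) (h : ∫⁻ a, ENNReal.ofReal |f a| ∂μ ≤ ENNReal.ofReal c) :
    |∫ a, f a ∂μ| ≤ c := by
  have h1 := norm_integral_le_lintegral_norm (μ := μ) f
  simp only [Real.norm_eq_abs] at h1
  exact h1.trans (ENNReal.toReal_le_of_le_ofReal hc h)

/-- The integrated kernel. -/
noncomputable def kernInt (φ : ℝ → EReal) (β : ℝ) (ζ : Pt d → ℝ) (A : Finset (Pt d))
    (S : Finset (Finset (Pt d))) : ℝ := lpIntegral 1 (kern φ β ζ A S)

lemma abs_kernInt_le (hr : Regime d φ β B z) {ζ : Pt d → ℝ} (hζ : IsActivity z ζ)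
    {A : Finset (Pt d)} {S : Finset (Finset (Pt d))} (h : BlockSystem A S) :
    |kernInt φ β ζ A S| ≤ growthConst φ β B z S * (nu1 d φ β)⁻¹ ^ A.card := by
  rw [kernInt, integral_lp (lpIntegrable_kern hr hζ h)]
  have := nu1_pos hr.pot hr.beta
  exact abs_integral_le_of_lintegral_le (mul_nonneg (growthConst_nonneg hr S) (by positivity))
    (lintegral_abs_kern_le hr hζ h)

end KernelBounds

end PTCF

namespace PTCF

/-! ### The integral operator, and the system for the integrated kernels. -/

section KirkwoodSalsburg

variable {d : ℕ} {φ : ℝ → EReal} {β B z : ℝ}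

/-- Integration over pairs (subset, complement), in terms of `lpIntegral`. -/
lemma lpIntegral_powerset (hd : 1 ≤ d) {g : Finset (Pt d) → Finset (Pt d) → ℝ}
    (hg : JointMeas g)
    (hfin : ∫⁻ τ, ∫⁻ τ', ENNReal.ofReal |g (conf τ) (conf τ')| ∂(lpMeasure d) ∂(lpMeasure d) < ⊤) :
    LPIntegrable (fun γ => ∑ ξ ∈ γ.powerset, g ξ (γ \ ξ)) ∧
      lpIntegral 1 (fun γ => ∑ ξ ∈ γ.powerset, g ξ (γ \ ξ)) =
        lpIntegral 1 fun ξ => lpIntegral 1 (g ξ) := by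
  have h1 : LPIntegrable (fun γ => ∑ ξ ∈ γ.powerset, g ξ (γ \ ξ)) :=
    integrable_lp_iff.1 (integrable_lp_powerset hd hg hfin)
  have hprod := integrable_lp_prod hg hfin
  have hae : ∀ᵐ τ ∂(lpMeasure d), ∫ τ', g (conf τ) (conf τ') ∂(lpMeasure d) =
      lpIntegral 1 (g (conf τ)) := by
    filter_upwards [hprod.prod_right_ae] with τ hτ
    exact (integral_lp (integrable_lp_iff.1 hτ)).symm
  have h2 : LPIntegrable (fun ξ => lpIntegral 1 (g ξ)) :=
    integrable_lp_iff.1 (hprod.integral_prod_left.congr hae)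
  refine ⟨h1, ?_⟩
  rw [integral_lp h1, integral_lp h2, integral_lp_powerset hd hg hfin]
  exact integral_congr_ae hae

lemma abs_kerK (x : Pt d) (ξ : Finset (Pt d)) :
    |kerK φ β x ξ| = ∏ y ∈ ξ, nu d φ β (x - y) := by
  rw [kerK, Finset.abs_prod]
  exact Finset.prod_congr rfl fun y _ => abs_mayer_dist x y

lemma kerK_union (x : Pt d) {ξ γ : Finset (Pt d)} (h : Disjoint ξ γ) :
    kerK φ β x (ξ ∪ γ) = kerK φ β x ξ * kerK φ β x γ := Finset.prod_union h

/-- The integral over n points of a product is the nth power of one integral, and division by n!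
yields the exponential series. -/
lemma lintegral_lp_prod (hd : 1 ≤ d) {f : Pt d → ℝ} (hf : Integrable f) (h0 : ∀ x, 0 ≤ f x) :
    ∫⁻ τ, ENNReal.ofReal (∏ y ∈ conf τ, f y) ∂(lpMeasure d) =
      ENNReal.ofReal (Real.exp (∫ x, f x)) := by
  have hI : 0 ≤ ∫ x, f x := integral_nonneg h0
  rw [lintegral_lp]
  have hterm : ∀ n : ℕ, ENNReal.ofReal (1 / (n.factorial : ℝ)) * ∫⁻ u : Fin n → Pt d,
      ENNReal.ofReal (∏ y ∈ conf ⟨n, u⟩, f y) =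
      ENNReal.ofReal ((∫ x, f x) ^ n / n.factorial) := by
    intro n
    have h1 : ∫⁻ u : Fin n → Pt d, ENNReal.ofReal (∏ y ∈ conf ⟨n, u⟩, f y) =
        ∫⁻ u : Fin n → Pt d, ENNReal.ofReal (∏ i, f (u i)) := by
      refine lintegral_congr_ae ?_
      filter_upwards [ae_isGeneric hd ∅] with u hu
      rw [conf, Finset.prod_image fun a _ b _ e => hu.1 e]
    have hp : Integrable fun u : Fin n → Pt d => ∏ i, f (u i) :=
      Integrable.fintype_prod (f := fun _ y => f y) fun _ => hf
    rw [h1, ← ofReal_integral_eq_lintegral_ofReal hp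
      (Eventually.of_forall fun u => Finset.prod_nonneg fun i _ => h0 _),
      integral_fintype_prod_volume_eq_pow f, Fintype.card_fin,
      ← ENNReal.ofReal_mul (by positivity), one_div_mul_eq_div]
  rw [tsum_congr hterm, ← ENNReal.ofReal_tsum_of_nonneg (fun n => by positivity)
    (Real.summable_pow_div_factorial _), Real.exp_eq_exp_ℝ, NormedSpace.exp_eq_tsum_div]

/-- The weight ν₁^{-|γ|} normalizes the integral of ν to one, so the exponential formula gives
exactly e. This is the origin of the extra 1 in e^{2βB+1}. -/
lemma lintegral_lp_kerK (hr : Regime d φ β B z) (x : Pt d) :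
    ∫⁻ τ, ENNReal.ofReal (|kerK φ β x (conf τ)| * (nu1 d φ β)⁻¹ ^ (conf τ).card) ∂(lpMeasure d) =
      ENNReal.ofReal (Real.exp 1) := by
  have hn1 : 0 < nu1 d φ β := nu1_pos hr.pot hr.beta
  have hi : Integrable (fun y => nu d φ β (x - y)) := (integrable_nu hr.pot hr.beta).comp_sub_left x
  have h := lintegral_lp_prod hr.dim (hi.mul_const (nu1 d φ β)⁻¹)
    fun y => mul_nonneg (nu_nonneg _) (inv_nonneg.2 hn1.le)
  rw [integral_mul_const, integral_sub_left_eq_self (fun y => nu d φ β y) volume x] at h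
  change _ = ENNReal.ofReal (Real.exp (nu1 d φ β * (nu1 d φ β)⁻¹)) at h
  rw [mul_inv_cancel₀ hn1.ne'] at h
  rw [← h]
  refine lintegral_congr fun τ => ?_
  rw [abs_kerK, Finset.prod_mul_distrib, Finset.prod_const]

lemma measurable_mayer_dist (hr : Regime d φ β B z) (x : Pt d) :
    Measurable fun y => mayer φ β (dist x y) := by
  have hp : Measurable (Prod.mk x : Pt d → Pt d × Pt d) := measurable_prodMk_left
  have h := (measurable_bond_sub_one hr).comp hp
  simp only [Function.comp_def] at h
  simpa only [mayer_dist] using h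

lemma jointMeas_kerK (hr : Regime d φ β B z) (x : Pt d) :
    JointMeas fun ξ (_ : Finset (Pt d)) => kerK φ β x ξ :=
  JointMeas.of_prod hr.dim (measurable_mayer_dist hr x)

lemma lintegral_lp_kerK_mul_le (hr : Regime d φ β B z) (x : Pt d) {f : Finset (Pt d) → ENNReal}
    {M : ℝ} (hM : 0 ≤ M)
    (hf : ∀ᵐ τ ∂(lpMeasure d), f (conf τ) ≤ ENNReal.ofReal (M * (nu1 d φ β)⁻¹ ^ (conf τ).card)) :
    ∫⁻ τ, ENNReal.ofReal |kerK φ β x (conf τ)| * f (conf τ) ∂(lpMeasure d) ≤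
      ENNReal.ofReal (M * Real.exp 1) := by
  rw [ENNReal.ofReal_mul hM, ← lintegral_lp_kerK hr x,
    ← lintegral_const_mul' _ _ ENNReal.ofReal_ne_top]
  refine lintegral_mono_ae ?_
  filter_upwards [hf] with τ hτ
  refine (mul_le_mul_right hτ _).trans (le_of_eq ?_)
  rw [ENNReal.ofReal_mul hM, ENNReal.ofReal_mul (abs_nonneg _), mul_left_comm]

/-- The integral operator of the system is bounded on functions of growth `ν₁^{-|γ|}`. -/
lemma lpIntegrable_kerK_mul (hr : Regime d φ β B z) (x : Pt d) {f : Finset (Pt d) → ℝ} {M : ℝ}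
    (hM : 0 ≤ M)
    (hm : ∀ n, AEStronglyMeasurable (fun u : Fin n → Pt d => f (Finset.univ.image u)) volume)
    (hf : ∀ᵐ τ ∂(lpMeasure d), |f (conf τ)| ≤ M * (nu1 d φ β)⁻¹ ^ (conf τ).card) :
    LPIntegrable (fun γ => kerK φ β x γ * f γ) ∧
      |lpIntegral 1 fun γ => kerK φ β x γ * f γ| ≤ M * Real.exp 1 := by
  have hb : ∫⁻ τ, ENNReal.ofReal |kerK φ β x (conf τ) * f (conf τ)| ∂(lpMeasure d) ≤
      ENNReal.ofReal (M * Real.exp 1) := by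
    simp_rw [abs_mul, ENNReal.ofReal_mul (abs_nonneg (kerK φ β x _))]
    refine lintegral_lp_kerK_mul_le hr x (f := fun γ => ENNReal.ofReal |f γ|) hM ?_
    filter_upwards [hf] with τ hτ
    exact ENNReal.ofReal_le_ofReal hτ
  have hi : Integrable (fun τ => kerK φ β x (conf τ) * f (conf τ)) (lpMeasure d) := by
    refine ⟨aestronglyMeasurable_lp.2 fun n => ?_, ?_⟩
    · exact ((jointMeas_kerK hr x).aemeasurable_left n).aestronglyMeasurable.mul (hm n)
    · rw [hasFiniteIntegral_iff_norm]
      simp only [Real.norm_eq_abs]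
      exact hb.trans_lt ENNReal.ofReal_lt_top
  have hi' := integrable_lp_iff (F := fun γ => kerK φ β x γ * f γ).1 hi
  refine ⟨hi', ?_⟩
  rw [integral_lp hi']
  exact abs_integral_le_of_lintegral_le (by positivity) hb

/-- The Kirkwood–Salsburg-type system, for functions of a root and a set of blocks, together with
the regularity of its solutions. -/
structure IsBlockKS (φ : ℝ → EReal) (β : ℝ) (ζ : Pt d → ℝ)
    (R : Finset (Pt d) → Finset (Finset (Pt d)) → ℝ) : Prop where
  base : ∀ S, R ∅ S = if S = ∅ then 1 else 0
  step : ∀ A S, BlockSystem A S → ∀ x ∈ A,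
    R A S = (ζ x * ∏ y ∈ A.erase x, bond φ β x y) *
      ∑ U ∈ S.powerset, (∏ C ∈ U, absorbWeight (fun x y => bond φ β x y - 1) x C) *
        lpIntegral 1 fun γ => kerK φ β x γ * R (A.erase x ∪ pts U ∪ γ) (S \ U)
  meas : ∀ A S, BlockSystem A S → ∀ n, AEStronglyMeasurable
    (fun x : Fin n → Pt d => R (A ∪ Finset.univ.image x) S) volume
  bound : ∀ S, ∃ C, ∀ A, BlockSystem A S → |R A S| ≤ C * (nu1 d φ β)⁻¹ ^ A.card

/-- The activity of the removed point is split off; the remaining activities run over the same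
points for every choice of U and ξ, and so they join each smaller kernel. -/
lemma kern_step (hr : Regime d φ β B z) (ζ : Pt d → ℝ) {A : Finset (Pt d)}
    {S : Finset (Finset (Pt d))} {γ : Finset (Pt d)} (h : BlockSystem A S)
    (hγ : Disjoint γ (A ∪ pts S)) {x : Pt d} (hx : x ∈ A) :
    kern φ β ζ A S γ = (ζ x * ∏ y ∈ A.erase x, bond φ β x y) *
      ∑ U ∈ S.powerset, (∏ C ∈ U, absorbWeight (fun x y => bond φ β x y - 1) x C) *
        ∑ ξ ∈ γ.powerset, kerK φ β x ξ * kern φ β ζ (A.erase x ∪ pts U ∪ ξ) (S \ U) (γ \ ξ) := by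
  rw [kern, (gibbs_clusterRec hr.pot hr.beta).step_singles h
    (hγ.mono_right Finset.subset_union_left) (hγ.mono_right Finset.subset_union_right) hx trivial,
    Finset.sum_comm, Finset.mul_sum, Finset.mul_sum, Finset.mul_sum]
  refine Finset.sum_congr rfl fun U hU => ?_
  have hU := Finset.mem_powerset.1 hU
  rw [Finset.mul_sum, Finset.mul_sum, Finset.mul_sum, Finset.mul_sum]
  refine Finset.sum_congr rfl fun ξ hξ => ?_
  have hξ := Finset.mem_powerset.1 hξ
  have hxS : x ∉ pts S := Finset.disjoint_left.1 h.disjoint_pts hx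
  have hxγ : x ∉ γ := fun h' => Finset.disjoint_left.1 hγ h' (Finset.mem_union_left _ hx)
  have hset : A ∪ pts S ∪ γ = insert x (A.erase x ∪ pts U ∪ ξ ∪ pts (S \ U) ∪ γ \ ξ) := by
    rw [← pts_union_pts_sdiff hU, ← Finset.union_sdiff_of_subset hξ]
    nth_rw 1 [← Finset.insert_erase hx]
    ext y; simp only [Finset.mem_union, Finset.mem_insert, Finset.mem_sdiff]; tauto
  have hxn : x ∉ A.erase x ∪ pts U ∪ ξ ∪ pts (S \ U) ∪ γ \ ξ := by
    have h1 : x ∉ pts U := fun h' =>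
      hxS (Finset.biUnion_subset_biUnion_of_subset_left id hU h')
    have h2 : x ∉ pts (S \ U) := fun h' =>
      hxS (Finset.biUnion_subset_biUnion_of_subset_left id Finset.sdiff_subset h')
    have h3 : x ∉ ξ := fun h' => hxγ (hξ h')
    simp only [Finset.mem_union, Finset.mem_erase, Finset.mem_sdiff]
    tauto
  rw [hset, Finset.prod_insert hxn, kern, kerK_eq]
  ring

lemma lpIntegral_indicator_empty :
    lpIntegral (d := d) 1 (fun γ => if γ = ∅ then 1 else 0) = 1 := by
  rw [lpIntegral, tsum_eq_single 0]
  · simp [volume_pi, Measure.real]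
  · intro n hn
    have : ∀ x : Fin n → Pt d, ¬ (Finset.univ.image x = ∅) := fun x => by
      rw [Finset.image_eq_empty, Finset.univ_eq_empty_iff, not_isEmpty_iff]
      exact ⟨⟨0, Nat.pos_of_ne_zero hn⟩⟩
    simp [this]

lemma kernInt_empty (ζ : Pt d → ℝ) (S : Finset (Finset (Pt d))) :
    kernInt φ β ζ ∅ S = if S = ∅ then 1 else 0 := by
  have h : ∀ γ : Finset (Pt d), kern φ β ζ ∅ S γ = if S = ∅ then (if γ = ∅ then 1 else 0) else 0 := by
    intro γ
    rw [kern, trunc_empty_left _ (gibbs_empty β)]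
    simp only [Finset.union_eq_empty, singles, Finset.image_eq_empty]
    by_cases hS : S = ∅
    · subst hS
      by_cases hγ : γ = ∅
      · subst hγ; simp
      · simp [hγ]
    · simp [hS]
  unfold kernInt
  rw [funext h]
  by_cases hS : S = ∅
  · simp only [hS, if_true, lpIntegral_indicator_empty]
  · simp [hS, lpIntegral]

lemma BlockSystem.union_image {A : Finset (Pt d)} {S : Finset (Finset (Pt d))}
    (h : BlockSystem A S) {ξ : Finset (Pt d)} (hξ : Disjoint ξ (A ∪ pts S)) :
    BlockSystem (A ∪ ξ) S := by
  have := h.absorb_singles (A' := A) (U := ∅) (ξ := ξ) le_rfl (Finset.empty_subset _)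
    (hξ.mono_right Finset.subset_union_right)
  simpa using this

/-- Integrating the kernel recursion over γ turns the sum over ξ ⊆ γ into a double integral. It
converges absolutely: the inner integral is of growth ν₁^{-|ξ|}, and K integrates such growth to a
factor e. -/
lemma isBlockKS_kernInt (hr : Regime d φ β B z) {ζ : Pt d → ℝ} (hζ : IsActivity z ζ) :
    IsBlockKS φ β ζ (kernInt φ β ζ) := by
  have hn1 : 0 < nu1 d φ β := nu1_pos hr.pot hr.beta
  refine ⟨kernInt_empty ζ, fun A S h x hx => ?_, fun A S h n => ?_,
    fun S => ⟨growthConst φ β B z S, fun A h => abs_kernInt_le hr hζ h⟩⟩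
  · let g : Finset (Finset (Pt d)) → Finset (Pt d) → Finset (Pt d) → ℝ := fun U ξ γ =>
      kerK φ β x ξ * kern φ β ζ (A.erase x ∪ pts U ∪ ξ) (S \ U) γ
    have hU' : ∀ U ∈ S.powerset, BlockSystem (A.erase x ∪ pts U) (S \ U) := fun U hU =>
      h.absorb (Finset.erase_subset _ _) (Finset.mem_powerset.1 hU)
    have hg : ∀ U ∈ S.powerset, JointMeas (g U) := fun U hU =>
      (jointMeas_kerK hr x).mul (jointMeas_kern hr hζ (hU' U hU))
    have hfin : ∀ U ∈ S.powerset, ∫⁻ τ, ∫⁻ τ', ENNReal.ofReal |g U (conf τ) (conf τ')|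
        ∂(lpMeasure d) ∂(lpMeasure d) < ⊤ := by
      intro U hU
      simp only [g, abs_mul, ENNReal.ofReal_mul (abs_nonneg (kerK φ β x _))]
      simp_rw [lintegral_const_mul' _ _ ENNReal.ofReal_ne_top]
      refine (lintegral_lp_kerK_mul_le hr x (M := growthConst φ β B z (S \ U) *
        (nu1 d φ β)⁻¹ ^ (A.erase x ∪ pts U).card) (f := fun ξ => ∫⁻ τ', ENNReal.ofReal
        |kern φ β ζ (A.erase x ∪ pts U ∪ ξ) (S \ U) (conf τ')| ∂(lpMeasure d))
        (mul_nonneg (growthConst_nonneg hr _) (by positivity)) ?_).trans_lt ENNReal.ofReal_lt_top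
      filter_upwards [ae_conf_disjoint hr.dim ((A.erase x ∪ pts U) ∪ pts (S \ U))] with τ hτ
      refine (lintegral_abs_kern_le hr hζ ((hU' U hU).union_image hτ)).trans (le_of_eq ?_)
      rw [Finset.card_union_of_disjoint (hτ.mono_right Finset.subset_union_left).symm, pow_add,
        mul_assoc]
    have hM := fun U hU => lpIntegral_powerset hr.dim (hg U hU) (hfin U hU)
    have hae : ∀ᵐ τ ∂(lpMeasure d), kern φ β ζ A S (conf τ) =
        (ζ x * ∏ y ∈ A.erase x, bond φ β x y) *
        ∑ U ∈ S.powerset, (∏ C ∈ U, absorbWeight (fun x y => bond φ β x y - 1) x C) *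
          ∑ ξ ∈ (conf τ).powerset, g U ξ (conf τ \ ξ) := by
      filter_upwards [ae_conf_disjoint hr.dim (A ∪ pts S)] with τ hτ
      exact kern_step hr ζ h hτ hx
    rw [kernInt, integral_lp (lpIntegrable_kern hr hζ h), integral_congr_ae hae,
      integral_const_mul, integral_finsetSum _ fun U hU =>
        (integrable_lp_iff.2 (hM U hU).1).const_mul _]
    congr 1
    refine Finset.sum_congr rfl fun U hU => ?_
    rw [integral_const_mul, ← integral_lp (hM U hU).1, (hM U hU).2]
    congr 2
    funext ξ
    simp only [g, lpIntegral, kernInt]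
    rw [← tsum_mul_left]
    refine tsum_congr fun n => ?_
    rw [integral_const_mul]
    ring
  · have h1 := (aestronglyMeasurable_lp_prod (jointMeas_kern hr hζ h)).integral_prod_right'
    have h2 := aestronglyMeasurable_lp.1 h1 n
    refine h2.congr ?_
    filter_upwards [ae_isGeneric hr.dim (A ∪ pts S)] with x hx
    rw [kernInt, integral_lp (lpIntegrable_kern hr hζ (h.union_image (hx.disjoint_image _)))]
    rfl

end KirkwoodSalsburg

end PTCF

namespace PTCF

/-! ### Correlation functions with cut-off and their truncation. -/

section Correlation

variable {d : ℕ} {φ : ℝ → EReal} {β B z : ℝ}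

/-- The weight of the configuration `A ∪ γ`. -/
noncomputable def weight (φ : ℝ → EReal) (β : ℝ) (ζ : Pt d → ℝ) (A γ : Finset (Pt d)) : ℝ :=
  (∏ x ∈ A ∪ γ, ζ x) * gibbs φ β (A ∪ γ)

/-- The unnormalized correlation function. -/
noncomputable def weightInt (φ : ℝ → EReal) (β : ℝ) (ζ : Pt d → ℝ) (A : Finset (Pt d)) : ℝ :=
  lpIntegral 1 (weight φ β ζ A)

/-- The bonds from x to γ expand as ∏ (1 + Mayer factor) over ξ ⊆ γ. The remaining weight depends
only on the union of its two arguments, so shifting ξ between them changes nothing. -/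
lemma weight_step (hr : Regime d φ β B z) (ζ : Pt d → ℝ) {A γ : Finset (Pt d)}
    (hγ : Disjoint γ A) {x : Pt d} (hx : x ∈ A) :
    weight φ β ζ A γ = (ζ x * ∏ y ∈ A.erase x, bond φ β x y) *
      ∑ ξ ∈ γ.powerset, kerK φ β x ξ * weight φ β ζ (A.erase x ∪ ξ) (γ \ ξ) := by
  have hxγ : x ∉ γ := fun h => Finset.disjoint_left.1 hγ h hx
  have hset : (A ∪ γ).erase x = A.erase x ∪ γ := by
    rw [Finset.erase_union_distrib, Finset.erase_eq_of_notMem hxγ]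
  have hxm : x ∈ A ∪ γ := Finset.mem_union_left _ hx
  have h1 : ∀ ξ ∈ γ.powerset, kerK φ β x ξ * weight φ β ζ (A.erase x ∪ ξ) (γ \ ξ) =
      kerK φ β x ξ * weight φ β ζ (A.erase x) γ := by
    intro ξ hξ
    rw [weight, weight, Finset.union_assoc, Finset.union_sdiff_of_subset (Finset.mem_powerset.1 hξ)]
  have h2 : ∑ ξ ∈ γ.powerset, kerK φ β x ξ = ∏ y ∈ γ, bond φ β x y := by
    simp only [kerK]
    rw [← Finset.prod_one_add]
    exact Finset.prod_congr rfl fun y _ => by rw [mayer_dist]; ring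
  rw [Finset.sum_congr rfl h1, ← Finset.sum_mul, h2, weight, weight,
    gibbs_erase hr.pot hr.beta _ x hxm, hset, Finset.prod_union
    ((hγ.mono_right (Finset.erase_subset _ _)).symm), ← Finset.mul_prod_erase _ _ hxm, hset]
  ring

/-- Without blocks the truncation is the Boltzmann factor itself, so its measurability is a case of
the one proved for the recursion. -/
lemma jointMeas_weight (hr : Regime d φ β B z) {ζ : Pt d → ℝ} (hζ : IsActivity z ζ)
    (A : Finset (Pt d)) : JointMeas fun ξ γ => weight φ β ζ (A ∪ ξ) γ := by
  intro κ _ s t hst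
  have hBS : BlockSystem A ∅ := ⟨by simp, by simp, by simp⟩
  have h1 := (gibbs_clusterRec hr.pot hr.beta).aemeasurable hr.dim
    (measurable_bond hr.pot hr.beta) (measurable_bond_sub_one hr) (s ∪ t) ∅ A ∅ hBS
    (Finset.disjoint_empty_right _)
  have h2 := aemeasurable_prod_union hr.dim hζ.meas A (s ∪ t)
  refine (h2.mul h1).congr (Eventually.of_forall fun x => ?_)
  simp [weight, singles, Finset.image_union, Finset.union_assoc]

variable {ζ : Pt d → ℝ}

/-- The constant in the bound of the correlation functions. -/
noncomputable def corrConst (β B : ℝ) (ζ : Pt d → ℝ) : ℝ :=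
  Real.exp (∫ x, ζ x * Real.exp (β * B))

/-- Stability gives e^{βB} per point. Points of A are bounded by z e^{βB} ≤ ν₁^{-1}; for the
integrated points the integrability of ζ, which a compactly supported cut-off provides, is
essential. -/
lemma lintegral_abs_weight_le (hr : Regime d φ β B z) (hζ : IsActivity z ζ) (hi : Integrable ζ)
    (A : Finset (Pt d)) :
    ∫⁻ τ, ENNReal.ofReal |weight φ β ζ A (conf τ)| ∂(lpMeasure d) ≤
      ENNReal.ofReal (corrConst β B ζ * (nu1 d φ β)⁻¹ ^ A.card) := by
  have hn1 : 0 < nu1 d φ β := nu1_pos hr.pot hr.beta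
  have hz := hr.pos
  have hzl : z * Real.exp (β * B) ≤ (nu1 d φ β)⁻¹ := by
    have h1 : Real.exp (β * B) ≤ Real.exp (2 * β * B + 2) := by
      apply Real.exp_le_exp.2
      nlinarith [mul_nonneg hr.beta.le hr.nonneg]
    have h2 : z * Real.exp (2 * β * B + 2) ≤ (nu1 d φ β)⁻¹ := by
      rw [le_inv_comm₀ (by positivity) hn1, ← one_div, le_div_iff₀ (by positivity)]
      linarith [hr.small]
    exact (mul_le_mul_of_nonneg_left h1 hz.le).trans h2
  rw [corrConst, mul_comm, ENNReal.ofReal_mul (by positivity), ← lintegral_lp_prod hr.dim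
    (hi.mul_const (Real.exp (β * B))) (fun x => mul_nonneg (hζ.nonneg x) (Real.exp_pos _).le),
    ← lintegral_const_mul' _ _ ENNReal.ofReal_ne_top]
  refine lintegral_mono_ae ?_
  filter_upwards [ae_conf_disjoint hr.dim A] with τ hτ
  rw [← ENNReal.ofReal_mul (by positivity)]
  refine ENNReal.ofReal_le_ofReal ?_
  rw [weight, abs_of_nonneg (mul_nonneg (hζ.prod_nonneg _) (gibbs_nonneg _ _))]
  calc (∏ x ∈ A ∪ conf τ, ζ x) * gibbs φ β (A ∪ conf τ)
      ≤ (∏ x ∈ A ∪ conf τ, ζ x) * Real.exp (β * B) ^ (A ∪ conf τ).card :=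
        mul_le_mul_of_nonneg_left (gibbs_le hr.beta hr.stable _) (hζ.prod_nonneg _)
    _ = (∏ x ∈ A, ζ x * Real.exp (β * B)) * ∏ x ∈ conf τ, ζ x * Real.exp (β * B) := by
        rw [← Finset.prod_const, ← Finset.prod_mul_distrib, Finset.prod_union hτ.symm]
    _ ≤ _ := by
        refine mul_le_mul_of_nonneg_right ?_ (Finset.prod_nonneg fun x _ =>
          mul_nonneg (hζ.nonneg x) (Real.exp_pos _).le)
        rw [← Finset.prod_const]
        refine Finset.prod_le_prod (fun x _ => mul_nonneg (hζ.nonneg x) (Real.exp_pos _).le)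
          fun x _ => ?_
        exact (mul_le_mul_of_nonneg_right (hζ.le x) (Real.exp_pos _).le).trans hzl

lemma lpIntegrable_weight (hr : Regime d φ β B z) (hζ : IsActivity z ζ) (hi : Integrable ζ)
    (A : Finset (Pt d)) : LPIntegrable (weight φ β ζ A) := by
  refine integrable_lp_iff.1 ⟨aestronglyMeasurable_lp.2 fun n => ?_, ?_⟩
  · have := (jointMeas_weight hr hζ A).aemeasurable_right n
    simp only [Finset.union_empty] at this
    exact this.aestronglyMeasurable
  · rw [hasFiniteIntegral_iff_norm]
    simp only [Real.norm_eq_abs]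
    exact (lintegral_abs_weight_le hr hζ hi A).trans_lt ENNReal.ofReal_lt_top

lemma abs_weightInt_le (hr : Regime d φ β B z) (hζ : IsActivity z ζ) (hi : Integrable ζ)
    (A : Finset (Pt d)) :
    |weightInt φ β ζ A| ≤ corrConst β B ζ * (nu1 d φ β)⁻¹ ^ A.card := by
  rw [weightInt, integral_lp (lpIntegrable_weight hr hζ hi A)]
  have := nu1_pos hr.pot hr.beta
  exact abs_integral_le_of_lintegral_le (mul_nonneg (Real.exp_pos _).le (by positivity))
    (lintegral_abs_weight_le hr hζ hi A)

lemma aestronglyMeasurable_weightInt (hr : Regime d φ β B z) (hζ : IsActivity z ζ)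
    (hi : Integrable ζ) (A : Finset (Pt d)) (n : ℕ) :
    AEStronglyMeasurable (fun x : Fin n → Pt d => weightInt φ β ζ (A ∪ Finset.univ.image x))
      volume := by
  have h1 := (aestronglyMeasurable_lp_prod (jointMeas_weight hr hζ A)).integral_prod_right'
  refine (aestronglyMeasurable_lp.1 h1 n).congr (Eventually.of_forall fun x => ?_)
  simp only [weightInt]
  rw [integral_lp (lpIntegrable_weight hr hζ hi _)]
  rfl

lemma lpIntegral_const_mul (a : ℝ) (F : Finset (Pt d) → ℝ) :
    lpIntegral 1 (fun γ => a * F γ) = a * lpIntegral 1 F := by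
  rw [lpIntegral, lpIntegral, ← tsum_mul_left]
  refine tsum_congr fun n => ?_
  rw [integral_const_mul]
  ring

lemma lpIntegral_finsetSum {ι : Type*} (s : Finset ι) {F : ι → Finset (Pt d) → ℝ}
    (h : ∀ i ∈ s, LPIntegrable (F i)) :
    lpIntegral 1 (fun γ => ∑ i ∈ s, F i γ) = ∑ i ∈ s, lpIntegral 1 (F i) := by
  have h1 : ∀ i ∈ s, Integrable (fun τ => F i (conf τ)) (lpMeasure d) :=
    fun i hi => integrable_lp_iff.2 (h i hi)
  have h2 : LPIntegrable (fun γ => ∑ i ∈ s, F i γ) :=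
    integrable_lp_iff.1 (integrable_finsetSum s h1)
  rw [integral_lp h2, integral_finsetSum s h1]
  exact Finset.sum_congr rfl fun i hi => (integral_lp (h i hi)).symm

lemma LPIntegrable.const_mul {F : Finset (Pt d) → ℝ} (h : LPIntegrable F) (a : ℝ) :
    LPIntegrable fun γ => a * F γ :=
  integrable_lp_iff.1 ((integrable_lp_iff.2 h).const_mul a)

lemma weightInt_step (hr : Regime d φ β B z) (hζ : IsActivity z ζ) (hi : Integrable ζ)
    {A : Finset (Pt d)} {x : Pt d} (hx : x ∈ A) :
    weightInt φ β ζ A = (ζ x * ∏ y ∈ A.erase x, bond φ β x y) *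
      lpIntegral 1 fun γ => kerK φ β x γ * weightInt φ β ζ (A.erase x ∪ γ) := by
  have hn1 : 0 < nu1 d φ β := nu1_pos hr.pot hr.beta
  let g : Finset (Pt d) → Finset (Pt d) → ℝ := fun ξ γ =>
    kerK φ β x ξ * weight φ β ζ (A.erase x ∪ ξ) γ
  have hg : JointMeas g := (jointMeas_kerK hr x).mul (jointMeas_weight hr hζ _)
  have hfin : ∫⁻ τ, ∫⁻ τ', ENNReal.ofReal |g (conf τ) (conf τ')|
      ∂(lpMeasure d) ∂(lpMeasure d) < ⊤ := by
    simp only [g, abs_mul, ENNReal.ofReal_mul (abs_nonneg (kerK φ β x _))]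
    simp_rw [lintegral_const_mul' _ _ ENNReal.ofReal_ne_top]
    refine (lintegral_lp_kerK_mul_le hr x (M := corrConst β B ζ *
      (nu1 d φ β)⁻¹ ^ (A.erase x).card) (f := fun ξ => ∫⁻ τ', ENNReal.ofReal
      |weight φ β ζ (A.erase x ∪ ξ) (conf τ')| ∂(lpMeasure d))
      (mul_nonneg (Real.exp_pos _).le (by positivity)) ?_).trans_lt ENNReal.ofReal_lt_top
    filter_upwards [ae_conf_disjoint hr.dim (A.erase x)] with τ hτ
    refine (lintegral_abs_weight_le hr hζ hi _).trans (le_of_eq ?_)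
    rw [Finset.card_union_of_disjoint hτ.symm, pow_add, mul_assoc]
  have hM := lpIntegral_powerset hr.dim hg hfin
  have hae : ∀ᵐ τ ∂(lpMeasure d), weight φ β ζ A (conf τ) =
      (ζ x * ∏ y ∈ A.erase x, bond φ β x y) * ∑ ξ ∈ (conf τ).powerset, g ξ (conf τ \ ξ) := by
    filter_upwards [ae_conf_disjoint hr.dim A] with τ hτ
    exact weight_step hr ζ hτ hx
  rw [weightInt, lpIntegral_congr_ae (G := fun γ => (ζ x * ∏ y ∈ A.erase x, bond φ β x y) *
    ∑ ξ ∈ γ.powerset, g ξ (γ \ ξ)) hae, lpIntegral_const_mul, hM.2]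
  simp only [g, lpIntegral_const_mul, weightInt]

/-- The empty configuration contributes 1 and all other terms are nonnegative; division by the
partition function is therefore harmless. -/
lemma one_le_weightInt_empty (hr : Regime d φ β B z) (hζ : IsActivity z ζ) (hi : Integrable ζ) :
    1 ≤ weightInt φ β ζ ∅ := by
  have h0 : ∀ γ, 0 ≤ weight φ β ζ ∅ γ := fun γ =>
    mul_nonneg (hζ.prod_nonneg _) (gibbs_nonneg _ _)
  have hs := (lpIntegrable_weight hr hζ hi ∅).2
  simp only [abs_of_nonneg (h0 _)] at hs
  have h1 := hs.le_tsum 0 fun n _ => mul_nonneg (by positivity) (integral_nonneg fun x => h0 _)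
  rw [weightInt, lpIntegral]
  simp only [one_pow]
  refine le_trans (le_of_eq ?_) h1
  simp [weight, gibbs_empty, volume_pi, Measure.real]

lemma corr_eq (hd : 1 ≤ d) (j : Pt d → ℝ) (A : Finset (Pt d)) :
    corr φ β z j A =
      weightInt φ β (fun x => z * j x) A / weightInt φ β (fun x => z * j x) ∅ := by
  have key : ∀ A : Finset (Pt d), z ^ A.card *
      lpIntegral z (fun γ => chi j (A ∪ γ) * boltz β (energyU φ (A ∪ γ))) =
      weightInt φ β (fun x => z * j x) A := by
    intro A
    rw [lpIntegral_eq_one hd, ← lpIntegral_const_mul, weightInt]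
    refine lpIntegral_congr_ae ?_
    filter_upwards [ae_conf_disjoint hd A] with τ hτ
    rw [weight, Finset.prod_mul_distrib, Finset.prod_const, Finset.card_union_of_disjoint hτ.symm,
      pow_add, chi, gibbs]
    ring
  have h0 := key ∅
  simp only [Finset.card_empty, pow_zero, one_mul, Finset.empty_union] at h0
  rw [corr, partFun, h0, ← key A]
  ring

/-- The truncation of the correlation functions solves the system. -/
lemma isBlockKS_trunc_corr (hr : Regime d φ β B z) {j : Pt d → ℝ}
    (hζ : IsActivity z fun x => z * j x) (hi : Integrable fun x => z * j x) :
    IsBlockKS φ β (fun x => z * j x) (trunc (corr φ β z j)) := by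
  have hn1 : 0 < nu1 d φ β := nu1_pos hr.pot hr.beta
  have hZ := one_le_weightInt_empty hr hζ hi
  have hZ0 : weightInt φ β (fun x => z * j x) ∅ ≠ 0 := by linarith
  have hb : ∀ A, |corr φ β z j A| ≤
      corrConst β B (fun x => z * j x) * (nu1 d φ β)⁻¹ ^ A.card := by
    intro A
    rw [corr_eq hr.dim, abs_div, abs_of_nonneg (by linarith : 0 ≤ weightInt φ β (fun x => z * j x) ∅)]
    exact (div_le_self (abs_nonneg _) hZ).trans (abs_weightInt_le hr hζ hi A)
  have hm : ∀ A n, AEStronglyMeasurable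
      (fun x : Fin n → Pt d => corr φ β z j (A ∪ Finset.univ.image x)) volume := by
    intro A n
    simp only [corr_eq hr.dim, div_eq_mul_inv]
    exact (aestronglyMeasurable_weightInt hr hζ hi A n).mul_const _
  have hint : ∀ (x : Pt d) (A : Finset (Pt d)),
      LPIntegrable fun γ => kerK φ β x γ * corr φ β z j (A ∪ γ) := by
    intro x A
    refine (lpIntegrable_kerK_mul hr x (M := corrConst β B (fun x => z * j x) *
      (nu1 d φ β)⁻¹ ^ A.card) (mul_nonneg (Real.exp_pos _).le (by positivity)) (hm A) ?_).1
    filter_upwards [ae_conf_disjoint hr.dim A] with τ hτ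
    refine (hb _).trans (le_of_eq ?_)
    rw [Finset.card_union_of_disjoint hτ.symm, pow_add, mul_assoc]
  have h0 : corr φ β z j ∅ = 1 := by rw [corr_eq hr.dim, div_self hZ0]
  have hstep : ∀ A, ∀ x ∈ A, corr φ β z j A =
      (z * j x * ∏ y ∈ A.erase x, bond φ β x y) *
        lpIntegral 1 fun γ => kerK φ β x γ * corr φ β z j (A.erase x ∪ γ) := by
    intro A x hx
    simp only [corr_eq hr.dim]
    rw [weightInt_step hr hζ hi hx, mul_div_assoc]
    congr 1
    rw [div_eq_mul_inv, mul_comm, ← lpIntegral_const_mul]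
    congr 1
    funext γ
    rw [div_eq_mul_inv]
    ring
  refine ⟨trunc_empty_left _ h0, fun A S h x hx => ?_, fun A S h n => ?_, fun S => ?_⟩
  -- The integral equation for ρ has the product form required for truncation, with L the integral
  -- of ρ against K. The inner sum over U is the truncation under the integral sign.
  · rw [trunc_step _ (fun A' => lpIntegral 1 fun γ => kerK φ β x γ * corr φ β z j (A' ∪ γ))
      (z * j x * ∏ y ∈ A.erase x, bond φ β x y)
      (absorbWeight (fun x y => bond φ β x y - 1) x) A (A.erase x) S]
    · congr 1
      refine Finset.sum_congr rfl fun W hW => ?_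
      congr 1
      have hfun : (fun γ => kerK φ β x γ * trunc (corr φ β z j) (A.erase x ∪ pts W ∪ γ) (S \ W)) =
          fun γ => ∑ U ∈ (S \ W).powerset, convInv (fun W => corr φ β z j (pts W)) ((S \ W) \ U) *
            (kerK φ β x γ * corr φ β z j (A.erase x ∪ pts W ∪ pts U ∪ γ)) := by
        funext γ
        rw [trunc, Finset.mul_sum]
        refine Finset.sum_congr rfl fun U _ => ?_
        rw [Finset.union_right_comm]
        ring
      rw [hfun, lpIntegral_finsetSum _ fun U _ => (hint x _).const_mul _]
      refine Finset.sum_congr rfl fun U hU => ?_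
      rw [lpIntegral_const_mul, mul_comm]
    · intro U hU
      have hd : Disjoint (A.erase x) (pts U) :=
        (h.mono (Finset.erase_subset _ _) hU).disjoint_pts
      have hxU : x ∉ pts U := Finset.disjoint_left.1 (h.mono le_rfl hU).disjoint_pts hx
      have he : (A ∪ pts U).erase x = A.erase x ∪ pts U := by
        rw [Finset.erase_union_distrib, Finset.erase_eq_of_notMem hxU]
      rw [hstep _ x (Finset.mem_union_left _ hx), he, Finset.prod_union hd, Finset.prod_biUnion]
      · simp only [absorbWeight, id, add_sub_cancel]
        ring
      · intro C hC C' hC' hne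
        exact h.pairwise C (hU hC) C' (hU hC') hne
  · simp only [trunc]
    refine Finset.aestronglyMeasurable_fun_sum _ fun U _ => ?_
    simp only [Finset.union_right_comm A]
    exact (hm (A ∪ pts U) n).mul_const _
  · refine ⟨∑ U ∈ S.powerset, corrConst β B (fun x => z * j x) * (nu1 d φ β)⁻¹ ^ (pts U).card *
      |convInv (fun W => corr φ β z j (pts W)) (S \ U)|, fun A h => ?_⟩
    rw [trunc, Finset.sum_mul]
    refine (Finset.abs_sum_le_sum_abs _ _).trans (Finset.sum_le_sum fun U hU => ?_)
    rw [abs_mul]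
    refine (mul_le_mul_of_nonneg_right (hb _) (abs_nonneg _)).trans (le_of_eq ?_)
    rw [Finset.card_union_of_disjoint (h.mono le_rfl (Finset.mem_powerset.1 hU)).disjoint_pts,
      pow_add]
    ring

end Correlation

end PTCF

namespace PTCF

/-! ### From sets of blocks to tuples of clusters. -/

section Hierarchies

variable {d r : ℕ} {φ : ℝ → EReal} {β B z : ℝ}

lemma disjointClusters_cons {A : Finset (Pt d)} {η : Fin r → Finset (Pt d)} :
    DisjointClusters (Fin.cons A η : Fin (r + 1) → Finset (Pt d)) ↔
      DisjointClusters η ∧ ∀ i, Disjoint A (η i) := by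
  constructor
  · intro h
    refine ⟨fun i k hik => ?_, fun i => ?_⟩
    · have := h (i := i.succ) (j := k.succ) fun e => hik (Fin.succ_injective _ e)
      simpa using this
    · have := h (i := 0) (j := i.succ) (Fin.succ_ne_zero i).symm
      simpa using this
  · rintro ⟨h1, h2⟩ i k hik
    induction i using Fin.cases with
    | zero =>
      induction k using Fin.cases with
      | zero => exact absurd rfl hik
      | succ k => simpa using h2 k
    | succ i =>
      induction k using Fin.cases with
      | zero => simpa using (h2 i).symm
      | succ k => simpa using h1 (i := i) (j := k) fun e => hik (by rw [e])

lemma DisjointClusters.tail {η : Fin (r + 1) → Finset (Pt d)} (h : DisjointClusters η) :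
    DisjointClusters (Fin.tail η) ∧ ∀ i, Disjoint (η 0) (Fin.tail η i) := by
  rw [← Fin.cons_self_tail η] at h
  exact disjointClusters_cons.1 h

/-- This permits a tuple of clusters to be replaced by its set of values. Empty clusters could
coincide, and are treated separately throughout. -/
lemma DisjointClusters.injective {η : Fin r → Finset (Pt d)} (h : DisjointClusters η)
    (hne : ∀ i, (η i).Nonempty) : Function.Injective η := by
  intro i k e
  by_contra hik
  have hd : Disjoint (η i) (η k) := h hik
  rw [e, disjoint_self] at hd
  exact (hne k).ne_empty hd

lemma consRest_succ (A : Finset (Pt d)) (η : Fin r → Finset (Pt d)) (I : Finset (Fin r))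
    (k : Fin Iᶜ.card) : consRest A η I k.succ = η (Iᶜ.orderEmbOfFin rfl k) := by
  simp [consRest]

lemma image_tail_consRest (A : Finset (Pt d)) (η : Fin r → Finset (Pt d)) (I : Finset (Fin r)) :
    Finset.univ.image (Fin.tail (consRest A η I)) = Iᶜ.image η := by
  have : Fin.tail (consRest A η I) = η ∘ Iᶜ.orderEmbOfFin rfl := by
    funext k
    exact consRest_succ A η I k
  rw [this, ← Finset.image_image, Finset.image_orderEmbOfFin_univ]

lemma disjointClusters_consRest {A : Finset (Pt d)} {η : Fin r → Finset (Pt d)}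
    {I : Finset (Fin r)} (h : DisjointClusters η) (hA : ∀ i ∉ I, Disjoint A (η i)) :
    DisjointClusters (consRest A η I) := by
  refine disjointClusters_cons.2 ⟨fun i k hik => h fun e => hik ?_, fun i => hA _ ?_⟩
  · exact (Iᶜ.orderEmbOfFin rfl).injective e
  · exact Finset.mem_compl.1 (Finset.orderEmbOfFin_mem _ _ _)

lemma exists_consRest_eq {A : Finset (Pt d)} {η : Fin r → Finset (Pt d)} {I : Finset (Fin r)}
    {i : Fin r} (hi : i ∉ I) : ∃ k : Fin Iᶜ.card, consRest A η I k.succ = η i := by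
  have : i ∈ Set.range (Iᶜ.orderEmbOfFin rfl) := by
    rw [Finset.range_orderEmbOfFin]; simpa using hi
  obtain ⟨k, rfl⟩ := this
  exact ⟨k, consRest_succ A η I k⟩

lemma apply_consRest_empty (ρ : Hierarchy d) (A : Finset (Pt d)) (η : Fin r → Finset (Pt d)) :
    ρ ((∅ : Finset (Fin r))ᶜ.card + 1) (consRest A η ∅) = ρ (r + 1) (Fin.cons A η) := by
  -- The complement of ∅ and its cardinality are generalized so that equal numbers of clusters can
  -- be substituted; the increasing enumeration of all indices is the identity.
  have key : ∀ (s : Finset (Fin r)) (k : ℕ) (hk : s.card = k), s = Finset.univ →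
      ρ (k + 1) (Fin.cons A fun i => η (s.orderEmbOfFin hk i)) = ρ (r + 1) (Fin.cons A η) := by
    rintro s k hk rfl
    have hkr : k = r := by rw [← hk, Finset.card_univ, Fintype.card_fin]
    subst hkr
    congr 2
    funext i
    have h := Finset.orderEmbOfFin_unique hk (f := id) (fun x => Finset.mem_univ _) strictMono_id
    rw [← h, id]
  exact key _ _ rfl Finset.compl_empty

lemma sum_starSubsets_kerK {η : Fin r → Finset (Pt d)} (h : DisjointClusters η)
    (I : Finset (Fin r)) (x : Pt d) :
    ∑ ξ ∈ starSubsets η I, kerK φ β x ξ =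
      ∏ i ∈ I, absorbWeight (fun x y => bond φ β x y - 1) x (η i) := by
  have e : starSubsets η I = transversals I η := by
    ext ξ; simp [starSubsets, transversals]
  rw [e]
  exact sum_transversals_prod I η (fun i _ k _ hik => h hik) (fun y => mayer φ β (dist x y))

/-- Sums over sets of clusters and subsets meeting each of them, as sums over sets of blocks. -/
lemma sum_starSubsets {η : Fin r → Finset (Pt d)} (h : DisjointClusters η)
    (hne : ∀ i, (η i).Nonempty) (x : Pt d) (H : Finset (Finset (Pt d)) → ℝ) :
    ∑ I : Finset (Fin r), ∑ ξ ∈ starSubsets η I, kerK φ β x ξ * H (I.image η) =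
      ∑ U ∈ (Finset.univ.image η).powerset,
        (∏ C ∈ U, absorbWeight (fun x y => bond φ β x y - 1) x C) * H U := by
  have hinj := h.injective hne
  rw [sum_powerset_image η hinj, Finset.powerset_univ]
  refine Finset.sum_congr rfl fun I _ => ?_
  rw [← Finset.sum_mul, sum_starSubsets_kerK h, Finset.prod_image fun a _ b _ e => hinj e]

lemma pts_image (η : Fin r → Finset (Pt d)) (I : Finset (Fin r)) :
    pts (I.image η) = I.biUnion η := by
  simp [pts, Finset.image_biUnion]

lemma starSubsets_eq_empty {η : Fin r → Finset (Pt d)} {I : Finset (Fin r)} {i : Fin r}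
    (hi : i ∈ I) (h : η i = ∅) : starSubsets η I = ∅ := by
  rw [starSubsets, Finset.filter_eq_empty_iff]
  intro ξ _ hξ
  have := hξ i hi
  rw [h] at this
  simp at this

lemma starSubsets_subset {η : Fin r → Finset (Pt d)} {I : Finset (Fin r)} {ξ : Finset (Pt d)}
    (h : ξ ∈ starSubsets η I) : ξ ⊆ allPts η :=
  (Finset.mem_powerset.1 (Finset.mem_filter.1 h).1).trans
    (Finset.biUnion_subset_biUnion_of_subset_left η (Finset.subset_univ I))

lemma subset_allPts (η : Fin r → Finset (Pt d)) (i : Fin r) : η i ⊆ allPts η :=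
  Finset.subset_biUnion_of_mem η (Finset.mem_univ i)

lemma tailBlocks_empty (η : Fin r → Finset (Pt d)) : tailBlocks η ∅ = Finset.univ.image η := by
  simp [tailBlocks, singles]

lemma blockSystem_clusters {η : Fin (r + 1) → Finset (Pt d)} (hη : DisjointClusters η)
    (hne : ∀ i : Fin r, (η i.succ).Nonempty) :
    BlockSystem (η 0) (Finset.univ.image (Fin.tail η)) := by
  rw [← tailBlocks_empty]
  exact blockSystem_tailBlocks hη hne (Finset.disjoint_empty_left _)

/-- The root of the tuple which remains after absorbing the clusters in `I` is disjoint from the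
remaining clusters. -/
lemma disjoint_rest {η : Fin (r + 1) → Finset (Pt d)} (hη : DisjointClusters η)
    {I : Finset (Fin r)} {A' γ : Finset (Pt d)} (hA : A' ⊆ η 0) (hγ : Disjoint γ (allPts η)) :
    ∀ i ∉ I, Disjoint (A' ∪ I.biUnion (Fin.tail η) ∪ γ) (Fin.tail η i) := by
  intro i hi
  obtain ⟨h1, h2⟩ := hη.tail
  rw [Finset.disjoint_union_left, Finset.disjoint_union_left, Finset.disjoint_biUnion_left]
  exact ⟨⟨(h2 i).mono_left hA, fun k hk => h1 fun e => hi (e ▸ hk)⟩,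
    hγ.mono_right (subset_allPts η i.succ)⟩

/-- The hierarchy `ρ` is given by the function `R` of a root and a set of blocks. -/
structure Represents (ρ : Hierarchy d) (R : Finset (Pt d) → Finset (Finset (Pt d)) → ℝ) :
    Prop where
  eq : ∀ (r : ℕ) (η : Fin (r + 1) → Finset (Pt d)), DisjointClusters η →
    (∀ i : Fin r, (η i.succ).Nonempty) → ρ (r + 1) η = R (η 0) (Finset.univ.image (Fin.tail η))
  zero : ∀ (r : ℕ) (η : Fin (r + 1) → Finset (Pt d)), DisjointClusters η →
    (∃ i : Fin r, η i.succ = ∅) → ρ (r + 1) η = 0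

lemma Represents.consRest {ρ : Hierarchy d} {R : Finset (Pt d) → Finset (Finset (Pt d)) → ℝ}
    (h : Represents ρ R) {A : Finset (Pt d)} {η : Fin r → Finset (Pt d)} {I : Finset (Fin r)}
    (hη : DisjointClusters η) (hne : ∀ i, (η i).Nonempty) (hA : ∀ i ∉ I, Disjoint A (η i)) :
    ρ (Iᶜ.card + 1) (consRest A η I) = R A (Finset.univ.image η \ I.image η) := by
  rw [h.eq _ _ (disjointClusters_consRest hη hA) fun k => by rw [consRest_succ]; exact hne _,
    image_tail_consRest, ← Finset.image_sdiff _ _ (hη.injective hne)]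
  congr 1

lemma Represents.consRest_zero {ρ : Hierarchy d}
    {R : Finset (Pt d) → Finset (Finset (Pt d)) → ℝ} (h : Represents ρ R) {A : Finset (Pt d)}
    {η : Fin r → Finset (Pt d)} {I : Finset (Fin r)} (hη : DisjointClusters η)
    (hA : ∀ i ∉ I, Disjoint A (η i)) {i : Fin r} (hi : i ∉ I) (hie : η i = ∅) :
    ρ (Iᶜ.card + 1) (PTCF.consRest A η I) = 0 := by
  obtain ⟨k, hk⟩ := exists_consRest_eq (A := A) (η := η) hi
  exact h.zero _ _ (disjointClusters_consRest hη hA) ⟨k, hk.trans hie⟩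

lemma lpIntegral_eq_zero {F : Finset (Pt d) → ℝ} (h : ∀ᵐ τ ∂(lpMeasure d), F (conf τ) = 0) :
    lpIntegral 1 F = 0 := by
  rw [lpIntegral_congr_ae (G := fun _ => 0) h]
  simp [lpIntegral]

/-- For almost every γ the factor K(x; ξ ∪ γ) splits, and the sum over ξ becomes the product of
absorption weights. If a later cluster is empty, both sides vanish: no ξ meets it when it is
absorbed, and otherwise it stays as an empty cluster. -/
lemma IsBlockKS.isKSSolution (hr : Regime d φ β B z) {j : Pt d → ℝ}
    {R : Finset (Pt d) → Finset (Finset (Pt d)) → ℝ} (hR : IsBlockKS φ β (fun x => z * j x) R)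
    {ρ : Hierarchy d} (hρ : Represents ρ R) {sel : Finset (Pt d) → Pt d}
    (hsel : IsSelection φ B sel) (m : ℕ) : IsKSSolution φ β z j sel m ρ := by
  refine ⟨?_, ?_, ?_⟩
  · rw [hρ.eq 0 (fun _ => ∅) (fun i k _ => Finset.disjoint_empty_left _) fun i => i.elim0, hR.base]
    simp
  · intro k hk _ η hη ⟨i, hi⟩
    obtain ⟨r, rfl⟩ : ∃ r, k = r + 1 := ⟨k - 1, by omega⟩
    by_cases hne : ∀ i : Fin r, (η i.succ).Nonempty
    · have h0 : η 0 = ∅ := by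
        induction i using Fin.cases with
        | zero => exact hi
        | succ i => exact absurd hi (hne i).ne_empty
      rw [hρ.eq r η hη hne, h0, hR.base, if_neg]
      rw [Finset.image_eq_empty, Finset.univ_eq_empty_iff, not_isEmpty_iff]
      exact ⟨⟨0, by omega⟩⟩
    · push Not at hne
      obtain ⟨i, hi⟩ := hne
      exact hρ.zero r η hη ⟨i, hi⟩
  · intro r _ η hη h0
    have hx := (hsel _ h0).1
    set x := sel (η 0) with hxdef
    obtain ⟨ht, ht0⟩ := hη.tail
    by_cases hne : ∀ i : Fin r, (η i.succ).Nonempty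
    · rw [hρ.eq r η hη hne, hR.step _ _ (blockSystem_clusters hη hne) x hx,
        boltz_energyW hr.pot hr.beta, ← sum_starSubsets ht hne]
      have hterm : ∀ I : Finset (Fin r), ∀ ξ ∈ starSubsets (Fin.tail η) I,
          lpIntegral 1 (fun γ => kerK φ β x (ξ ∪ γ) * ρ (Iᶜ.card + 1)
            (consRest ((η 0).erase x ∪ I.biUnion (Fin.tail η) ∪ γ) (Fin.tail η) I)) =
          kerK φ β x ξ * lpIntegral 1 fun γ => kerK φ β x γ *
            R ((η 0).erase x ∪ pts (I.image (Fin.tail η)) ∪ γ)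
              (Finset.univ.image (Fin.tail η) \ I.image (Fin.tail η)) := by
        intro I ξ hξ
        rw [← lpIntegral_const_mul]
        refine lpIntegral_congr_ae ?_
        filter_upwards [ae_conf_disjoint hr.dim (allPts η)] with τ hτ
        have hξη : ξ ⊆ allPts η := (starSubsets_subset hξ).trans (by
          rw [allPts_eq_union_tail η]; exact Finset.subset_union_right)
        rw [kerK_union x (hτ.mono_right hξη).symm,
          hρ.consRest ht hne (disjoint_rest hη (Finset.erase_subset _ _) hτ), pts_image, mul_assoc]
      rw [Finset.sum_congr rfl fun I _ => Finset.sum_congr rfl (hterm I)]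
      ring
    · push Not at hne
      obtain ⟨i, hi⟩ := hne
      rw [hρ.zero r η hη ⟨i, hi⟩, Finset.sum_eq_zero, mul_zero]
      intro I _
      by_cases hiI : i ∈ I
      · rw [starSubsets_eq_empty hiI hi, Finset.sum_empty]
      · refine Finset.sum_eq_zero fun ξ _ => lpIntegral_eq_zero ?_
        filter_upwards [ae_conf_disjoint hr.dim (allPts η)] with τ hτ
        rw [hρ.consRest_zero ht (disjoint_rest hη (Finset.erase_subset _ _) hτ) hiI hi, mul_zero]

lemma IsBlockKS.isRegularHierarchy (hr : Regime d φ β B z) {ζ : Pt d → ℝ}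
    {R : Finset (Pt d) → Finset (Finset (Pt d)) → ℝ} (hR : IsBlockKS φ β ζ R)
    {ρ : Hierarchy d} (hρ : Represents ρ R) (m : ℕ) :
    IsRegularHierarchy (nu1 d φ β)⁻¹ m ρ := by
  refine ⟨fun r _ η hη A hA n => ?_, fun r _ η hη => ?_⟩
  · by_cases hne : ∀ i, (η i).Nonempty
    · have hBS : BlockSystem A (Finset.univ.image η) := by
        have := blockSystem_clusters (disjointClusters_cons.2 ⟨hη, hA⟩) (by simpa using hne)
        simpa using this
      refine (hR.meas A _ hBS n).congr ?_
      filter_upwards [ae_isGeneric hr.dim (A ∪ allPts η)] with x hx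
      rw [hρ.eq]
      · simp
      · refine disjointClusters_cons.2 ⟨hη, fun i => Finset.disjoint_union_left.2 ⟨hA i, ?_⟩⟩
        exact (hx.disjoint_image _).mono_right
          ((subset_allPts η i).trans Finset.subset_union_right)
      · simpa using hne
    · push Not at hne
      obtain ⟨i, hi⟩ := hne
      refine (aestronglyMeasurable_const (b := (0 : ℝ))).congr ?_
      filter_upwards [ae_isGeneric hr.dim (A ∪ allPts η)] with x hx
      rw [hρ.zero]
      · refine disjointClusters_cons.2 ⟨hη, fun i => Finset.disjoint_union_left.2 ⟨hA i, ?_⟩⟩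
        exact (hx.disjoint_image _).mono_right
          ((subset_allPts η i).trans Finset.subset_union_right)
      · exact ⟨i, by simpa using hi⟩
  · by_cases hne : ∀ i, (η i).Nonempty
    · obtain ⟨C, hC⟩ := hR.bound (Finset.univ.image η)
      refine ⟨C, fun A hA => ?_⟩
      have hd := disjointClusters_cons.2 ⟨hη, hA⟩
      have hBS := blockSystem_clusters hd (by simpa using hne)
      rw [hρ.eq _ _ hd (by simpa using hne)]
      simp only [Fin.cons_zero, Fin.tail_cons] at hBS ⊢
      exact hC A hBS
    · push Not at hne
      obtain ⟨i, hi⟩ := hne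
      refine ⟨0, fun A hA => ?_⟩
      rw [hρ.zero _ _ (disjointClusters_cons.2 ⟨hη, hA⟩) ⟨i, by simpa using hi⟩]
      simp

end Hierarchies

/-! ### Uniqueness by contraction. -/

section Uniqueness

variable {d : ℕ} {φ : ℝ → EReal} {β B z : ℝ}

lemma starSubsets_empty {r : ℕ} (η : Fin r → Finset (Pt d)) : starSubsets η ∅ = {∅} := by
  ext ξ
  simp [starSubsets]

lemma lpIntegral_sub {F G : Finset (Pt d) → ℝ} (hF : LPIntegrable F) (hG : LPIntegrable G) :
    lpIntegral 1 (fun γ => F γ - G γ) = lpIntegral 1 F - lpIntegral 1 G := by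
  have h := (integrable_lp_iff.2 hF).sub (integrable_lp_iff.2 hG)
  have h' : LPIntegrable fun γ => F γ - G γ := integrable_lp_iff.1 h
  rw [integral_lp hF, integral_lp hG, integral_lp h',
    integral_sub (integrable_lp_iff.2 hF) (integrable_lp_iff.2 hG)]

/-- Regular solutions of the system are unique: the homogeneous system for the functions of `r + 1`
clusters is a contraction once the functions of fewer clusters are known. -/
theorem IsKSSolution.unique (hr : Regime d φ β B z) {j : Pt d → ℝ} (hj0 : ∀ x, 0 ≤ j x)
    (hj1 : ∀ x, j x ≤ 1) {sel : Finset (Pt d) → Pt d} (hsel : IsSelection φ B sel) {m : ℕ}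
    {ρ ρ' : Hierarchy d} (h : IsKSSolution φ β z j sel m ρ)
    (hreg : IsRegularHierarchy (nu1 d φ β)⁻¹ m ρ) (h' : IsKSSolution φ β z j sel m ρ')
    (hreg' : IsRegularHierarchy (nu1 d φ β)⁻¹ m ρ') (r : ℕ) (hrm : r + 1 ≤ m)
    (η : Fin (r + 1) → Finset (Pt d)) (hη : DisjointClusters η) : ρ' (r + 1) η = ρ (r + 1) η := by
  induction r using Nat.strong_induction_on with
  | _ r ih =>
  have hn1 : 0 < nu1 d φ β := nu1_pos hr.pot hr.beta
  have hz := hr.pos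
  obtain ⟨hθ, -⟩ := hη.tail
  set θ := Fin.tail η with hθdef
  let D : Finset (Pt d) → ℝ := fun A => ρ' (r + 1) (Fin.cons A θ) - ρ (r + 1) (Fin.cons A θ)
  obtain ⟨C, hC⟩ := hreg.bound r hrm θ hθ
  obtain ⟨C', hC'⟩ := hreg'.bound r hrm θ hθ
  -- Contraction constant: z e^{2βB} from the selected point, e from the integral of K, and ν₁ from
  -- removing one point in the growth ν₁^{-|A|}.
  set q := z * Real.exp (2 * β * B + 1) * nu1 d φ β with hq
  have hq0 : 0 ≤ q := by positivity
  have hq1 : q < 1 := by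
    refine lt_of_le_of_lt ?_ hr.small
    have : Real.exp (2 * β * B + 1) ≤ Real.exp (2 * β * B + 2) := Real.exp_le_exp.2 (by linarith)
    exact mul_le_mul_of_nonneg_right (mul_le_mul_of_nonneg_left this hz.le) hn1.le
  have hdisj : ∀ {A : Finset (Pt d)} {γ : Finset (Pt d)}, (∀ i, Disjoint A (θ i)) →
      Disjoint γ (allPts θ) → ∀ i, Disjoint (A ∪ γ) (θ i) := fun hA hγ i =>
    Finset.disjoint_union_left.2 ⟨hA i, hγ.mono_right (subset_allPts θ i)⟩
  have hstep : ∀ A : Finset (Pt d), (∀ i, Disjoint A (θ i)) → A.Nonempty →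
      D A = z * boltz β (energyW φ (sel A) (A.erase (sel A))) * j (sel A) *
        lpIntegral 1 fun γ => kerK φ β (sel A) γ * D (A.erase (sel A) ∪ γ) := by
    intro A hA hne
    have hcons := disjointClusters_cons.2 ⟨hθ, hA⟩
    have e1 := h.eqn r hrm _ hcons (by simpa using hne)
    have e2 := h'.eqn r hrm _ hcons (by simpa using hne)
    simp only [Fin.cons_zero, Fin.tail_cons] at e1 e2
    set x := sel A
    have hA' : ∀ i, Disjoint (A.erase x) (θ i) := fun i => (hA i).mono_left (Finset.erase_subset _ _)
    simp only [D]
    rw [e1, e2, ← mul_sub, ← Finset.sum_sub_distrib]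
    congr 1
    -- Only I = ∅ involves functions of r + 1 clusters. For I ≠ ∅ the two solutions agree by
    -- induction, almost everywhere in γ.
    rw [Finset.sum_eq_single ∅]
    · rw [starSubsets_empty, Finset.sum_singleton, Finset.sum_singleton]
      simp only [Finset.empty_union, Finset.biUnion_empty, Finset.union_empty,
        apply_consRest_empty]
      have hint : ∀ (ρ : Hierarchy d) (C : ℝ), IsRegularHierarchy (nu1 d φ β)⁻¹ m ρ →
          (∀ A : Finset (Pt d), (∀ i, Disjoint A (θ i)) →
            |ρ (r + 1) (Fin.cons A θ)| ≤ C * (nu1 d φ β)⁻¹ ^ A.card) →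
          LPIntegrable fun γ => kerK φ β x γ * ρ (r + 1) (Fin.cons (A.erase x ∪ γ) θ) := by
        intro ρ C hreg hC
        refine (lpIntegrable_kerK_mul hr x (M := |C| * (nu1 d φ β)⁻¹ ^ (A.erase x).card)
          (by positivity) (hreg.meas r hrm θ hθ _ hA') ?_).1
        filter_upwards [ae_conf_disjoint hr.dim (allPts θ ∪ A.erase x)] with τ hτ
        refine (hC _ (hdisj hA' (hτ.mono_right Finset.subset_union_left))).trans ?_
        rw [Finset.card_union_of_disjoint (hτ.mono_right Finset.subset_union_right).symm, pow_add,
          ← mul_assoc]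
        gcongr
        exact le_abs_self C
      rw [← lpIntegral_sub (hint ρ' C' hreg' hC') (hint ρ C hreg hC)]
      simp only [mul_sub]
    · intro I _ hI
      rw [sub_eq_zero]
      refine Finset.sum_congr rfl fun ξ _ => lpIntegral_congr_ae ?_
      filter_upwards [ae_conf_disjoint hr.dim (allPts (Fin.cons A θ : Fin (r + 1) → _))] with τ hτ
      have hcard : Iᶜ.card < r := by
        have h1 := Finset.card_pos.2 (Finset.nonempty_iff_ne_empty.2 hI)
        have h2 := Finset.card_compl_add_card I
        rw [Fintype.card_fin] at h2
        omega
      rw [ih _ hcard (by omega)]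
      refine disjointClusters_consRest hθ ?_
      have := disjoint_rest hcons (I := I) (A' := A.erase x) (by simp [Finset.erase_subset]) hτ
      simpa using this
    · intro hn
      exact absurd (Finset.mem_univ _) hn
  have hempty : D ∅ = 0 := by
    simp only [D]
    rcases Nat.eq_zero_or_pos r with rfl | hr0
    · have : (Fin.cons ∅ θ : Fin 1 → Finset (Pt d)) = fun _ => ∅ := by
        funext i; exact Fin.cases rfl (fun i => i.elim0) i
      rw [this, h.one_empty, h'.one_empty, sub_self]
    · have hcons := disjointClusters_cons.2 ⟨hθ, fun i => Finset.disjoint_empty_left (θ i)⟩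
      rw [h.some_empty (r + 1) (by omega) hrm _ hcons ⟨0, rfl⟩,
        h'.some_empty (r + 1) (by omega) hrm _ hcons ⟨0, rfl⟩, sub_self]
  have hmeas : ∀ A : Finset (Pt d), (∀ i, Disjoint A (θ i)) → ∀ n, AEStronglyMeasurable
      (fun x : Fin n → Pt d => D (A ∪ Finset.univ.image x)) volume := fun A hA n =>
    (hreg'.meas r hrm θ hθ A hA n).sub (hreg.meas r hrm θ hθ A hA n)
  -- Iterating the homogeneous equation gains a factor q at every step, starting from the growth
  -- bounds of the two solutions.
  have hiter : ∀ (n : ℕ) (A : Finset (Pt d)), (∀ i, Disjoint A (θ i)) →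
      |D A| ≤ q ^ n * (|C| + |C'|) * (nu1 d φ β)⁻¹ ^ A.card := by
    intro n
    induction n with
    | zero =>
      intro A hA
      rw [pow_zero, one_mul]
      have hp : 0 ≤ (nu1 d φ β)⁻¹ ^ A.card := by positivity
      calc |D A| ≤ |ρ' (r + 1) (Fin.cons A θ)| + |ρ (r + 1) (Fin.cons A θ)| := abs_sub _ _
        _ ≤ |C'| * (nu1 d φ β)⁻¹ ^ A.card + |C| * (nu1 d φ β)⁻¹ ^ A.card :=
          add_le_add ((hC' A hA).trans (mul_le_mul_of_nonneg_right (le_abs_self _) hp))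
            ((hC A hA).trans (mul_le_mul_of_nonneg_right (le_abs_self _) hp))
        _ = _ := by ring
    | succ n ihn =>
      intro A hA
      rcases A.eq_empty_or_nonempty with rfl | hne
      · rw [hempty, abs_zero]; positivity
      · have hx := (hsel A hne).1
        set x := sel A with hxdef
        have hA' : ∀ i, Disjoint (A.erase x) (θ i) :=
          fun i => (hA i).mono_left (Finset.erase_subset _ _)
        have hb := (lpIntegrable_kerK_mul hr x (f := fun γ => D (A.erase x ∪ γ))
          (M := q ^ n * (|C| + |C'|) * (nu1 d φ β)⁻¹ ^ (A.erase x).card) (by positivity)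
          (hmeas _ hA') (by
            filter_upwards [ae_conf_disjoint hr.dim (allPts θ ∪ A.erase x)] with τ hτ
            refine (ihn _ (hdisj hA' (hτ.mono_right Finset.subset_union_left))).trans (le_of_eq ?_)
            rw [Finset.card_union_of_disjoint (hτ.mono_right Finset.subset_union_right).symm,
              pow_add, ← mul_assoc])).2
        rw [hstep A hA hne, ← hxdef, abs_mul, boltz_energyW hr.pot hr.beta]
        have hw := hsel.prod_bond_le hr.pot hr.beta hne
        rw [← hxdef] at hw
        have hw0 : 0 ≤ ∏ y ∈ A.erase x, bond φ β x y := Finset.prod_nonneg fun y _ => bond_nonneg _ _ _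
        have hc : |z * (∏ y ∈ A.erase x, bond φ β x y) * j x| ≤ z * Real.exp (2 * β * B) := by
          rw [abs_of_nonneg (mul_nonneg (mul_nonneg hz.le hw0) (hj0 x))]
          calc _ ≤ z * (∏ y ∈ A.erase x, bond φ β x y) * 1 :=
                mul_le_mul_of_nonneg_left (hj1 x) (mul_nonneg hz.le hw0)
            _ ≤ _ := by rw [mul_one]; exact mul_le_mul_of_nonneg_left hw hz.le
        refine (mul_le_mul hc hb (abs_nonneg _) (by positivity)).trans (le_of_eq ?_)
        have hcard : A.card = (A.erase x).card + 1 := (Finset.card_erase_add_one hx).symm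
        rw [hcard, pow_succ, pow_succ, hq, Real.exp_add]
        field_simp
  have hη0 : ∀ i, Disjoint (η 0) (θ i) := hη.tail.2
  have hlim : Tendsto (fun n : ℕ => q ^ n * (|C| + |C'|) * (nu1 d φ β)⁻¹ ^ (η 0).card) atTop
      (𝓝 0) := by
    have := ((tendsto_pow_atTop_nhds_zero_of_lt_one hq0 hq1).mul_const (|C| + |C'|)).mul_const
      ((nu1 d φ β)⁻¹ ^ (η 0).card)
    simpa using this
  have h0 : |D (η 0)| ≤ 0 := ge_of_tendsto' hlim fun n => hiter n _ hη0
  have h1 : D (η 0) = 0 := abs_eq_zero.1 (le_antisymm h0 (abs_nonneg _))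
  simp only [D, hθdef, Fin.cons_self_tail] at h1
  linarith

end Uniqueness

end PTCF

namespace PTCF

/-! ### The j-PTCF as truncations. -/

section TruncatedCorrelations

variable {d : ℕ} {φ : ℝ → EReal} {β B z : ℝ}

/-- Sorting partitions by the part containing the first cluster gives the convolution defining
`trunc`. If a later cluster is empty, sorting by the part containing that one gives a function
convolved with its own inverse over a nonempty set, hence zero. -/
lemma represents_jPTCF (j : Pt d → ℝ) (h0 : corr φ β z j ∅ = 1) :
    Represents (jPTCF φ β z j) (trunc (corr φ β z j)) := by
  refine ⟨fun r η hη hne => ?_, fun r η hη ⟨i, hi⟩ => ?_⟩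
  · have hinj : Function.Injective (Fin.tail η) := hη.tail.1.injective hne
    have hs : (Finset.univ : Finset (Fin (r + 1))).erase 0 = Finset.univ.image Fin.succ := by
      ext i
      simp only [Finset.mem_erase, Finset.mem_univ, and_true, Finset.mem_image, true_and]
      exact ⟨fun h => ⟨i.pred h, Fin.succ_pred i h⟩, by rintro ⟨k, rfl⟩; exact Fin.succ_ne_zero k⟩
    have hsucc : ∀ α : Finset (Fin r), (α.image Fin.succ).biUnion η = α.biUnion (Fin.tail η) := by
      intro α; rw [Finset.image_biUnion]; rfl
    rw [jPTCF, sum_finpartition_signed (fun J => corr φ β z j (J.biUnion η)) Finset.univ 0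
      (Finset.mem_univ 0), hs, sum_powerset_image _ (Fin.succ_injective r), trunc,
      sum_powerset_image _ hinj]
    refine Finset.sum_congr rfl fun α _ => ?_
    rw [Finset.biUnion_insert, hsucc, pts_image, ← Finset.image_sdiff _ _ (Fin.succ_injective r),
      ← Finset.image_sdiff _ _ hinj]
    congr 1
    rw [convInv_image (fun J : Finset (Fin r) => corr φ β z j (J.biUnion (Fin.tail η))) _ _ _
        (Fin.succ_injective r).injOn fun U _ => by rw [hsucc],
      convInv_image (fun J : Finset (Fin r) => corr φ β z j (J.biUnion (Fin.tail η))) _ _ _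
        hinj.injOn fun U _ => by rw [pts_image]]
  · rw [jPTCF, sum_finpartition_signed (fun J => corr φ β z j (J.biUnion η)) Finset.univ i.succ
      (Finset.mem_univ _)]
    have h1 : ∀ U : Finset (Fin (r + 1)), (insert i.succ U).biUnion η = U.biUnion η := by
      intro U; rw [Finset.biUnion_insert, hi, Finset.empty_union]
    simp only [h1]
    rw [sum_powerset_mul_convInv (fun J => corr φ β z j (J.biUnion η)) (by simpa using h0), if_neg]
    have : (0 : Fin (r + 1)) ∈ Finset.univ.erase i.succ :=
      Finset.mem_erase.2 ⟨(Fin.succ_ne_zero i).symm, Finset.mem_univ _⟩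
    exact Finset.ne_empty_of_mem this

end TruncatedCorrelations

/-! ### The kernels and their recursion. -/

section Kernels

variable {d : ℕ} {φ : ℝ → EReal} {β B z : ℝ}

/-- The kernels `T_m`. -/
noncomputable def kernelT (φ : ℝ → EReal) (β z : ℝ) : KernelFamily d
  | 0, _, _ => 0
  | r + 1, η, γ =>
    if DisjointClusters η ∧ Disjoint γ (allPts η) ∧ ∀ i : Fin r, (η i.succ).Nonempty then
      kern φ β (fun _ => z) (η 0) (Finset.univ.image (Fin.tail η)) γ
    else 0

lemma kernelT_eq {r : ℕ} {η : Fin (r + 1) → Finset (Pt d)} {γ : Finset (Pt d)}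
    (hη : DisjointClusters η) (hγ : Disjoint γ (allPts η))
    (hne : ∀ i : Fin r, (η i.succ).Nonempty) :
    kernelT φ β z (r + 1) η γ =
      kern φ β (fun _ => z) (η 0) (Finset.univ.image (Fin.tail η)) γ := by
  rw [kernelT, if_pos ⟨hη, hγ, hne⟩]

lemma kernelT_zero {r : ℕ} {η : Fin (r + 1) → Finset (Pt d)} {i : Fin r} (hi : η i.succ = ∅)
    (γ : Finset (Pt d)) : kernelT φ β z (r + 1) η γ = 0 := by
  rw [kernelT, if_neg]
  rintro ⟨-, -, h⟩
  exact (h i).ne_empty hi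

lemma union_pts_tail {r : ℕ} (η : Fin (r + 1) → Finset (Pt d)) :
    η 0 ∪ pts (Finset.univ.image (Fin.tail η)) = allPts η := by
  rw [pts_image_univ, ← allPts_eq_union_tail]

lemma kern_empty (ζ : Pt d → ℝ) (S : Finset (Finset (Pt d))) (γ : Finset (Pt d)) :
    kern φ β ζ ∅ S γ = if S = ∅ ∧ γ = ∅ then 1 else 0 := by
  rw [kern, trunc_empty_left _ (gibbs_empty β)]
  simp only [Finset.union_eq_empty, singles, Finset.image_eq_empty]
  split_ifs with h
  · obtain ⟨rfl, rfl⟩ := h; simp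
  · simp

lemma kernelT_consRest {r : ℕ} {A γ : Finset (Pt d)} {η : Fin r → Finset (Pt d)}
    {I : Finset (Fin r)} (hη : DisjointClusters η) (hne : ∀ i, (η i).Nonempty)
    (hA : ∀ i ∉ I, Disjoint A (η i)) (hγA : Disjoint γ A) (hγ : Disjoint γ (allPts η)) :
    kernelT φ β z (Iᶜ.card + 1) (consRest A η I) γ =
      kern φ β (fun _ => z) A (Finset.univ.image η \ I.image η) γ := by
  rw [kernelT_eq (disjointClusters_consRest hη hA), image_tail_consRest,
    ← Finset.image_sdiff _ _ (hη.injective hne)]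
  · congr 1
  · rw [← union_pts_tail, image_tail_consRest, pts_image]
    refine Finset.disjoint_union_right.2 ⟨hγA, hγ.mono_right ?_⟩
    exact Finset.biUnion_subset_biUnion_of_subset_left η (Finset.subset_univ _)
  · intro k
    rw [consRest_succ]
    exact hne _

/-- The block recursion holds for every removed point, in particular for the one chosen by `sel`.
This is why a single family satisfies the kernel equations of all selections. -/
lemma isKernel_kernelT (hr : Regime d φ β B z) {sel : Finset (Pt d) → Pt d}
    (hsel : IsSelection φ B sel) : IsKernel φ β z sel (kernelT φ β z) := by
  refine ⟨fun m η γ h => ?_, ?_, fun γ hγ => ?_, fun m hm η γ ⟨i, hi⟩ => ?_, fun r η γ hη hγ h0 => ?_⟩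
  · cases m with
    | zero => rfl
    | succ r => rw [kernelT, if_neg fun h' => h h'.2.1]
  · rw [kernelT_eq (fun _ _ _ => Finset.disjoint_empty_left _) (Finset.disjoint_empty_left _)
      fun i => i.elim0, kern_empty]
    simp
  · rw [kernelT]
    split_ifs
    · rw [kern_empty, if_neg fun h => hγ.ne_empty h.2]
    · rfl
  · obtain ⟨r, rfl⟩ : ∃ r, m = r + 1 := ⟨m - 1, by omega⟩
    induction i using Fin.cases with
    | zero =>
      rw [kernelT]
      split_ifs
      · rw [hi, kern_empty, if_neg]
        rintro ⟨h, -⟩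
        rw [Finset.image_eq_empty, Finset.univ_eq_empty_iff] at h
        exact h.false ⟨0, by omega⟩
      · rfl
    | succ i => exact kernelT_zero hi γ
  · have hx := (hsel _ h0).1
    set x := sel (η 0)
    obtain ⟨ht, ht0⟩ := hη.tail
    have htail : allPts (Fin.tail η) ⊆ allPts η := by
      rw [allPts_eq_union_tail η]; exact Finset.subset_union_right
    by_cases hne : ∀ i : Fin r, (η i.succ).Nonempty
    · have hterm : ∀ ξ ∈ γ.powerset, ∑ I : Finset (Fin r), ∑ ζ ∈ starSubsets (Fin.tail η) I,
          kerK φ β x (ζ ∪ ξ) * kernelT φ β z (Iᶜ.card + 1)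
            (consRest ((η 0).erase x ∪ I.biUnion (Fin.tail η) ∪ ξ) (Fin.tail η) I) (γ \ ξ) =
          ∑ U ∈ (Finset.univ.image (Fin.tail η)).powerset,
            (∏ C ∈ U, absorbWeight (fun x y => bond φ β x y - 1) x C) *
            (kerK φ β x ξ * kern φ β (fun _ => z) ((η 0).erase x ∪ pts U ∪ ξ)
              (Finset.univ.image (Fin.tail η) \ U) (γ \ ξ)) := by
        intro ξ hξ
        have hξ := Finset.mem_powerset.1 hξ
        rw [← sum_starSubsets ht hne x fun U => kerK φ β x ξ * kern φ β (fun _ => z)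
          ((η 0).erase x ∪ pts U ∪ ξ) (Finset.univ.image (Fin.tail η) \ U) (γ \ ξ)]
        refine Finset.sum_congr rfl fun I _ => Finset.sum_congr rfl fun ζ hζ => ?_
        have hγ' : Disjoint (γ \ ξ) (allPts η) := hγ.mono_left Finset.sdiff_subset
        have hI : I.biUnion (Fin.tail η) ⊆ allPts η :=
          (Finset.biUnion_subset_biUnion_of_subset_left _ (Finset.subset_univ I)).trans htail
        have hA0 : (η 0).erase x ⊆ allPts η := (Finset.erase_subset _ _).trans (subset_allPts η 0)
        rw [kerK_union x ((hγ.mono hξ ((starSubsets_subset hζ).trans htail)).symm),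
          kernelT_consRest ht hne
            (disjoint_rest hη (Finset.erase_subset _ _) (hγ.mono_left hξ)) ?_
            (hγ'.mono_right htail), pts_image, mul_assoc]
        exact Finset.disjoint_union_right.2 ⟨hγ'.mono_right (Finset.union_subset hA0 hI),
          Finset.sdiff_disjoint⟩
      rw [kernelT_eq hη hγ hne, kern_step hr _ (blockSystem_clusters hη hne)
        (by rwa [union_pts_tail]) hx, Finset.sum_congr rfl hterm, boltz_energyW hr.pot hr.beta,
        Finset.sum_comm]
      simp only [Finset.mul_sum]
    · push Not at hne
      obtain ⟨i, hi⟩ := hne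
      rw [kernelT_zero hi, Finset.sum_eq_zero, mul_zero]
      intro ξ _
      refine Finset.sum_eq_zero fun I _ => ?_
      by_cases hiI : i ∈ I
      · rw [starSubsets_eq_empty hiI hi, Finset.sum_empty]
      · refine Finset.sum_eq_zero fun ζ _ => ?_
        obtain ⟨k, hk⟩ := exists_consRest_eq (A := (η 0).erase x ∪ I.biUnion (Fin.tail η) ∪ ξ)
          (η := Fin.tail η) hiI
        rw [kernelT_zero (hk.trans hi), mul_zero]

/-- The selected point disappears from the union of all clusters and γ at each recursion step, and
no point is added; the initial conditions settle an empty first cluster. -/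
lemma IsKernel.unique {sel : Finset (Pt d) → Pt d} (hsel : ∀ A : Finset (Pt d), A.Nonempty → sel A ∈ A)
    {T T' : KernelFamily d} (h : IsKernel φ β z sel T) (h' : IsKernel φ β z sel T') (r : ℕ)
    (η : Fin (r + 1) → Finset (Pt d)) (hη : DisjointClusters η) (γ : Finset (Pt d)) :
    T' (r + 1) η γ = T (r + 1) η γ := by
  induction hN : (allPts η ∪ γ).card using Nat.strong_induction_on generalizing r η γ with
  | _ N ih =>
    by_cases hγ : Disjoint γ (allPts η)
    swap
    · rw [h.overlap _ _ _ hγ, h'.overlap _ _ _ hγ]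
    rcases (η 0).eq_empty_or_nonempty with h0 | h0
    · rcases Nat.eq_zero_or_pos r with rfl | hr0
      · have he : η = fun _ => ∅ := by
          funext i; exact Fin.cases h0 (fun i => i.elim0) i
        subst he
        rcases γ.eq_empty_or_nonempty with rfl | hγ'
        · exact h'.one_empty.trans h.one_empty.symm
        · exact (h'.one_empty_of_nonempty γ hγ').trans (h.one_empty_of_nonempty γ hγ').symm
      · rw [h.some_empty _ (by omega) _ _ ⟨0, h0⟩, h'.some_empty _ (by omega) _ _ ⟨0, h0⟩]
    · have hx := hsel _ h0
      rw [h.recursion r η γ hη hγ h0, h'.recursion r η γ hη hγ h0]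
      set x := sel (η 0)
      congr 1
      refine Finset.sum_congr rfl fun ξ hξ => Finset.sum_congr rfl fun I _ =>
        Finset.sum_congr rfl fun ζ _ => ?_
      have hξ := Finset.mem_powerset.1 hξ
      have hD := disjointClusters_consRest hη.tail.1
        (disjoint_rest hη (I := I) (Finset.erase_subset x _) (hγ.mono_left hξ))
      congr 1
      refine ih _ ?_ _ _ hD _ rfl
      rw [← hN]
      refine Finset.card_lt_card ((Finset.ssubset_iff_of_subset ?_).2 ⟨x, ?_, ?_⟩)
      · rw [← union_pts_tail, image_tail_consRest, pts_image, allPts_eq_union_tail η]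
        intro y hy
        have e1 : ∀ J : Finset (Fin r), y ∈ J.biUnion (Fin.tail η) → y ∈ allPts (Fin.tail η) :=
          fun J hJ => Finset.biUnion_subset_biUnion_of_subset_left _ (Finset.subset_univ J) hJ
        have e2 := e1 I
        have e3 := e1 Iᶜ
        have e4 := @hξ y
        simp only [consRest, Fin.cons_zero, Finset.mem_union, Finset.mem_erase,
          Finset.mem_sdiff] at hy ⊢
        tauto
      · exact Finset.mem_union_left _ (subset_allPts η 0 hx)
      · rw [← union_pts_tail, image_tail_consRest, pts_image]
        have hxt : ∀ J : Finset (Fin r), x ∉ J.biUnion (Fin.tail η) := by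
          intro J hJ
          obtain ⟨i, -, hi⟩ := Finset.mem_biUnion.1 hJ
          exact Finset.disjoint_left.1 (hη.tail.2 i) hx hi
        have hxγ : x ∉ γ := fun h' => Finset.disjoint_left.1 hγ h' (subset_allPts η 0 hx)
        have e2 := hxt I
        have e3 := hxt Iᶜ
        have e4 : x ∉ ξ := fun h' => hxγ (hξ h')
        simp only [consRest, Fin.cons_zero, Finset.mem_union, Finset.mem_erase,
          Finset.mem_sdiff]
        tauto

end Kernels

end PTCF

namespace PTCF

/-! ### Properties of the kernels and of the truncated correlation functions. -/

section MainProperties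

variable {d : ℕ} {φ : ℝ → EReal} {β B z : ℝ}

lemma isActivity_const (hr : Regime d φ β B z) : IsActivity (d := d) z fun _ => z :=
  ⟨measurable_const, fun _ => hr.pos.le, fun _ => le_rfl⟩

lemma IsCutoff.isActivity (hr : Regime d φ β B z) {j : Pt d → ℝ} (hj : IsCutoff j) :
    IsActivity z fun x => z * j x :=
  ⟨measurable_const.mul hj.smooth.continuous.measurable, fun x => mul_nonneg hr.pos.le (hj.nonneg x),
    fun x => mul_le_of_le_one_right hr.pos.le (hj.le_one x)⟩

lemma IsCutoff.integrable {j : Pt d → ℝ} (hj : IsCutoff j) (z : ℝ) :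
    Integrable fun x => z * j x :=
  (hj.smooth.continuous.integrable_of_hasCompactSupport hj.compact).const_mul z

lemma LPIntegrable.congr_ae {F G : Finset (Pt d) → ℝ} (hF : LPIntegrable F)
    (h : ∀ᵐ τ ∂(lpMeasure d), F (conf τ) = G (conf τ)) : LPIntegrable G :=
  integrable_lp_iff.1 ((integrable_lp_iff.2 hF).congr h)

lemma lpIntegrable_zero : LPIntegrable (d := d) fun _ => 0 :=
  integrable_lp_iff.1 (integrable_zero _ _ _)

/-- A cut-off acts as a position dependent activity z j(x), so the bounds for general activities
cover it. -/
lemma chi_mul_kern (j : Pt d → ℝ) (A : Finset (Pt d)) (S : Finset (Finset (Pt d)))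
    (γ : Finset (Pt d)) :
    chi j (A ∪ pts S ∪ γ) * kern φ β (fun _ => z) A S γ = kern φ β (fun x => z * j x) A S γ := by
  rw [chi, kern, kern, Finset.prod_mul_distrib]
  ring

lemma kern_ae_eq (hd : 1 ≤ d) {j : Pt d → ℝ} {r : ℕ} {η : Fin (r + 1) → Finset (Pt d)}
    (hη : DisjointClusters η) (hne : ∀ i : Fin r, (η i.succ).Nonempty) :
    ∀ᵐ τ ∂(lpMeasure d), kern φ β (fun x => z * j x) (η 0) (Finset.univ.image (Fin.tail η))
      (conf τ) = chi j (allPts η ∪ conf τ) * kernelT φ β z (r + 1) η (conf τ) := by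
  filter_upwards [ae_conf_disjoint hd (allPts η)] with τ hτ
  rw [kernelT_eq hη hτ hne, ← union_pts_tail, chi_mul_kern]

lemma represents_kernelT (hd : 1 ≤ d) (j : Pt d → ℝ) :
    Represents (fun k η => lpIntegral 1 fun γ => chi j (allPts η ∪ γ) * kernelT φ β z k η γ)
      (kernInt φ β fun x => z * j x) := by
  refine ⟨fun r η hη hne => ?_, fun r η hη ⟨i, hi⟩ => ?_⟩
  · have h := lpIntegral_congr_ae
      (F := kern φ β (fun x => z * j x) (η 0) (Finset.univ.image (Fin.tail η)))
      (G := fun γ => chi j (allPts η ∪ γ) * kernelT φ β z (r + 1) η γ) (kern_ae_eq hd hη hne)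
    exact h.symm
  · simp only [kernelT_zero hi, mul_zero]
    simp [lpIntegral]

lemma lpIntegrable_chi_kernelT (hr : Regime d φ β B z) {j : Pt d → ℝ}
    (hj : IsActivity z fun x => z * j x) {r : ℕ} {η : Fin (r + 1) → Finset (Pt d)}
    (hη : DisjointClusters η) :
    LPIntegrable fun γ => chi j (allPts η ∪ γ) * kernelT φ β z (r + 1) η γ := by
  by_cases hne : ∀ i : Fin r, (η i.succ).Nonempty
  · exact (lpIntegrable_kern hr hj (blockSystem_clusters hη hne)).congr_ae
      (kern_ae_eq hr.dim hη hne)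
  · push Not at hne
    obtain ⟨i, hi⟩ := hne
    simp only [kernelT_zero hi, mul_zero]
    exact lpIntegrable_zero

lemma chi_one (X : Finset (Pt d)) : chi (fun _ => (1 : ℝ)) X = 1 := by simp [chi]

lemma lpIntegrable_kernelT (hr : Regime d φ β B z) {r : ℕ} {η : Fin (r + 1) → Finset (Pt d)}
    (hη : DisjointClusters η) : LPIntegrable (kernelT φ β z (r + 1) η) := by
  have := lpIntegrable_chi_kernelT hr (j := fun _ => 1) (by simpa using isActivity_const hr) hη
  simpa only [chi_one, one_mul] using this

lemma IsBlockKS.isUniqueKSSolution (hr : Regime d φ β B z) {j : Pt d → ℝ} (hj0 : ∀ x, 0 ≤ j x)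
    (hj1 : ∀ x, j x ≤ 1) {R : Finset (Pt d) → Finset (Finset (Pt d)) → ℝ}
    (hR : IsBlockKS φ β (fun x => z * j x) R) {ρ : Hierarchy d} (hρ : Represents ρ R)
    {sel : Finset (Pt d) → Pt d} (hsel : IsSelection φ B sel) (m : ℕ) :
    IsUniqueKSSolution φ β z j sel m ρ := by
  refine ⟨hR.isKSSolution hr hρ hsel m, hR.isRegularHierarchy hr hρ m,
    fun ρ' h h' k hk hkm η hη => ?_⟩
  obtain ⟨r, rfl⟩ : ∃ r, k = r + 1 := ⟨k - 1, by omega⟩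
  exact (hR.isKSSolution hr hρ hsel m).unique hr hj0 hj1 hsel (hR.isRegularHierarchy hr hρ m) h h'
    r hkm η hη

lemma isUniqueKSSolution_kernelT (hr : Regime d φ β B z) {sel : Finset (Pt d) → Pt d}
    (hsel : IsSelection φ B sel) (m : ℕ) :
    IsUniqueKSSolution φ β z (fun _ => 1) sel m fun k η => lpIntegral 1 (kernelT φ β z k η) := by
  have h1 : IsActivity (d := d) z fun _ => z * 1 := by simpa using isActivity_const hr
  have h2 := represents_kernelT (φ := φ) (β := β) (z := z) hr.dim (fun _ : Pt d => (1 : ℝ))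
  simp only [chi_one, one_mul] at h2
  exact (isBlockKS_kernInt hr h1).isUniqueKSSolution hr (fun _ => zero_le_one) (fun _ => le_rfl)
    h2 hsel m

lemma represents_jPTCF_of_isCutoff (hr : Regime d φ β B z) {j : Pt d → ℝ} (hj : IsCutoff j) :
    Represents (jPTCF φ β z j) (trunc (corr φ β z j)) := by
  refine represents_jPTCF j ?_
  have := (isBlockKS_trunc_corr hr (hj.isActivity hr) (hj.integrable z)).base ∅
  simpa using this

lemma isUniqueKSSolution_jPTCF (hr : Regime d φ β B z) {j : Pt d → ℝ} (hj : IsCutoff j)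
    {sel : Finset (Pt d) → Pt d} (hsel : IsSelection φ B sel) (m : ℕ) :
    IsUniqueKSSolution φ β z j sel m (jPTCF φ β z j) :=
  (isBlockKS_trunc_corr hr (hj.isActivity hr) (hj.integrable z)).isUniqueKSSolution hr hj.nonneg
    hj.le_one (represents_jPTCF_of_isCutoff hr hj) hsel m

/-- Both sides are regular solutions of the same system with cut-off j; any one selection suffices
for the comparison. -/
lemma jPTCF_eq (hr : Regime d φ β B z) {j : Pt d → ℝ} (hj : IsCutoff j) {r : ℕ}
    {η : Fin (r + 1) → Finset (Pt d)} (hη : DisjointClusters η) :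
    jPTCF φ β z j (r + 1) η =
      lpIntegral 1 fun γ => chi j (allPts η ∪ γ) * kernelT φ β z (r + 1) η γ := by
  obtain ⟨sel, hsel⟩ := exists_selection hr.pot hr.stable
  have h := (isBlockKS_kernInt hr (hj.isActivity hr)).isUniqueKSSolution hr hj.nonneg hj.le_one
    (represents_kernelT hr.dim j) hsel (r + 1)
  have h' := isUniqueKSSolution_jPTCF hr hj hsel (r + 1)
  exact h.2.2 _ h'.1 h'.2.1 (r + 1) (by omega) le_rfl η hη

/-- The integrand χ_j T_m is dominated by |T_m|, which is integrable by the bound at j = 1 and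
independent of the cut-off. -/
lemma tendsto_jPTCF (hr : Regime d φ β B z) {J : ℕ → Pt d → ℝ} (hJ : ∀ k, IsCutoff (J k))
    (hlim : ∀ x, Tendsto (fun k => J k x) atTop (𝓝 1)) {r : ℕ}
    {η : Fin (r + 1) → Finset (Pt d)} (hη : DisjointClusters η) :
    Tendsto (fun k => jPTCF φ β z (J k) (r + 1) η) atTop
      (𝓝 (lpIntegral 1 (kernelT φ β z (r + 1) η))) := by
  have hi := fun k => lpIntegrable_chi_kernelT hr ((hJ k).isActivity hr) hη
  simp only [jPTCF_eq hr (hJ _) hη, integral_lp (hi _)]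
  rw [integral_lp (lpIntegrable_kernelT hr hη)]
  refine tendsto_integral_of_dominated_convergence
    (fun τ => |kernelT φ β z (r + 1) η (conf τ)|) (fun k => (integrable_lp_iff.2 (hi k)).1)
    (integrable_lp_iff.2 (lpIntegrable_kernelT hr hη)).abs
    (fun k => Eventually.of_forall fun τ => ?_) (Eventually.of_forall fun τ => ?_)
  · rw [Real.norm_eq_abs, abs_mul]
    refine mul_le_of_le_one_left (abs_nonneg _) ?_
    rw [chi, abs_of_nonneg (Finset.prod_nonneg fun x _ => (hJ k).nonneg x)]
    exact Finset.prod_le_one (fun x _ => (hJ k).nonneg x) fun x _ => (hJ k).le_one x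
  · have h1 : Tendsto (fun k => chi (J k) (allPts η ∪ conf τ)) atTop (𝓝 1) := by
      have := tendsto_finsetProd (allPts η ∪ conf τ) fun x _ => hlim x
      simpa [chi] using this
    simpa using h1.mul_const (kernelT φ β z (r + 1) η (conf τ))

lemma prod_const_allPts {r : ℕ} {η : Fin (r + 1) → Finset (Pt d)} {γ : Finset (Pt d)}
    (hη : DisjointClusters η) (hγ : Disjoint γ (allPts η)) (z : ℝ) :
    ∏ _x ∈ η 0 ∪ pts (Finset.univ.image (Fin.tail η)) ∪ γ, z =
      z ^ (∑ i, (η i).card + γ.card) := by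
  rw [Finset.prod_const, union_pts_tail, Finset.card_union_of_disjoint hγ.symm,
    sum_card_eq_card_allPts hη]

/-- Truncation and explored forest sum satisfy the same recursion along `sel`, hence they agree by
`ClusterRec.unique`. -/
lemma kernelT_eq_sum_forests (hr : Regime d φ β B z) {sel : Finset (Pt d) → Pt d}
    (hsel : IsSelection φ B sel) {r : ℕ} {η : Fin (r + 1) → Finset (Pt d)} {γ : Finset (Pt d)}
    (hη : DisjointClusters η) (hne : ∀ i, (η i).Nonempty) (hγ : Disjoint γ (allPts η)) :
    kernelT φ β z (r + 1) η γ = ∑ f ∈ forests η γ, forestTerm φ β z sel η γ f := by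
  have hBS := blockSystem_tailBlocks hη (fun i => hne i.succ) hγ
  have hu := ((gibbs_clusterRec hr.pot hr.beta).mono (Q' := fun A x => x = sel A)
    fun _ _ _ => trivial).unique
    (exploredForestSum_clusterRec (bond φ β) (fun x y => bond φ β x y - 1)
      (onPair fun r => boltz β (φ r)) (onPair (mayer φ β)) (fun _ _ => rfl) (fun _ _ => rfl) sel
      fun A hA => (hsel A hA).1)
    (fun A hA => ⟨sel A, (hsel A hA).1, rfl⟩) _ _ hBS
  rw [kernelT_eq hη hγ fun i => hne i.succ, kern, prod_const_allPts hη hγ]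
  change _ * trunc (gibbs φ β) (η 0) (tailBlocks (Fin.tail η) γ) = _
  rw [hu, Finset.mul_sum, forests_eq_parentForests hη hne hγ]
  refine Finset.sum_congr rfl fun f _ => ?_
  rw [forestTerm, addedEdges_eq_explore hη hne hγ, mul_assoc]

lemma majorantCoeff_eq {r : ℕ} {η : Fin (r + 1) → Finset (Pt d)} {γ : Finset (Pt d)}
    (hη : DisjointClusters η) (hne : ∀ i, (η i).Nonempty) (hγ : Disjoint γ (allPts η)) :
    majorantCoeff φ β B η γ = Real.exp (2 * β * B) ^ (∑ i, (η i).card + γ.card) *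
      forestNu φ β (η 0) (Finset.univ.image (Fin.tail η) ∪ singles γ) := by
  rw [majorantCoeff, forests_eq_parentForests hη hne hγ]
  rfl

lemma card_clusters {r : ℕ} {η : Fin (r + 1) → Finset (Pt d)} (hη : DisjointClusters η) :
    (η 0).card + (pts (Finset.univ.image (Fin.tail η))).card = ∑ i, (η i).card := by
  rw [sum_card_eq_card_allPts hη, ← union_pts_tail, Finset.card_union_of_disjoint]
  rw [pts_image_univ, allPts, Finset.disjoint_biUnion_right]
  exact fun i _ => hη.tail.2 i

lemma abs_kernelT_le (hr : Regime d φ β B z) {r : ℕ} {η : Fin (r + 1) → Finset (Pt d)}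
    {γ : Finset (Pt d)} (hη : DisjointClusters η) (hne : ∀ i, (η i).Nonempty)
    (hγ : Disjoint γ (allPts η)) :
    |kernelT φ β z (r + 1) η γ| ≤
      majorantCoeff φ β B η γ * z ^ (∑ i, (η i).card + γ.card) := by
  rw [kernelT_eq hη hγ fun i => hne i.succ, majorantCoeff_eq hη hne hγ]
  refine (abs_kern_le hr (isActivity_const hr) (blockSystem_clusters hη fun i => hne i.succ)
    (by rwa [union_pts_tail])).trans (le_of_eq ?_)
  rw [card_clusters hη]
  ring

lemma majorantCoeff_ae_eq (hd : 1 ≤ d) {r : ℕ} {η : Fin (r + 1) → Finset (Pt d)}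
    (hη : DisjointClusters η) (hne : ∀ i, (η i).Nonempty) (n : ℕ) :
    ∀ᵐ x : Fin n → Pt d, Real.exp (2 * β * B) ^ (∑ i, (η i).card + n) *
      forestNu φ β (η 0) (Finset.univ.image (Fin.tail η) ∪ singles (Finset.univ.image x)) =
      majorantCoeff φ β B η (Finset.univ.image x) := by
  filter_upwards [ae_isGeneric hd (allPts η)] with x hx
  rw [majorantCoeff_eq hη hne (hx.disjoint_image _), Finset.card_image_of_injective _ hx.1,
    Finset.card_univ, Fintype.card_fin]

lemma integrable_majorantCoeff (hr : Regime d φ β B z) {r : ℕ}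
    {η : Fin (r + 1) → Finset (Pt d)} (hη : DisjointClusters η) (hne : ∀ i, (η i).Nonempty)
    (n : ℕ) :
    Integrable fun x : Fin n → Pt d => majorantCoeff φ β B η (Finset.univ.image x) := by
  have hBS := blockSystem_clusters hη fun i => hne i.succ
  have h1 : Integrable fun x : Fin n → Pt d => forestNu φ β (η 0)
      (Finset.univ.image (Fin.tail η) ∪ singles (Finset.univ.image x)) := by
    refine ⟨?_, ?_⟩
    · have := (forestNu_clusterRec.jointMeas hr.dim measurable_const
        (measurable_nu_sub hr.pot hr.beta) hBS).aemeasurable_right n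
      simp only [Finset.union_empty] at this
      exact this.aestronglyMeasurable
    · rw [hasFiniteIntegral_iff_ofReal (Eventually.of_forall fun x => forestNu_nonneg _ _)]
      exact (lintegral_forestNu_le_crude hr.dim hr.pot hr.beta n _ _ hBS).trans_lt
        ENNReal.ofReal_lt_top
  exact (h1.const_mul _).congr (majorantCoeff_ae_eq hr.dim hη hne n)

lemma summable_majorantCoeff (hr : Regime d φ β B z) {r : ℕ}
    {η : Fin (r + 1) → Finset (Pt d)} (hη : DisjointClusters η) (hne : ∀ i, (η i).Nonempty) :
    Summable fun n : ℕ => (1 / (n.factorial : ℝ) *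
      ∫ x : Fin n → Pt d, majorantCoeff φ β B η (Finset.univ.image x)) *
        z ^ (∑ i, (η i).card + n) := by
  have hBS := blockSystem_clusters hη fun i => hne i.succ
  have hz := hr.pos
  let F : Finset (Pt d) → ℝ := fun γ => (z * Real.exp (2 * β * B)) ^
    ((η 0).card + (pts (Finset.univ.image (Fin.tail η))).card + γ.card) *
      forestNu φ β (η 0) (Finset.univ.image (Fin.tail η) ∪ singles γ)
  have hF0 : ∀ γ, 0 ≤ F γ := fun γ => mul_nonneg (by positivity) (forestNu_nonneg _ _)
  have hae : ∀ n : ℕ, ∀ᵐ x : Fin n → Pt d, F (Finset.univ.image x) =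
      z ^ (∑ i, (η i).card + n) * majorantCoeff φ β B η (Finset.univ.image x) := by
    intro n
    filter_upwards [majorantCoeff_ae_eq (φ := φ) (β := β) (B := B) hr.dim hη hne n,
      ae_isGeneric hr.dim ∅] with x hx hx'
    rw [← hx]
    simp only [F]
    rw [card_clusters hη, Finset.card_image_of_injective _ hx'.1, Finset.card_univ,
      Fintype.card_fin, mul_pow, mul_assoc]
  have hF : LPIntegrable F := by
    refine integrable_lp_iff.1 ⟨aestronglyMeasurable_lp.2 fun n => ?_, ?_⟩
    · exact (((integrable_majorantCoeff hr hη hne n).const_mul _).congr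
        ((hae n).mono fun x hx => hx.symm)).1
    · rw [hasFiniteIntegral_iff_ofReal (Eventually.of_forall fun x => hF0 _)]
      exact (lintegral_lp_forestNu_le hr hBS).trans_lt ENNReal.ofReal_lt_top
  refine hF.2.congr fun n => ?_
  simp only [abs_of_nonneg (hF0 _)]
  rw [integral_congr_ae (hae n), integral_const_mul]
  ring

lemma abs_lpIntegral_kernelT_le (hr : Regime d φ β B z) {r : ℕ} (hr1 : 1 ≤ r)
    {η : Fin (r + 1) → Finset (Pt d)} (hη : DisjointClusters η) :
    |lpIntegral 1 (kernelT φ β z (r + 1) η)| ≤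
      (2 * z * Real.exp (2 * β * B + 1)) ^ (∑ i, (η i).card) *
        nu0Tilde d φ β ^ ((∑ i, (η i).card) - (η 0).card) *
        ((∑ i, (η i).card : ℕ) : ℝ) ^ (r + 1 - 2) *
        ∑' n : ℕ, (z * Real.exp (2 * β * B + 2) * nu1 d φ β) ^ n := by
  have hn1 : 0 < nu1 d φ β := nu1_pos hr.pot hr.beta
  have hn0 := one_le_nu0Tilde (d := d) (φ := φ) (β := β)
  have hz := hr.pos
  have hq : 0 ≤ z * Real.exp (2 * β * B + 2) * nu1 d φ β := by positivity
  rw [tsum_geometric_of_lt_one hq hr.small]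
  have hinv : 0 < (1 - z * Real.exp (2 * β * B + 2) * nu1 d φ β)⁻¹ :=
    inv_pos.2 (by linarith [hr.small])
  -- Only the later clusters matter here: the sharp forest bound needs at least one block, and it
  -- permits an empty root.
  by_cases hne : ∀ i : Fin r, (η i.succ).Nonempty
  swap
  · push Not at hne
    obtain ⟨i, hi⟩ := hne
    rw [lpIntegral_eq_zero (Eventually.of_forall fun τ => kernelT_zero hi _), abs_zero]
    positivity
  have hBS := blockSystem_clusters hη hne
  have hSne : (Finset.univ.image (Fin.tail η)).Nonempty := ⟨_, Finset.mem_image_of_mem _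
    (Finset.mem_univ ⟨0, hr1⟩)⟩
  have hScard : (Finset.univ.image (Fin.tail η)).card = r := by
    rw [Finset.card_image_of_injective _ (hη.tail.1.injective hne), Finset.card_univ,
      Fintype.card_fin]
  rw [integral_lp (lpIntegrable_kernelT hr hη)]
  refine abs_integral_le_of_lintegral_le (by positivity) ?_
  have hle : ∫⁻ τ, ENNReal.ofReal |kernelT φ β z (r + 1) η (conf τ)| ∂(lpMeasure d) ≤ _ :=
    le_trans (lintegral_mono_ae (by
      filter_upwards [ae_conf_disjoint hr.dim (allPts η)] with τ hτ
      rw [kernelT_eq hη hτ hne]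
      exact ENNReal.ofReal_le_ofReal (abs_kern_le hr (isActivity_const hr) hBS
        (by rwa [union_pts_tail]))))
      (lintegral_lp_forestNu_le_of hr (by positivity) fun n =>
        lintegral_forestNu_le_sharp hr.dim hr.pot hr.beta n _ _ hBS hSne)
  refine hle.trans (ENNReal.ofReal_le_ofReal (le_of_eq ?_))
  have hP : (pts (Finset.univ.image (Fin.tail η))).card = ∑ i, (η i).card - (η 0).card := by
    have := card_clusters hη; omega
  have e1 : Real.exp (2 * β * B + 1) = Real.exp (2 * β * B) * Real.exp 1 := Real.exp_add _ _
  rw [card_clusters hη, hScard, hP, e1]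
  have : r + 1 - 2 = r - 1 := by omega
  rw [this]
  simp only [mul_pow]
  ring

end MainProperties

end PTCF



/-! ### Assembly of the main theorem. -/

theorem mainTheorem1 (d : ℕ) (hd : 1 ≤ d) (φ : ℝ → EReal) (hφ : AssumptionA d φ)
    (β : ℝ) (hβ : 0 < β) :
    -- stability and regularity hold, so that the constants below are meaningful
    (∃ B : ℝ, 0 ≤ B ∧ IsStable d φ B) ∧
    Integrable (nu d φ β) ∧ 0 < nu1 d φ β ∧ BddAbove (Set.range (nu d φ β)) ∧
    ∀ B z : ℝ, 0 ≤ B → IsStable d φ B → 0 < z →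
      z * Real.exp (2 * β * B + 2) * nu1 d φ β < 1 →
      (∃ sel : Finset (Pt d) → Pt d, IsSelection φ B sel) ∧
      ∃ T : KernelFamily d,
        -- `T` is the unique solution of the recursion relations for the kernels
        (∀ sel, IsSelection φ B sel → IsKernel φ β z sel T ∧
          ∀ T' : KernelFamily d, IsKernel φ β z sel T' →
            ∀ m, 1 ≤ m → ∀ η : Fin m → Finset (Pt d), DisjointClusters η →
              ∀ γ, T' m η γ = T m η γ) ∧
        -- the kernels are integrable
        (∀ m, 1 ≤ m → ∀ η : Fin m → Finset (Pt d), DisjointClusters η →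
          LPIntegrable (T m η)) ∧
        -- forest graph expansion of the kernels
        (∀ sel, IsSelection φ B sel → ∀ (m : ℕ) [NeZero m], 2 ≤ m →
          ∀ (η : Fin m → Finset (Pt d)) (γ : Finset (Pt d)), DisjointClusters η →
            (∀ i, (η i).Nonempty) → Disjoint γ (allPts η) →
            T m η γ = ∑ f ∈ forests η γ, forestTerm φ β z sel η γ f) ∧
        -- domination by a convergent power series in `z` with integrable coefficients
        (∀ (m : ℕ) [NeZero m], 2 ≤ m → ∀ η : Fin m → Finset (Pt d), DisjointClusters η →
          (∀ i, (η i).Nonempty) →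
          (∀ γ, Disjoint γ (allPts η) →
            |T m η γ| ≤ majorantCoeff φ β B η γ * z ^ ((∑ i, (η i).card) + γ.card)) ∧
          (∀ n : ℕ, Integrable fun x : Fin n → Pt d =>
            majorantCoeff φ β B η (Finset.univ.image x)) ∧
          Summable fun n : ℕ =>
            (1 / (n.factorial : ℝ) * ∫ x : Fin n → Pt d, majorantCoeff φ β B η (Finset.univ.image x)) *
              z ^ ((∑ i, (η i).card) + n)) ∧
        -- existence and uniqueness for the system at `j = 1`, and the form of the solution
        (∀ sel, IsSelection φ B sel → ∀ m, 2 ≤ m →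
          IsUniqueKSSolution φ β z (fun _ => 1) sel m (fun k η => lpIntegral 1 (T k η))) ∧
        -- for every cut-off `j` the `j`-PTCF are the unique solution of the system
        (∀ j : Pt d → ℝ, IsCutoff j →
          (∀ sel, IsSelection φ B sel → ∀ m, 2 ≤ m →
            IsUniqueKSSolution φ β z j sel m (jPTCF φ β z j)) ∧
          ∀ m, 1 ≤ m → ∀ η : Fin m → Finset (Pt d), DisjointClusters η →
            jPTCF φ β z j m η = lpIntegral 1 fun γ => chi j (allPts η ∪ γ) * T m η γ) ∧
        -- the thermodynamic limit `j → 1`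
        (∀ J : ℕ → Pt d → ℝ, (∀ k, IsCutoff (J k)) →
          (∀ x, Tendsto (fun k => J k x) atTop (𝓝 1)) →
          ∀ m, 2 ≤ m → ∀ η : Fin m → Finset (Pt d), DisjointClusters η →
            Tendsto (fun k => jPTCF φ β z (J k) m η) atTop (𝓝 (lpIntegral 1 (T m η)))) ∧
        -- explicit bound
        (∀ (m : ℕ) [NeZero m], 2 ≤ m → ∀ η : Fin m → Finset (Pt d), DisjointClusters η →
          |lpIntegral 1 (T m η)| ≤
            (2 * z * Real.exp (2 * β * B + 1)) ^ (∑ i, (η i).card) *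
              nu0Tilde d φ β ^ ((∑ i, (η i).card) - (η 0).card) *
              ((∑ i, (η i).card : ℕ) : ℝ) ^ (m - 2) *
              ∑' n : ℕ, (z * Real.exp (2 * β * B + 2) * nu1 d φ β) ^ n) := by
  refine ⟨exists_isStable hd hφ, integrable_nu hφ hβ, nu1_pos hφ hβ, bddAbove_nu hφ hβ,
    fun B z hB hst hz hsmall => ?_⟩
  have hr : Regime d φ β B z := ⟨hd, hφ, hβ, hB, hst, hz, hsmall⟩
  -- The witness comes from the truncated Boltzmann factor and involves no selection, so one family
  -- serves all selections.
  refine ⟨exists_selection hφ hst, kernelT φ β z, fun sel hsel => ⟨isKernel_kernelT hr hsel, ?_⟩,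
    ?_, ?_, ?_, fun sel hsel m _ => isUniqueKSSolution_kernelT hr hsel m, fun j hj =>
    ⟨fun sel hsel m _ => isUniqueKSSolution_jPTCF hr hj hsel m, ?_⟩, ?_, ?_⟩
  · intro T' hT' m hm η hη γ
    obtain ⟨r, rfl⟩ : ∃ r, m = r + 1 := ⟨m - 1, by omega⟩
    exact (isKernel_kernelT hr hsel).unique (fun A hA => (hsel A hA).1) hT' r η hη γ
  · intro m hm η hη
    obtain ⟨r, rfl⟩ : ∃ r, m = r + 1 := ⟨m - 1, by omega⟩
    exact lpIntegrable_kernelT hr hη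
  · intro sel hsel m _ hm η γ hη hne hγ
    obtain ⟨r, rfl⟩ : ∃ r, m = r + 1 := ⟨m - 1, by omega⟩
    exact kernelT_eq_sum_forests hr hsel hη hne hγ
  · intro m _ hm η hη hne
    obtain ⟨r, rfl⟩ : ∃ r, m = r + 1 := ⟨m - 1, by omega⟩
    exact ⟨fun γ hγ => abs_kernelT_le hr hη hne hγ, integrable_majorantCoeff hr hη hne,
      summable_majorantCoeff hr hη hne⟩
  · intro m hm η hη
    obtain ⟨r, rfl⟩ : ∃ r, m = r + 1 := ⟨m - 1, by omega⟩
    exact jPTCF_eq hr hj hη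
  · intro J hJ hlim m hm η hη
    obtain ⟨r, rfl⟩ : ∃ r, m = r + 1 := ⟨m - 1, by omega⟩
    exact tendsto_jPTCF hr hJ hlim hη
  · intro m _ hm η hη
    obtain ⟨r, rfl⟩ : ∃ r, m = r + 1 := ⟨m - 1, by omega⟩
    exact abs_lpIntegral_kernelT_le hr (by omega) hη
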